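/- A graph is a finite undirected multigraph; parallel edges and loops are allowed, and a loop contributes $2$ to the degree of its vertex. An Eulerian graph is a connected graph all of whose vertices have even degree; a graph is $4$-regular if every vertex has degree $4$. An Eulerian tour of a graph $G$ is a closed trail $v_0,e_1,v_1,\dots,e_\ell,v_\ell=v_0$ that travels every edge of $G$ exactly once; the two directions in which a loop can be travelled are distinguished, and two tours are identified if they differ only by the choice of the starting point and by reversal of the whole tour. For a class $\mathcal C$ of graphs, #ET in $\mathcal C$ is the problem of computing, for a given $G\in\mathcal C$, the number of Eulerian tours of $G$. The graph $G$ is given as the list consisting of its number of vertices and of the two ends of each of its edges, all numbers in binary. A counting problem $A$ is polynomial-time Turing reducible to a counting problem $B$ if there are an oracle program (of a random access machine with logarithmic cost, which up to polynomial factors is an oracle Turing machine) and a polynomial $T$ such that, with every oracle that returns the correct number on every encoding of an instance of $B$, the program outputs the correct number for every instance of $A$ at cost at most $T(s)$, where $s$ is the bit length of the encoding of that instance; the bit lengths of the queries and of the answers are included in the cost. **Theorem.** #ET in Eulerian graphs is polynomial-time Turing reducible to #ET in $4$-regular graphs. -/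

import Mathlib

/-! ## Multigraphs and Eulerian tours -/

/-- A finite undirected multigraph; parallel edges and loops are allowed.
The order of the two ends of an edge carries no meaning. -/
structure Multigraph where
  numVerts : ℕ
  numEdges : ℕ
  ends : Fin numEdges → Fin numVerts × Fin numVerts

namespace Multigraph

/-- A dart is an edge with a direction of traversal (equivalently, a half-edge: the one at which
the traversal starts). A loop has two darts. -/
abbrev Dart (G : Multigraph) : Type := Fin G.numEdges × Bool

/-- The vertex at which a dart starts. -/
def src (G : Multigraph) (d : G.Dart) : Fin G.numVerts :=
  if d.2 then (G.ends d.1).2 else (G.ends d.1).1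

/-- The same edge traversed in the opposite direction. -/
def flip (G : Multigraph) (d : G.Dart) : G.Dart := (d.1, !d.2)

/-- The vertex at which a dart ends. -/
def tgt (G : Multigraph) (d : G.Dart) : Fin G.numVerts := G.src (G.flip d)

/-- The degree of a vertex; a loop counts twice. -/
def degree (G : Multigraph) (v : Fin G.numVerts) : ℕ :=
  (Finset.univ.filter fun d : G.Dart => G.src d = v).card

/-- Two vertices are adjacent in the underlying simple graph if they are distinct and joined by
at least one edge. -/
def toSimple (G : Multigraph) : SimpleGraph (Fin G.numVerts) :=
  SimpleGraph.fromRel fun u v => ∃ d : G.Dart, G.src d = u ∧ G.tgt d = v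

/-- Eulerian graphs: connected, with all degrees even. -/
def IsEulerian (G : Multigraph) : Prop :=
  G.toSimple.Connected ∧ ∀ v, Even (G.degree v)

/-- 4-regular graphs. -/
def IsFourRegular (G : Multigraph) : Prop := ∀ v, G.degree v = 4

/-- A directed Eulerian tour without a distinguished starting point: a cyclic sequence of darts,
each ending where the next one starts, that travels every edge exactly once. -/
def IsDirectedTour (G : Multigraph) (c : Cycle G.Dart) : Prop :=
  c.Chain (fun d d' => G.tgt d = G.src d') ∧
    ∀ e : Fin G.numEdges, (c.toMultiset.map Prod.fst).count e = 1

/-- A cyclic sequence of darts travelled backwards. -/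
def reverseTour (G : Multigraph) (c : Cycle G.Dart) : Cycle G.Dart := (c.map G.flip).reverse

theorem reverseTour_reverseTour (G : Multigraph) (c : Cycle G.Dart) :
    G.reverseTour (G.reverseTour c) = c := by
  induction c using Quotient.inductionOn with
  | h l =>
    have h : G.flip ∘ G.flip = id := by
      funext d; simp [flip]
    simp [reverseTour, List.map_reverse, h]

/-- Two directed tours are the same Eulerian tour if they agree up to the direction of travel. -/
def tourSetoid (G : Multigraph) : Setoid {c : Cycle G.Dart // G.IsDirectedTour c} where
  r c c' := c.1 = c'.1 ∨ c.1 = G.reverseTour c'.1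
  iseqv :=
    { refl := fun _ => Or.inl rfl
      symm := by
        rintro c c' (h | h)
        · exact Or.inl h.symm
        · exact Or.inr (by rw [h, reverseTour_reverseTour])
      trans := by
        rintro a b c (h | h) (h' | h')
        · exact Or.inl (h.trans h')
        · exact Or.inr (h.trans h')
        · exact Or.inr (by rw [h, h'])
        · exact Or.inl (by rw [h, h', reverseTour_reverseTour]) }

/-- The number of Eulerian tours, up to the choice of the starting point and the direction. -/
noncomputable def numEulerianTours (G : Multigraph) : ℕ :=
  Nat.card (Quotient G.tourSetoid)

/-- A multigraph as an input: the number of vertices, then the two ends of each edge. -/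
def encode (G : Multigraph) : List ℕ :=
  G.numVerts ::
    (List.ofFn G.ends).flatMap fun e => [(e.1 : ℕ), (e.2 : ℕ)]

theorem encode_injective : Function.Injective encode := by
  have key : ∀ {n : ℕ} (l l' : List (Fin n × Fin n)),
      (l.flatMap fun e => [(e.1 : ℕ), (e.2 : ℕ)]) =
        (l'.flatMap fun e => [(e.1 : ℕ), (e.2 : ℕ)]) → l = l' := by
    intro n l
    induction l with
    | nil => intro l' h; cases l' <;> simp_all
    | cons a l ih =>
      intro l' h
      cases l' with
      | nil => simp at h
      | cons b l' =>
        simp only [List.flatMap_cons, List.cons_append, List.nil_append, List.cons.injEq] at h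
        obtain ⟨h1, h2, h3⟩ := h
        rw [ih l' h3, Prod.ext (Fin.ext h1) (Fin.ext h2)]
  rintro ⟨n, m, f⟩ ⟨n', m', f'⟩ h
  simp only [encode, List.cons.injEq] at h
  obtain ⟨rfl, h⟩ := h
  have h := key _ _ h
  have hm : m = m' := by simpa using congrArg List.length h
  subst hm
  rw [List.ofFn_injective h]

end Multigraph

/-! ## Oracle random access machines with logarithmic cost

Programs work on finitely many arrays of natural numbers. Every operation is charged the bit
lengths of all the addresses and values that it touches, so that polynomial time here is
polynomial time on (oracle) Turing machines. -/

namespace OracleRAM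

/-- The bit length of a word of natural numbers, with one separator after each entry. -/
def wordSize (w : List ℕ) : ℕ := (w.map fun x => Nat.size x + 1).sum

/-- `s A i` is the content of cell `i` of the array `A`. -/
abbrev Store : Type := ℕ → ℕ → ℕ

/-- Overwrite one cell. -/
def Store.set (s : Store) (A i v : ℕ) : Store :=
  Function.update s A (Function.update (s A) i v)

/-- The arithmetic operations (`sub` is truncated at `0`). -/
inductive Op
  | add | sub | mul | div | mod

/-- The value of an arithmetic operation. -/
def Op.eval : Op → ℕ → ℕ → ℕ
  | .add, a, b => a + b
  | .sub, a, b => a - b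
  | .mul, a, b => a * b
  | .div, a, b => a / b
  | .mod, a, b => a % b

/-- Expressions: constants, array access with a computed address, arithmetic. -/
inductive Expr
  | const (c : ℕ)
  | load (A : ℕ) (i : Expr)
  | op (o : Op) (a b : Expr)

/-- The value of an expression. -/
def Expr.eval (s : Store) : Expr → ℕ
  | .const c => c
  | .load A i => s A (i.eval s)
  | .op o a b => o.eval (a.eval s) (b.eval s)

/-- The logarithmic cost of evaluating an expression. -/
def Expr.cost (s : Store) : Expr → ℕ
  | .const c => 1 + Nat.size c
  | .load A i => i.cost s + (1 + Nat.size (i.eval s) + Nat.size (s A (i.eval s)))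
  | .op o a b => a.cost s + b.cost s +
      (1 + Nat.size (a.eval s) + Nat.size (b.eval s) + Nat.size (o.eval (a.eval s) (b.eval s)))

/-- Programs. `assign A i e` is `A[i] := e`; a test succeeds if its value is nonzero;
`query A n B` asks the oracle about the word `A[0], …, A[n-1]` and writes the answer to `B[0]`. -/
inductive Prog
  | skip
  | assign (A : ℕ) (i e : Expr)
  | seq (P Q : Prog)
  | ite (e : Expr) (P Q : Prog)
  | while (e : Expr) (P : Prog)
  | query (A : ℕ) (n : Expr) (B : ℕ)

/-- The word `A[0], …, A[n-1]`. -/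
def Store.word (s : Store) (A n : ℕ) : List ℕ := (List.range n).map (s A)

/-- `Exec O P s s' t`: with oracle `O`, the program `P` started in `s` halts in `s'` at cost `t`. -/
inductive Exec (O : List ℕ → ℕ) : Prog → Store → Store → ℕ → Prop
  | skip (s : Store) : Exec O .skip s s 1
  | assign (s : Store) (A : ℕ) (i e : Expr) :
      Exec O (.assign A i e) s (s.set A (i.eval s) (e.eval s))
        (i.cost s + e.cost s + (1 + Nat.size (i.eval s) + Nat.size (e.eval s)))
  | seq {P Q : Prog} {s s' s'' : Store} {t t' : ℕ} :
      Exec O P s s' t → Exec O Q s' s'' t' → Exec O (.seq P Q) s s'' (t + t' + 1)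
  | ite_true {e : Expr} {P Q : Prog} {s s' : Store} {t : ℕ} :
      e.eval s ≠ 0 → Exec O P s s' t → Exec O (.ite e P Q) s s' (e.cost s + t + 1)
  | ite_false {e : Expr} {P Q : Prog} {s s' : Store} {t : ℕ} :
      e.eval s = 0 → Exec O Q s s' t → Exec O (.ite e P Q) s s' (e.cost s + t + 1)
  | while_true {e : Expr} {P : Prog} {s s' s'' : Store} {t t' : ℕ} :
      e.eval s ≠ 0 → Exec O P s s' t → Exec O (.while e P) s' s'' t' →
        Exec O (.while e P) s s'' (e.cost s + t + t' + 1)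
  | while_false {e : Expr} {P : Prog} {s : Store} :
      e.eval s = 0 → Exec O (.while e P) s s (e.cost s + 1)
  | query (s : Store) (A : ℕ) (n : Expr) (B : ℕ) :
      Exec O (.query A n B) s (s.set B 0 (O (s.word A (n.eval s))))
        (n.cost s + (1 + wordSize (s.word A (n.eval s)) + Nat.size (O (s.word A (n.eval s)))))

/-- The initial store: array `0` holds the input word, `1[0]` its length, all else is `0`. -/
def initStore (w : List ℕ) : Store := fun A i =>
  if A = 0 then w.getD i 0 else if A = 1 ∧ i = 0 then w.length else 0

/-- With oracle `O` and input `w`, the program `P` halts with output `y` (in the cell `0[0]`)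
at cost at most `T`. -/
def Outputs (O : List ℕ → ℕ) (P : Prog) (w : List ℕ) (y T : ℕ) : Prop :=
  ∃ s t, Exec O P (initStore w) s t ∧ s 0 0 = y ∧ t ≤ T

end OracleRAM

/-! ## Counting problems and reductions -/

/-- A counting problem: instances, their encoding as words, and the number to be computed. -/
structure CountingProblem where
  Inst : Type
  encode : Inst → List ℕ
  encode_injective : Function.Injective encode
  count : Inst → ℕ

/-- `A` is polynomial-time Turing reducible to `B`: one program and one polynomial such that, with
any oracle that answers the instances of `B` correctly (and words that encode no instance
arbitrarily), the program solves all instances of `A` in polynomial time. -/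
def CountingProblem.PolyTimeTuringReducible (A B : CountingProblem) : Prop :=
  ∃ (P : OracleRAM.Prog) (T : Polynomial ℕ),
    ∀ O : List ℕ → ℕ, (∀ b : B.Inst, O (B.encode b) = B.count b) →
      ∀ a : A.Inst,
        OracleRAM.Outputs O P (A.encode a) (A.count a)
          (T.eval (OracleRAM.wordSize (A.encode a)))

/-- #ET restricted to a class of graphs: count the Eulerian tours of a given graph of the class. -/
noncomputable def sharpET (C : Multigraph → Prop) : CountingProblem where
  Inst := {G : Multigraph // C G}
  encode G := G.1.encode
  encode_injective := Multigraph.encode_injective.comp Subtype.val_injective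
  count G := G.1.numEulerianTours

/-! An Eulerian tour amounts to a transition system, that is, a perfect matching of the half-edges
at every vertex, which has a single circuit (`numEulerianTours_eq`). Colour the edges with N colours
and prescribe the colour of one edge. For a transition system with c circuits there are N^(c-1)
colourings that are constant on circuits, and in a ring with N = 0 this vanishes unless c = 1.
Exchanging the sums gives the tour number, modulo N, as a sum over colourings of products of local
numbers: at each vertex, the matchings of equally coloured half-edges (`cast_numEulerianTours`). In
this state sum a vertex is a tensor, a piece of a graph may be replaced by any piece with a
proportional tensor, and a closed circuit is worth 0. An integer identity that holds in every `ZMod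
N` holds in ℤ (`Int.eq_of_forall_zmod`).

It remains to make the matching tensor of a vertex of even degree out of vertices of degree 4. A
uniform matching arises by adding pairs z, q one after the other, where q may trade places with one
of the m half-edges before z, all m + 1 outcomes being equally likely. This is done sequentially: at
the r-th earlier half-edge (r = 0, 1, …) the weights are m - r for staying and 1 for trading
(`codeTensor_ladders`, `codeTensor_code`). Such a choice is a ladder of m - r boxes, provided that a
box allows only two of the three transitions at a vertex of degree 4. Composed along the ladder such
a box is 1 + E with E² = N E = 0, and (1 + E)^w = 1 + w E (`ladderTensor_zero`).

A true vertex of degree 4 also allows the third transition. A chain of j + 1 such vertices, joined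
by double edges, acts as 2^j times a vertex whose third transition has weight κ = j + 1
(`partFn_chain`). With these chains as boxes, D of them in all, the 4-regular graph has 2^(j D) Q(j
+ 1) tours modulo N, where Q has degree at most D and Q(0) is a known positive constant times the
number sought. Extrapolating from κ = 1, …, D + 1 to κ = 0 (`Polynomial.sum_choose_mul_eval`),
multiplied by 2^(D²) so that no power of 2 has to be inverted, gives `sum_numEulerianTours`.

The reduction evaluates this formula with D + 1 queries. D and the graphs have polynomial size, and
a graph with E edges has at most (2E)! tours, so the answers have polynomial bit length. The running
time is controlled by `Runs`: a weight T bounds the growth of bit lengths by T and the cost by T (b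
+ T), and weights essentially add up along a program. -/

/-! ## Counting perfect matchings inside the fibres of a map -/

/-- The number of perfect matchings of `n` points. -/
def perfectMatchings : ℕ → ℕ
  | 0 => 1
  | 1 => 0
  | n + 2 => (n + 1) * perfectMatchings n

theorem perfectMatchings_succ (n : ℕ) :
    perfectMatchings (n + 1) = n * perfectMatchings (n - 1) := by
  cases n with
  | zero => simp [perfectMatchings]
  | succ n => simp [perfectMatchings]

/-- The number of perfect matchings of a multiset that match only equal elements. -/
def matchCount {α : Type*} [DecidableEq α] (s : Multiset α) : ℕ :=
  ∏ y ∈ s.toFinset, perfectMatchings (s.count y)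

theorem matchCount_eq_prod {α : Type*} [DecidableEq α] (s : Multiset α) (F : Finset α)
    (h : s.toFinset ⊆ F) : matchCount s = ∏ y ∈ F, perfectMatchings (s.count y) := by
  refine Finset.prod_subset h fun y _ hy => ?_
  rw [Multiset.mem_toFinset] at hy
  rw [Multiset.count_eq_zero_of_notMem hy, perfectMatchings]

theorem matchCount_zero {α : Type*} [DecidableEq α] : matchCount (0 : Multiset α) = 1 := by
  simp [matchCount]

/-- Condition on the partner of the distinguished copy of `z`, which is one of the copies of `z` in
`S`; whichever it is, `S.erase z` remains to be matched. -/
theorem matchCount_cons {α : Type*} [DecidableEq α] (z : α) (S : Multiset α) :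
    matchCount (z ::ₘ S) = S.count z * matchCount (S.erase z) := by
  have hz : z ∈ (z ::ₘ S).toFinset := by simp
  rw [matchCount_eq_prod (S.erase z) (z ::ₘ S).toFinset, matchCount,
    ← Finset.mul_prod_erase _ _ hz, ← Finset.mul_prod_erase _ _ hz, ← mul_assoc]
  · congr 1
    · simp [perfectMatchings_succ]
    · refine Finset.prod_congr rfl fun y hy => ?_
      have hy : y ≠ z := (Finset.mem_erase.1 hy).1
      simp [Multiset.count_cons_of_ne hy, Multiset.count_erase_of_ne hy]
  · intro y hy
    rw [Multiset.mem_toFinset] at hy ⊢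
    exact Multiset.mem_cons_of_mem (Multiset.mem_of_mem_erase hy)

section Involutions

variable {X Y : Type*} [Fintype X] [DecidableEq X] [DecidableEq Y]

/-- The involutions with support `s` that preserve `f`. -/
def fiberInvolutions (f : X → Y) (s : Finset X) : Finset (Equiv.Perm X) :=
  Finset.univ.filter fun τ => (∀ x, τ (τ x) = x) ∧ (∀ x, τ x ≠ x ↔ x ∈ s) ∧ ∀ x, f (τ x) = f x

theorem mem_fiberInvolutions {f : X → Y} {s : Finset X} {τ : Equiv.Perm X} :
    τ ∈ fiberInvolutions f s ↔
      (∀ x, τ (τ x) = x) ∧ (∀ x, τ x ≠ x ↔ x ∈ s) ∧ ∀ x, f (τ x) = f x := by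
  simp [fiberInvolutions]

/-- Composition with the transposition of `x` and `y` dissolves the pair into two fixed points, and
the same composition restores it. -/
theorem card_fiberInvolutions_filter (f : X → Y) {s : Finset X} {x y : X} (hx : x ∉ s)
    (hy : y ∈ s) (hf : f y = f x) :
    ((fiberInvolutions f (insert x s)).filter fun τ => τ x = y).card =
      (fiberInvolutions f (s.erase y)).card := by
  have hxy : x ≠ y := fun h => hx (h ▸ hy)
  refine Finset.card_bij' (fun τ _ => τ * Equiv.swap x y) (fun τ _ => τ * Equiv.swap x y)
    ?_ ?_ ?_ ?_
  · intro τ hτ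
    obtain ⟨hτ, h⟩ := Finset.mem_filter.1 hτ
    obtain ⟨h1, h2, h3⟩ := mem_fiberInvolutions.1 hτ
    have h' : τ y = x := by rw [← h, h1]
    have hinj := τ.injective
    rw [mem_fiberInvolutions]
    have key : ∀ z, (τ * Equiv.swap x y) z = if z = x then x else if z = y then y else τ z := by
      intro z
      by_cases hzx : z = x
      · subst hzx; simp [h']
      · by_cases hzy : z = y
        · subst hzy; simp [h, hzx]
        · simp [hzx, hzy, Equiv.swap_apply_of_ne_of_ne hzx hzy]
    refine ⟨fun z => ?_, fun z => ?_, fun z => ?_⟩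
    · rw [key z]
      by_cases hzx : z = x
      · simp [hzx, h']
      · by_cases hzy : z = y
        · simp [hzy, hxy.symm, h]
        · have a1 : τ z ≠ x := fun e => hzy (hinj (e.trans h'.symm))
          have a2 : τ z ≠ y := fun e => hzx (hinj (e.trans h.symm))
          simp only [hzx, hzy, if_false]
          rw [key, if_neg a1, if_neg a2, h1]
    · rw [key z]
      have := h2 z
      by_cases hzx : z = x
      · simp [hzx, hx]
      · by_cases hzy : z = y
        · simp [hzy, hxy.symm]
        · simpa [hzx, hzy] using this
    · rw [key z]
      by_cases hzx : z = x
      · simp [hzx]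
      · by_cases hzy : z = y
        · simp [hzy, hxy.symm]
        · simp [hzx, hzy, h3]
  · intro τ hτ
    obtain ⟨h1, h2, h3⟩ := mem_fiberInvolutions.1 hτ
    have hfx : τ x = x := by
      by_contra hne
      exact hx (Finset.mem_of_mem_erase ((h2 x).1 hne))
    have hfy : τ y = y := by
      by_contra hne
      exact Finset.notMem_erase _ _ ((h2 y).1 hne)
    have hinj := τ.injective
    have key : ∀ z, (τ * Equiv.swap x y) z = if z = x then y else if z = y then x else τ z := by
      intro z
      by_cases hzx : z = x
      · subst hzx; simp [hfy]
      · by_cases hzy : z = y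
        · subst hzy; simp [hfx, hzx]
        · simp [hzx, hzy, Equiv.swap_apply_of_ne_of_ne hzx hzy]
    rw [Finset.mem_filter, mem_fiberInvolutions]
    refine ⟨⟨fun z => ?_, fun z => ?_, fun z => ?_⟩, by simp [key]⟩
    · rw [key z]
      by_cases hzx : z = x
      · simp [hzx, hfx]
      · by_cases hzy : z = y
        · simp [hzy, hxy.symm, hfy]
        · have a1 : τ z ≠ x := fun e => hzx (hinj (e.trans hfx.symm))
          have a2 : τ z ≠ y := fun e => hzy (hinj (e.trans hfy.symm))
          simp only [hzx, hzy, if_false]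
          rw [key, if_neg a1, if_neg a2, h1]
    · rw [key z]
      have := h2 z
      by_cases hzx : z = x
      · simp [hzx, hxy.symm]
      · by_cases hzy : z = y
        · simp [hzy, hxy.symm, hy, hxy]
        · simpa [hzx, hzy] using this
    · rw [key z]
      by_cases hzx : z = x
      · simp [hzx, hf]
      · by_cases hzy : z = y
        · simp [hzy, hxy.symm, hf]
        · simp [hzx, hzy, h3]
  · intro τ _
    simp [mul_assoc]
  · intro τ _
    simp [mul_assoc]

theorem card_fiberInvolutions (f : X → Y) (s : Finset X) :
    (fiberInvolutions f s).card = matchCount (s.val.map f) := by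
  induction hn : s.card using Nat.strong_induction_on generalizing s with
  | _ n ih =>
  rcases s.eq_empty_or_nonempty with rfl | ⟨x, hx⟩
  · have : fiberInvolutions f ∅ = {1} := by
      ext τ
      rw [mem_fiberInvolutions, Finset.mem_singleton]
      constructor
      · rintro ⟨_, h, _⟩
        ext x
        simpa using h x
      · rintro rfl
        simp
    rw [this]
    simp [matchCount_zero]
  · obtain ⟨t, hxt, rfl⟩ : ∃ t, x ∉ t ∧ insert x t = s :=
      ⟨s.erase x, Finset.notMem_erase _ _, Finset.insert_erase hx⟩
    rw [Finset.insert_val_of_notMem hxt, Multiset.map_cons, matchCount_cons]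
    have hmaps : ∀ τ ∈ fiberInvolutions f (insert x t), τ x ∈ t.filter fun y => f x = f y := by
      intro τ hτ
      obtain ⟨h1, h2, h3⟩ := mem_fiberInvolutions.1 hτ
      have hne : τ x ≠ x := (h2 x).2 (Finset.mem_insert_self _ _)
      have : τ x ∈ insert x t := (h2 _).1 (by rw [h1]; exact hne.symm)
      rw [Finset.mem_filter]
      exact ⟨(Finset.mem_insert.1 this).resolve_left hne, (h3 x).symm⟩
    -- Sort the involutions by the partner of `x`. Every admissible partner leaves the same count,
    -- since it removes the same value `f x` from the multiset.
    rw [Finset.card_eq_sum_card_fiberwise hmaps]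
    have hcard : Multiset.count (f x) (t.val.map f) = (t.filter fun y => f x = f y).card := by
      rw [Multiset.count_map]; rfl
    rw [hcard, ← smul_eq_mul]
    refine Finset.sum_eq_card_nsmul fun y hy => ?_
    obtain ⟨hyt, hfy⟩ := Finset.mem_filter.1 hy
    rw [card_fiberInvolutions_filter f hxt hyt hfy.symm, ih (t.erase y).card ?_ _ rfl, Finset.erase_val,
      Multiset.map_erase_of_mem _ _ hyt, hfy]
    rw [← hn, Finset.card_insert_of_notMem hxt, Finset.card_erase_of_mem hyt]
    omega

end Involutions

/-! ## Eulerian tours as transition systems -/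

theorem Cycle.chain_reverse {α : Type*} (r : α → α → Prop) (c : Cycle α) :
    c.reverse.Chain r ↔ c.Chain fun a b => r b a := by
  induction c using Quotient.inductionOn with
  | h l =>
    cases l with
    | nil => exact Iff.rfl
    | cons a l =>
      have h : ((a :: l : List α) : Cycle α).reverse = ((a :: l.reverse : List α) : Cycle α) := by
        rw [Cycle.reverse_coe, List.reverse_cons, Cycle.coe_cons_eq_coe_append]
      change ((a :: l : List α) : Cycle α).reverse.Chain r ↔
        Cycle.Chain _ ((a :: l : List α) : Cycle α)
      rw [h, Cycle.chain_coe_cons, Cycle.chain_coe_cons, ← List.isChain_reverse]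
      simp

theorem Cycle.exists_coe_cons_of_mem {α : Type*} {c : Cycle α} {d : α} (h : d ∈ c) :
    ∃ l : List α, c = ((d :: l : List α) : Cycle α) := by
  induction c using Quotient.inductionOn with
  | h l =>
    have h : d ∈ l := h
    obtain ⟨l₁, l₂, rfl⟩ := List.append_of_mem h
    refine ⟨l₂ ++ l₁, ?_⟩
    change ((l₁ ++ d :: l₂ : List α) : Cycle α) = _
    rw [Cycle.coe_eq_coe, ← List.cons_append]
    exact List.isRotated_append

/-- For a list without repetition `formPerm` is the cyclic successor, so the chain condition becomes
pointwise and rotations need not be tracked. -/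
theorem Cycle.chain_coe_iff_formPerm {α : Type*} [DecidableEq α] (r : α → α → Prop) {l : List α}
    (hl : l.Nodup) : (l : Cycle α).Chain r ↔ ∀ x ∈ l, r x (l.formPerm x) := by
  cases l with
  | nil => simp
  | cons a l =>
    rw [Cycle.chain_coe_cons, List.isChain_iff_getElem]
    have key : ∀ i (hi : i < (a :: l).length),
        (a :: (l ++ [a]))[i]'(by simp at hi ⊢; omega) = (a :: l)[i] ∧
        (a :: (l ++ [a]))[i + 1]'(by simp at hi ⊢; omega) = (a :: l).formPerm (a :: l)[i] := by
      intro i hi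
      rw [List.formPerm_apply_getElem _ hl]
      constructor
      · cases i with
        | zero => rfl
        | succ i => simp at hi; simp [hi]
      · simp only [List.length_cons] at hi ⊢
        rcases Nat.lt_or_ge i l.length with h | h
        · simp [Nat.mod_eq_of_lt (Nat.succ_lt_succ h), h]
        · obtain rfl : i = l.length := by omega
          simp
    constructor
    · intro h x hx
      obtain ⟨i, hi, rfl⟩ := List.getElem_of_mem hx
      have := h i (by simp at hi ⊢; omega)
      rwa [(key i hi).1, (key i hi).2] at this
    · intro h i hi
      have hi' : i < (a :: l).length := by simp at hi ⊢; omega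
      rw [(key i hi').1, (key i hi').2]
      exact h _ (List.getElem_mem _)

/-- Following `f` from `d` runs through the cycle; a return to `d` before all entries are used up
would repeat an entry. -/
theorem Cycle.eq_periodicOrbit {α : Type*} (f : α → α) {c : Cycle α} {d : α} (hd : d ∈ c)
    (hn : c.Nodup) (hc : c.Chain fun a b => f a = b) : c = Function.periodicOrbit f d := by
  obtain ⟨l, rfl⟩ := Cycle.exists_coe_cons_of_mem hd
  rw [Cycle.nodup_coe_iff] at hn
  rw [Cycle.chain_coe_cons, List.isChain_iff_getElem] at hc
  have key : ∀ i (hi : i < (d :: (l ++ [d])).length), (d :: (l ++ [d]))[i] = f^[i] d := by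
    intro i
    induction i with
    | zero => intro _; rfl
    | succ i ih =>
      intro hi
      rw [Function.iterate_succ_apply', ← ih (by omega), hc i hi]
  have key' : ∀ i (hi : i < (d :: l).length), (d :: l)[i] = f^[i] d := by
    intro i hi
    rw [← key i (by simp at hi ⊢; omega)]
    cases i with
    | zero => rfl
    | succ i => simp at hi; simp [hi]
  have hper : Function.IsPeriodicPt f (l.length + 1) d := by
    have := key (l.length + 1) (by simp)
    simpa [Function.IsPeriodicPt, Function.IsFixedPt] using this.symm
  have hle := hper.minimalPeriod_le (Nat.succ_pos _)
  have hpos := hper.minimalPeriod_pos (Nat.succ_pos _)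
  have hmin : Function.minimalPeriod f d = l.length + 1 := by
    by_contra hne
    have hlt : Function.minimalPeriod f d < (d :: l).length := by
      simp; omega
    have h0 := key' _ hlt
    rw [Function.iterate_minimalPeriod] at h0
    have : (d :: l)[Function.minimalPeriod f d] = (d :: l)[0] := h0
    rw [hn.getElem_inj_iff] at this
    omega
  rw [Function.periodicOrbit_def, hmin]
  congr 1
  apply List.ext_getElem
  · simp
  · intro i hi _
    rw [key' i hi, List.getElem_map, List.getElem_range]

namespace Multigraph

variable (G : Multigraph)

@[simp] theorem flip_flip (d : G.Dart) : G.flip (G.flip d) = d := by simp [flip]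

theorem flip_ne (d : G.Dart) : G.flip d ≠ d := by
  intro h
  have := congrArg Prod.snd h
  simp [flip] at this

theorem eq_or_eq_flip {d d' : G.Dart} (h : d.1 = d'.1) : d = d' ∨ d = G.flip d' := by
  obtain ⟨e, b⟩ := d
  obtain ⟨e', b'⟩ := d'
  obtain rfl : e = e' := h
  cases b <;> cases b' <;> simp [flip]

/-- The transition systems: at each vertex a perfect matching of the half-edges. -/
def transitions : Finset (Equiv.Perm G.Dart) := fiberInvolutions G.src Finset.univ

variable {G}

theorem mem_transitions {τ : Equiv.Perm G.Dart} :
    τ ∈ G.transitions ↔ (∀ d, τ (τ d) = d) ∧ (∀ d, τ d ≠ d) ∧ ∀ d, G.src (τ d) = G.src d := by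
  simp [transitions, mem_fiberInvolutions]

/-- Two edges are linked if they follow each other in a circuit of the transition system. -/
def EdgeLink (τ : Equiv.Perm G.Dart) (e e' : Fin G.numEdges) : Prop :=
  ∃ d : G.Dart, d.1 = e ∧ (τ d).1 = e'

/-- All edges lie on one circuit of the transition system. -/
def SingleCircuit (τ : Equiv.Perm G.Dart) : Prop :=
  ∀ e e', Relation.EqvGen (EdgeLink τ) e e'

/-- The dart that follows `d` on its circuit. -/
def follow (τ : Equiv.Perm G.Dart) (d : G.Dart) : G.Dart := τ (G.flip d)

theorem follow_injective (τ : Equiv.Perm G.Dart) : Function.Injective (follow τ) := by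
  intro d d' h
  have := τ.injective h
  rw [← G.flip_flip d, this, G.flip_flip]

theorem IsDirectedTour.nodup_fst {l : List G.Dart} (h : G.IsDirectedTour (l : Cycle G.Dart)) :
    (l.map Prod.fst).Nodup := by
  rw [← Multiset.coe_nodup, Multiset.nodup_iff_count_le_one]
  intro e
  exact (h.2 e).le

theorem IsDirectedTour.exists_mem {l : List G.Dart} (h : G.IsDirectedTour (l : Cycle G.Dart))
    (e : Fin G.numEdges) : ∃ d ∈ l, d.1 = e := by
  have : 0 < Multiset.count e ((l : Multiset G.Dart).map Prod.fst) := by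
    have := h.2 e
    change Multiset.count e ((l : Multiset G.Dart).map Prod.fst) = 1 at this
    omega
  simpa using Multiset.count_pos.1 this

theorem IsDirectedTour.mem_iff_flip_notMem {l : List G.Dart}
    (h : G.IsDirectedTour (l : Cycle G.Dart)) (d : G.Dart) : d ∈ l ↔ G.flip d ∉ l := by
  constructor
  · intro h1 h2
    exact G.flip_ne d (List.inj_on_of_nodup_map h.nodup_fst h2 h1 rfl)
  · intro h1
    obtain ⟨d', hd', he⟩ := h.exists_mem d.1
    rcases G.eq_or_eq_flip he with rfl | rfl
    · exact hd'
    · exact absurd hd' h1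

theorem IsDirectedTour.nodup {l : List G.Dart} (h : G.IsDirectedTour (l : Cycle G.Dart)) :
    l.Nodup := h.nodup_fst.of_map _

/-- Match the half-edge through which the tour enters a vertex with the one through which it leaves
next. Successive edges of the tour are then linked, so there is one circuit. -/
theorem IsDirectedTour.exists_transition {c : Cycle G.Dart} (h : G.IsDirectedTour c) :
    ∃ τ ∈ G.transitions, SingleCircuit τ ∧ c.Chain fun d d' => follow τ d = d' := by
  induction c using Quotient.inductionOn with
  | h l =>
  change G.IsDirectedTour (l : Cycle G.Dart) at h
  change ∃ τ ∈ G.transitions, SingleCircuit τ ∧ Cycle.Chain _ (l : Cycle G.Dart)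
  have hnd := h.nodup
  have hchain := (Cycle.chain_coe_iff_formPerm _ hnd).1 h.1
  set f := l.formPerm with hf
  have hmem : ∀ x, f x ∈ l ↔ x ∈ l := fun x => List.formPerm_mem_iff_mem
  have hmem' : ∀ x, f⁻¹ x ∈ l ↔ x ∈ l := fun x => by rw [← hmem (f⁻¹ x)]; simp
  have hflip := h.mem_iff_flip_notMem
  -- Darts on `l` are the departing half-edges and all others the arriving ones; the two branches
  -- are inverse to each other.
  let t : G.Dart → G.Dart := fun d => if d ∈ l then G.flip (f⁻¹ d) else f (G.flip d)
  have ht1 : ∀ d, d ∈ l → t d = G.flip (f⁻¹ d) := fun d hd => if_pos hd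
  have ht2 : ∀ d, d ∉ l → t d = f (G.flip d) := fun d hd => if_neg hd
  have htm1 : ∀ d, d ∈ l → t d ∉ l := by
    intro d hd
    rw [ht1 d hd]
    exact (hflip _).1 ((hmem' d).2 hd)
  have htm2 : ∀ d, d ∉ l → t d ∈ l := by
    intro d hd
    rw [ht2 d hd, hmem, hflip, G.flip_flip]
    exact hd
  have hinv : Function.Involutive t := by
    intro d
    by_cases hd : d ∈ l
    · rw [ht2 _ (htm1 d hd), ht1 d hd, G.flip_flip]; simp
    · rw [ht1 _ (htm2 d hd), ht2 d hd]; simp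
  have htl : ∀ d ∈ l, t (G.flip d) = f d := by
    intro d hd
    rw [ht2 _ ((hflip d).1 hd), G.flip_flip]
  refine ⟨hinv.toPerm t, ?_, ?_, ?_⟩
  · rw [mem_transitions]
    refine ⟨hinv, ?_, ?_⟩
    · intro d
      change t d ≠ d
      by_cases hd : d ∈ l
      · exact fun e => htm1 d hd (e.symm ▸ hd)
      · exact fun e => hd (e.subst (motive := (· ∈ l)) (htm2 d hd))
    · intro d
      change G.src (t d) = G.src d
      by_cases hd : d ∈ l
      · rw [ht1 d hd]
        have := hchain (f⁻¹ d) ((hmem' d).2 hd)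
        simpa [tgt] using this
      · rw [ht2 d hd]
        have := hchain (G.flip d) (by rw [hflip, G.flip_flip]; exact hd)
        simpa [tgt] using this.symm
  · have hlink : ∀ d ∈ l, EdgeLink (hinv.toPerm t) d.1 (f d).1 := by
      intro d hd
      exact ⟨G.flip d, rfl, congrArg Prod.fst (htl d hd)⟩
    intro e e'
    obtain ⟨d, hd, rfl⟩ := h.exists_mem e
    obtain ⟨d', hd', rfl⟩ := h.exists_mem e'
    have hsame : ∀ n : ℕ, (f ^ n) d ∈ l ∧
        Relation.EqvGen (EdgeLink (hinv.toPerm t)) d.1 ((f ^ n) d).1 := by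
      intro n
      induction n with
      | zero => exact ⟨hd, Relation.EqvGen.refl _⟩
      | succ n ih =>
        rw [pow_succ', Equiv.Perm.mul_apply]
        exact ⟨(hmem _).2 ih.1, ih.2.trans _ _ _ (Relation.EqvGen.rel _ _ (hlink _ ih.1))⟩
    obtain ⟨i, hi, rfl⟩ := List.getElem_of_mem hd
    obtain ⟨j, hj, rfl⟩ := List.getElem_of_mem hd'
    -- Position `j` is reached from position `i` by going once past the end, which avoids a case
    -- distinction between `i ≤ j` and `j < i`.
    have hpow : (f ^ (l.length - i + j)) l[i] = l[j] := by
      rw [hf, List.formPerm_pow_apply_getElem _ hnd]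
      congr 1
      rw [show i + (l.length - i + j) = j + l.length by omega, Nat.add_mod_right,
        Nat.mod_eq_of_lt hj]
    rw [← hpow]
    exact (hsame _).2
  · rw [Cycle.chain_coe_iff_formPerm _ hnd]
    exact fun d hd => htl d hd

/-- The successor on the tour determines `τ` on the arriving half-edges; on the departing ones it is
then forced because `τ` is an involution. -/
theorem transition_unique {c : Cycle G.Dart} (h : G.IsDirectedTour c) {τ τ' : Equiv.Perm G.Dart}
    (hτ : τ ∈ G.transitions) (hτ' : τ' ∈ G.transitions)
    (hc : c.Chain fun d d' => follow τ d = d') (hc' : c.Chain fun d d' => follow τ' d = d') :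
    τ = τ' := by
  induction c using Quotient.inductionOn with
  | h l =>
  change G.IsDirectedTour (l : Cycle G.Dart) at h
  change Cycle.Chain _ (l : Cycle G.Dart) at hc hc'
  have hnd := h.nodup
  rw [Cycle.chain_coe_iff_formPerm _ hnd] at hc hc'
  obtain ⟨h1, -, -⟩ := mem_transitions.1 hτ
  obtain ⟨h1', -, -⟩ := mem_transitions.1 hτ'
  have hout : ∀ d, d ∉ l → τ d = τ' d := by
    intro d hd
    have hm : G.flip d ∈ l := by
      rw [h.mem_iff_flip_notMem, G.flip_flip]
      exact hd
    have a := hc _ hm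
    have b := hc' _ hm
    simp only [follow, G.flip_flip] at a b
    rw [a, b]
  ext1 d
  by_cases hd : d ∈ l
  · have hx : (l.formPerm⁻¹ d) ∈ l := by
      rw [← List.formPerm_mem_iff_mem]; simpa using hd
    have a := hc _ hx
    have b := hc' _ hx
    rw [follow, show l.formPerm (l.formPerm⁻¹ d) = d by simp] at a b
    have a' := h1 (G.flip (l.formPerm⁻¹ d))
    have b' := h1' (G.flip (l.formPerm⁻¹ d))
    rw [a] at a'
    rw [b] at b'
    rw [a', b']
  · exact hout d hd

theorem follow_reverse {τ : Equiv.Perm G.Dart} (hτ : τ ∈ G.transitions) {c : Cycle G.Dart}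
    (hc : c.Chain fun d d' => follow τ d = d') :
    (G.reverseTour c).Chain fun d d' => follow τ d = d' := by
  obtain ⟨h1, -, -⟩ := mem_transitions.1 hτ
  rw [reverseTour, Cycle.chain_reverse, Cycle.chain_map]
  refine hc.imp ?_
  rintro d d' rfl
  simp [follow, h1]

theorem mem_or_mem_reverseTour {c : Cycle G.Dart} (h : G.IsDirectedTour c) (d : G.Dart) :
    d ∈ c ∨ d ∈ G.reverseTour c := by
  induction c using Quotient.inductionOn with
  | h l =>
  change G.IsDirectedTour (l : Cycle G.Dart) at h
  by_cases hd : d ∈ l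
  · exact Or.inl hd
  · right
    have hm : G.flip d ∈ l := by
      rw [h.mem_iff_flip_notMem, G.flip_flip]
      exact hd
    change d ∈ (l.map G.flip).reverse
    rw [List.mem_reverse]
    exact List.mem_map.2 ⟨_, hm, G.flip_flip d⟩

theorem nodup_of_isDirectedTour {c : Cycle G.Dart} (h : G.IsDirectedTour c) : c.Nodup := by
  induction c using Quotient.inductionOn with
  | h l => exact IsDirectedTour.nodup h

theorem nodup_reverseTour {c : Cycle G.Dart} (h : c.Nodup) : (G.reverseTour c).Nodup := by
  induction c using Quotient.inductionOn with
  | h l =>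
  have h : l.Nodup := h
  change (l.map G.flip).reverse.Nodup
  rw [List.nodup_reverse]
  exact h.map (fun a b hab => by rw [← G.flip_flip a, hab, G.flip_flip])

/-- A circuit cannot traverse an edge in both directions: the stretch between the two passages is
its own reversal and can be shortened by a step at each end, until a dart equals its flip or `τ` has
a fixed point. -/
theorem flip_notMem_periodicOrbit {τ : Equiv.Perm G.Dart} (hτ : τ ∈ G.transitions) (n : ℕ) :
    ∀ d : G.Dart, (follow τ)^[n] d ≠ G.flip d := by
  obtain ⟨h1, h2, -⟩ := mem_transitions.1 hτ
  induction n using Nat.strong_induction_on with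
  | _ n ih =>
  intro d hd
  match n with
  | 0 => exact G.flip_ne d hd.symm
  | 1 => exact h2 _ hd
  | n + 2 =>
    refine ih n (by omega) (follow τ d) ?_
    rw [Function.iterate_succ_apply', Function.iterate_succ_apply] at hd
    have h3 : τ (G.flip ((follow τ)^[n] (follow τ d))) = G.flip d := hd
    rw [← G.flip_flip ((follow τ)^[n] (follow τ d)), ← h1 (G.flip ((follow τ)^[n] (follow τ d))), h3]
    rfl

/-- The orbit uses no edge twice, by `flip_notMem_periodicOrbit`. The set of edges it uses is closed
under `EdgeLink`, hence contains all edges. -/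
theorem isDirectedTour_periodicOrbit {τ : Equiv.Perm G.Dart} (hτ : τ ∈ G.transitions)
    (hs : SingleCircuit τ) (d : G.Dart) :
    G.IsDirectedTour (Function.periodicOrbit (follow τ) d) := by
  obtain ⟨h1, h2, h3⟩ := mem_transitions.1 hτ
  have hper : ∀ d, d ∈ Function.periodicPts (follow τ) := (follow_injective τ).mem_periodicPts
  refine ⟨?_, ?_⟩
  · rw [Function.periodicOrbit_chain' _ (hper d)]
    intro n
    rw [Function.iterate_succ_apply', follow, h3, tgt]
  · have hinj : ∀ x ∈ Function.periodicOrbit (follow τ) d,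
        ∀ y ∈ Function.periodicOrbit (follow τ) d, x.1 = y.1 → x = y := by
      intro x hx y hy hxy
      refine (G.eq_or_eq_flip hxy).resolve_right fun hf => ?_
      obtain ⟨a, rfl⟩ := (Function.mem_periodicOrbit_iff (hper d)).1 hx
      obtain ⟨b, rfl⟩ := (Function.mem_periodicOrbit_iff (hper d)).1 hy
      have : (follow τ)^[a] d ∈ Function.periodicOrbit (follow τ) ((follow τ)^[b] d) := by
        rw [Function.periodicOrbit_apply_iterate_eq (hper d)]
        exact hx
      obtain ⟨n, hn⟩ := (Function.mem_periodicOrbit_iff (hper _)).1 this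
      exact flip_notMem_periodicOrbit hτ n _ (hn.trans hf)
    have hcov : ∀ e e' : Fin G.numEdges, Relation.EqvGen (EdgeLink τ) e e' →
        ((∃ x ∈ Function.periodicOrbit (follow τ) d, x.1 = e) ↔
          ∃ x ∈ Function.periodicOrbit (follow τ) d, x.1 = e') := by
      have hfwd : ∀ x ∈ Function.periodicOrbit (follow τ) d,
          (∃ y ∈ Function.periodicOrbit (follow τ) d, y.1 = (τ x).1) ∧
            ∃ y ∈ Function.periodicOrbit (follow τ) d, y.1 = (τ (G.flip x)).1 := by
        intro x hx
        refine ⟨?_, follow τ x, ?_, rfl⟩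
        · have hxx := hx
          -- Restarting the orbit at `follow τ d` exhibits a predecessor of `x` on it, and `τ x` is
          -- the flip of that predecessor.
          rw [← Function.periodicOrbit_apply_eq (hper d)] at hxx
          obtain ⟨n, rfl⟩ := (Function.mem_periodicOrbit_iff (hper _)).1 hxx
          refine ⟨(follow τ)^[n] d, Function.iterate_mem_periodicOrbit (hper d) n, ?_⟩
          rw [← Function.iterate_succ_apply, Function.iterate_succ_apply', follow, h1]
          rfl
        · obtain ⟨n, rfl⟩ := (Function.mem_periodicOrbit_iff (hper d)).1 hx
          rw [← Function.iterate_succ_apply' (follow τ)]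
          exact Function.iterate_mem_periodicOrbit (hper d) _
      have hfwd' : ∀ e e', EdgeLink τ e e' →
          (∃ x ∈ Function.periodicOrbit (follow τ) d, x.1 = e) →
          ∃ x ∈ Function.periodicOrbit (follow τ) d, x.1 = e' := by
        rintro _ _ ⟨z, rfl, rfl⟩ ⟨x, hx, hxz⟩
        rcases G.eq_or_eq_flip hxz.symm with rfl | rfl
        · exact (hfwd _ hx).1
        · exact (hfwd _ hx).2
      intro e e' h
      induction h with
      | rel e e' h =>
        refine ⟨hfwd' _ _ h, hfwd' _ _ ?_⟩
        obtain ⟨z, rfl, rfl⟩ := h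
        exact ⟨τ z, rfl, by rw [h1]⟩
      | refl => rfl
      | symm _ _ _ ih => exact ih.symm
      | trans _ _ _ _ _ ih1 ih2 => exact ih1.trans ih2
    intro e
    have hnd : (Function.periodicOrbit (follow τ) d).Nodup := Function.nodup_periodicOrbit
    obtain ⟨x, hx, rfl⟩ := (hcov d.1 e (hs _ _)).1 ⟨d, Function.self_mem_periodicOrbit (hper d), rfl⟩
    generalize Function.periodicOrbit (follow τ) d = c at *
    induction c using Quotient.inductionOn with
    | h l =>
      change Multiset.count x.1 ((l : Multiset G.Dart).map Prod.fst) = 1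
      have hl : ((l : Multiset G.Dart).map Prod.fst).Nodup :=
        Multiset.Nodup.map_on hinj hnd
      exact Multiset.count_eq_one_of_mem hl (Multiset.mem_map_of_mem _ hx)

open Classical in
/-- Eulerian tours correspond to the transition systems with a single circuit. -/
theorem numEulerianTours_eq (hE : 0 < G.numEdges) :
    G.numEulerianTours = (G.transitions.filter SingleCircuit).card := by
  have d₀ : G.Dart := (⟨0, hE⟩, false)
  choose T hT1 hT2 hT3 using
    fun c : {c : Cycle G.Dart // G.IsDirectedTour c} => c.2.exists_transition
  have hcompat : ∀ c c' : {c : Cycle G.Dart // G.IsDirectedTour c},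
      G.tourSetoid.r c c' → T c = T c' := by
    rintro c c' (h | h)
    · rw [Subtype.ext h]
    · refine transition_unique c.2 (hT1 c) (hT1 c') (hT3 c) ?_
      rw [h]
      exact follow_reverse (hT1 c') (hT3 c')
  let F : Quotient G.tourSetoid → (G.transitions.filter SingleCircuit : Finset _) :=
    Quotient.lift (fun c => ⟨T c, Finset.mem_filter.2 ⟨hT1 c, hT2 c⟩⟩)
      (fun c c' h => Subtype.ext (hcompat c c' h))
  have hF : Function.Bijective F := by
    constructor
    · intro q q'
      induction q using Quotient.inductionOn with
      | h c =>
      induction q' using Quotient.inductionOn with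
      | h c' =>
      intro h
      have h : T c = T c' := congrArg Subtype.val h
      refine Quotient.sound ?_
      -- The dart `d₀` fixes the direction: exactly as traversed or backwards, the tour passes `d₀`
      -- and is then its orbit, which depends on the transition system only.
      have hor : ∀ c : {c : Cycle G.Dart // G.IsDirectedTour c},
          c.1 = Function.periodicOrbit (follow (T c)) d₀ ∨
            G.reverseTour c.1 = Function.periodicOrbit (follow (T c)) d₀ := by
        intro c
        rcases mem_or_mem_reverseTour c.2 d₀ with hm | hm
        · exact Or.inl (Cycle.eq_periodicOrbit _ hm (nodup_of_isDirectedTour c.2) (hT3 c))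
        · exact Or.inr (Cycle.eq_periodicOrbit _ hm
            (nodup_reverseTour (nodup_of_isDirectedTour c.2)) (follow_reverse (hT1 c) (hT3 c)))
      change c.1 = c'.1 ∨ c.1 = G.reverseTour c'.1
      rcases hor c with h1 | h1 <;> rcases hor c' with h2 | h2
      · exact Or.inl (by rw [h1, h2, h])
      · exact Or.inr (by rw [h1, h2, h])
      · exact Or.inr (by rw [h2, ← h, ← h1, reverseTour_reverseTour])
      · refine Or.inl ?_
        rw [← reverseTour_reverseTour G c.1, h1, h, ← h2, reverseTour_reverseTour]
    · rintro ⟨τ, hτ⟩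
      obtain ⟨hτ1, hτ2⟩ := Finset.mem_filter.1 hτ
      have htour := isDirectedTour_periodicOrbit hτ1 hτ2 d₀
      refine ⟨Quotient.mk _ ⟨_, htour⟩, Subtype.ext ?_⟩
      refine transition_unique htour (hT1 ⟨_, htour⟩) hτ1 (hT3 ⟨_, htour⟩) ?_
      rw [Function.periodicOrbit_chain' _ ((follow_injective τ).mem_periodicPts _)]
      intro n
      rw [Function.iterate_succ_apply']
  rw [numEulerianTours, Nat.card_eq_of_bijective F hF, Nat.card_eq_fintype_card,
    Fintype.card_coe]

theorem numEulerianTours_of_numEdges_eq_zero (hE : G.numEdges = 0) : G.numEulerianTours = 1 := by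
  have hD : IsEmpty G.Dart := ⟨fun d => by have := d.1.2; omega⟩
  have hnil : ∀ c : Cycle G.Dart, c = Cycle.nil := by
    intro c
    induction c using Quotient.inductionOn with
    | h l =>
      cases l with
      | nil => rfl
      | cons a l => exact hD.elim a
  rw [numEulerianTours, Nat.card_eq_one_iff_unique]
  refine ⟨⟨fun q q' => ?_⟩, ⟨Quotient.mk _ ⟨Cycle.nil, ?_⟩⟩⟩
  · induction q using Quotient.inductionOn with
    | h c =>
    induction q' using Quotient.inductionOn with
    | h c' =>
    congr 1
    exact Subtype.ext ((hnil _).trans (hnil _).symm)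
  · exact ⟨Cycle.Chain.nil _, fun e => by have := e.2; omega⟩

end Multigraph

/-! ### Tour numbers as sums over edge colourings. -/

namespace Multigraph

variable {G : Multigraph} {N : ℕ} [NeZero N] {R : Type*} [CommRing R]

-- An invariant colouring is a colouring of the circuits. With the circuit of `e₀` prescribed there
-- are N^(c-1) of them for c circuits, which is 0 in `R` unless c = 1. Without the prescription even
-- a single circuit would count N = 0.
open Classical in
theorem card_linkInvariant_colorings (hN : (N : R) = 0) (τ : Equiv.Perm G.Dart)
    (e₀ : Fin G.numEdges) :
    ((Finset.univ.filter fun col : Fin G.numEdges → Fin N =>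
        col e₀ = 0 ∧ ∀ d : G.Dart, col (τ d).1 = col d.1).card : R) =
      if SingleCircuit τ then 1 else 0 := by
  let Q := Quot (EdgeLink τ)
  have : Fintype Q := Fintype.ofSurjective (Quot.mk (EdgeLink τ)) Quot.mk_surjective
  let S : Q → Finset (Fin N) := fun q => if q = Quot.mk _ e₀ then {0} else Finset.univ
  have hcard : (Finset.univ.filter fun col : Fin G.numEdges → Fin N =>
        col e₀ = 0 ∧ ∀ d : G.Dart, col (τ d).1 = col d.1).card = (Fintype.piFinset S).card := by
    symm
    refine Finset.card_bij (fun g _ => fun e => g (Quot.mk _ e)) ?_ ?_ ?_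
    · intro g hg
      rw [Fintype.mem_piFinset] at hg
      rw [Finset.mem_filter]
      refine ⟨Finset.mem_univ _, by simpa [S] using hg (Quot.mk _ e₀), fun d => ?_⟩
      exact congrArg g (Quot.sound (r := EdgeLink τ) ⟨d, rfl, rfl⟩).symm
    · intro g _ g' _ h
      funext q
      induction q using Quot.inductionOn with
      | h e => exact congrFun h e
    · intro col hcol
      obtain ⟨-, h0, hinv⟩ := Finset.mem_filter.1 hcol
      refine ⟨Quot.lift col ?_, ?_, rfl⟩
      · rintro _ _ ⟨d, rfl, rfl⟩
        exact (hinv d).symm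
      · rw [Fintype.mem_piFinset]
        intro q
        by_cases hq : q = Quot.mk _ e₀
        · subst hq; simp [S, h0]
        · simp [S, hq]
  rw [hcard, Fintype.card_piFinset]
  split_ifs with hs
  · have : ∀ q : Q, (S q).card = 1 := by
      intro q
      induction q using Quot.inductionOn with
      | h e => simp [S, Quot.eqvGen_sound (hs e e₀)]
    simp [this]
  · rw [SingleCircuit] at hs
    push Not at hs
    obtain ⟨e, e', he⟩ := hs
    have : ∃ e₁, Quot.mk (EdgeLink τ) e₁ ≠ Quot.mk _ e₀ := by
      by_contra hall
      push Not at hall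
      exact he (Quot.eqvGen_exact ((hall e).trans (hall e').symm))
    obtain ⟨e₁, he₁⟩ := this
    rw [Nat.cast_prod]
    refine Finset.prod_eq_zero (Finset.mem_univ (Quot.mk (EdgeLink τ) e₁)) ?_
    simp [S, he₁, hN]

/-- The number of Eulerian tours as a sum over edge colourings in which a closed circuit has
weight `0`. -/
theorem cast_numEulerianTours (hN : (N : R) = 0) (e₀ : Fin G.numEdges) :
    (G.numEulerianTours : R) = ∑ col : Fin G.numEdges → Fin N with col e₀ = 0,
      (matchCount ((Finset.univ : Finset G.Dart).val.map
        fun d => ((G.src d : ℕ), col d.1)) : R) := by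
  classical
  -- Matching half-edges with equal vertex and equal colour means choosing a transition system along
  -- whose circuits the colour is constant; afterwards the two sums are exchanged.
  have hfib : ∀ col : Fin G.numEdges → Fin N,
      fiberInvolutions (fun d : G.Dart => ((G.src d : ℕ), col d.1)) Finset.univ =
        G.transitions.filter fun τ => ∀ d : G.Dart, col (τ d).1 = col d.1 := by
    intro col
    ext τ
    simp only [mem_fiberInvolutions, Finset.mem_filter, transitions, Prod.mk.injEq, Fin.val_inj]
    constructor
    · rintro ⟨a, b, c⟩
      exact ⟨⟨a, b, fun x => (c x).1⟩, fun x => (c x).2⟩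
    · rintro ⟨⟨a, b, c⟩, d⟩
      exact ⟨a, b, fun x => ⟨c x, d x⟩⟩
  simp only [← card_fiberInvolutions, hfib]
  rw [numEulerianTours_eq (lt_of_le_of_lt (Nat.zero_le _) e₀.2), ← Nat.cast_sum]
  simp only [Finset.card_filter _ G.transitions]
  rw [Finset.sum_comm]
  push_cast
  refine Finset.sum_congr rfl fun τ _ => ?_
  rw [← card_linkInvariant_colorings hN τ e₀, ← Finset.filter_filter, Finset.card_filter]
  push_cast
  rfl

/-- A crude bound, needed only to see that the answers of the oracle have polynomial bit length. -/
theorem numEulerianTours_le_factorial (G : Multigraph) :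
    G.numEulerianTours ≤ (G.numEdges * 2).factorial := by
  classical
  rcases Nat.eq_zero_or_pos G.numEdges with h | h
  · rw [numEulerianTours_of_numEdges_eq_zero h]
    exact Nat.factorial_pos _
  · rw [numEulerianTours_eq h]
    refine (Finset.card_le_univ _).trans ?_
    rw [Fintype.card_perm]
    simp

end Multigraph

/-! ## Partition functions of coloured multigraphs with legs -/

section Partition

variable {N : ℕ} (R : Type*) [CommRing R]

/-- The sum over the colourings of the edges `es` of the number of matchings, at each vertex, of
the incident ends of equal colour; `ℓ` lists the coloured legs. -/
def partFn : List (ℕ × ℕ) → Multiset (ℕ × Fin N) → R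
  | [], ℓ => (matchCount ℓ : R)
  | e :: es, ℓ => ∑ a, partFn es ((e.1, a) ::ₘ (e.2, a) ::ₘ ℓ)

/-- The sums over the colours of different edges commute, so any edge may be cut first. -/
theorem partFn_append (es fs : List (ℕ × ℕ)) (ℓ : Multiset (ℕ × Fin N)) (e : ℕ × ℕ) :
    partFn R (es ++ e :: fs) ℓ = partFn R (e :: (es ++ fs)) ℓ := by
  induction es generalizing ℓ with
  | nil => rfl
  | cons f es ih =>
    simp only [List.cons_append, partFn]
    simp only [ih, partFn]
    rw [Finset.sum_comm]
    refine Finset.sum_congr rfl fun a _ => Finset.sum_congr rfl fun b _ => ?_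
    congr 1
    rw [← Multiset.singleton_add, ← Multiset.singleton_add, ← Multiset.singleton_add (f.1, b),
      ← Multiset.singleton_add (f.2, b), ← Multiset.singleton_add (f.1, b),
      ← Multiset.singleton_add (f.2, b), ← Multiset.singleton_add (e.1, a),
      ← Multiset.singleton_add (e.2, a)]
    abel

theorem partFn_concat (es : List (ℕ × ℕ)) (ℓ : Multiset (ℕ × Fin N)) (e : ℕ × ℕ) :
    partFn R (es ++ [e]) ℓ = ∑ a, partFn R es ((e.1, a) ::ₘ (e.2, a) ::ₘ ℓ) := by
  rw [partFn_append, List.append_nil, partFn]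

/-- The legs that arise by cutting coloured edges. -/
def cutLegs {m : ℕ} (g : Fin m → ℕ × ℕ) (col : Fin m → Fin N) : Multiset (ℕ × Fin N) :=
  ∑ i, {((g i).1, col i), ((g i).2, col i)}

theorem partFn_ofFn {m : ℕ} (g : Fin m → ℕ × ℕ) (ℓ : Multiset (ℕ × Fin N)) :
    partFn R (List.ofFn g) ℓ = ∑ col : Fin m → Fin N, (matchCount (cutLegs g col + ℓ) : R) := by
  induction m generalizing ℓ with
  | zero => simp [partFn, cutLegs]
  | succ m ih =>
    rw [List.ofFn_succ, partFn]
    simp only [ih]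
    rw [← (Fin.consEquiv fun _ => Fin N).sum_comp, Fintype.sum_prod_type]
    refine Finset.sum_congr rfl fun a _ => Finset.sum_congr rfl fun col _ => ?_
    congr 2
    simp only [cutLegs, Fin.sum_univ_succ, Fin.consEquiv_apply, Fin.cons_zero, Fin.cons_succ,
      Multiset.insert_eq_cons, ← Multiset.singleton_add]
    abel

theorem univ_dart_map {m : ℕ} {α : Type*} (f : Fin m × Bool → α) :
    (Finset.univ : Finset (Fin m × Bool)).val.map f = ∑ i, {f (i, false), f (i, true)} := by
  have h : ∀ s : Finset (Fin m × Bool), s.val.map f = ∑ d ∈ s, {f d} := by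
    intro s
    induction s using Finset.induction_on with
    | empty => rfl
    | insert a s ha ih =>
      rw [Finset.sum_insert ha, ← ih, Finset.insert_val_of_notMem ha, Multiset.map_cons,
        Multiset.singleton_add]
  rw [h, Fintype.sum_prod_type]
  refine Finset.sum_congr rfl fun i _ => ?_
  rw [Fintype.sum_bool, add_comm]
  rfl

end Partition

/-! ## The chain and ladder gadgets -/

/-- No leg of `ℓ` sits at `n`, so the vertex `n` splits off; the three summands are the three
pairings of its four ends. -/
theorem matchCount_four_cons {N : ℕ} {n : ℕ} (a b c d : Fin N) {ℓ : Multiset (ℕ × Fin N)}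
    (hℓ : ∀ x ∈ ℓ, x.1 < n) :
    matchCount ((n, a) ::ₘ (n, b) ::ₘ (n, c) ::ₘ (n, d) ::ₘ ℓ) =
      ((if a = b ∧ c = d then 1 else 0) + (if a = c ∧ b = d then 1 else 0) +
        (if a = d ∧ b = c then 1 else 0)) * matchCount ℓ := by
  have h0 : ∀ x, (n, x) ∉ ℓ := fun x hx => lt_irrefl _ (hℓ _ hx)
  have hc : ∀ x, Multiset.count (n, x) ℓ = 0 := fun x => Multiset.count_eq_zero_of_notMem (h0 x)
  have two : ∀ x y, matchCount ((n, x) ::ₘ (n, y) ::ₘ ℓ) = if x = y then matchCount ℓ else 0 := by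
    intro x y
    rw [matchCount_cons]
    by_cases h : x = y
    · subst h; simp [hc]
    · have : (n, x) ≠ (n, y) := by simpa using h
      simp [Multiset.count_cons_of_ne this, hc, h]
  rw [matchCount_cons]
  by_cases hab : a = b
  · subst hab
    rw [Multiset.erase_cons_head, two]
    by_cases hac : a = c <;> by_cases had : a = d <;> by_cases hcd : c = d <;>
      simp_all
  · have hab' : (n, a) ≠ (n, b) := by simpa using hab
    rw [Multiset.erase_cons_tail _ hab'.symm]
    by_cases hac : a = c
    · subst hac
      rw [Multiset.erase_cons_head, two]
      by_cases had : a = d <;> by_cases hcd : b = d <;>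
        simp_all
    · have hac' : (n, a) ≠ (n, c) := by simpa using hac
      rw [Multiset.erase_cons_tail _ hac'.symm]
      by_cases had : a = d
      · subst had
        rw [Multiset.erase_cons_head, two]
        by_cases hbc : b = c <;> simp_all
      · simp_all

section Tensors

variable {N : ℕ} {R : Type*} [CommRing R]

/-- The identity tensor. -/
def delta (R : Type*) [CommRing R] (a b : Fin N) : R := if a = b then 1 else 0

theorem delta_comm (a b : Fin N) : delta R a b = delta R b a := by
  simp only [delta, eq_comm]

@[simp] theorem delta_self (a : Fin N) : delta R a a = 1 := by simp [delta]

theorem sum_delta_mul (a : Fin N) (f : Fin N → R) : ∑ x, delta R a x * f x = f a := by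
  simp [delta]

theorem sum_delta_mul' (a : Fin N) (f : Fin N → R) : ∑ x, delta R x a * f x = f a := by
  simp [delta]

/-- The tensor of a vertex of degree `4` at which the three transitions have the weights `1`, `1`
and `κ`. -/
def boxTensor (κ : R) (a b c d : Fin N) : R :=
  delta R a c * delta R b d + delta R a d * delta R b c + κ * (delta R a b * delta R c d)

/-- `w` boxes in a row, each attached to the next one with a twist. -/
def ladderTensor (κ : R) : ℕ → Fin N → Fin N → Fin N → Fin N → R
  | 0, a, c, d, b => delta R a d * delta R b c
  | w + 1, a, c, d, b => ∑ x, ∑ y, ladderTensor κ w a c x y * boxTensor κ x b y d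

/-- Write a box as 1 + X + κE, with 1 the parallel strands, X the crossing and E the cap. Then (1 +
X)² = 2(1 + X), each mixed product with E gives 2E, and the two caps between them enclose a circuit
worth N = 0. Hence κ grows by 1. -/
theorem sum_box_mul_box (hN : (N : R) = 0) (κ : R) (a b c d : Fin N) :
    ∑ x, ∑ y, boxTensor κ a b x y * boxTensor 1 x y c d = 2 * boxTensor (κ + 1) a b c d := by
  have h1 : ∀ x y, boxTensor κ a b x y * boxTensor 1 x y c d =
      delta R a x * (delta R b y * boxTensor 1 x y c d) +
      delta R b x * (delta R a y * boxTensor 1 x y c d) +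
      κ * delta R a b * (delta R x y * boxTensor 1 x y c d) := by
    intro x y
    rw [boxTensor]; ring
  have h2 : ∀ x : Fin N, boxTensor 1 x x c d =
      2 * (delta R x c * delta R x d) + delta R c d := by
    intro x; simp [boxTensor]; ring
  simp only [h1, Finset.sum_add_distrib, ← Finset.mul_sum, sum_delta_mul, sum_delta_mul', h2]
  simp only [Finset.sum_const, Finset.card_univ, Fintype.card_fin, nsmul_eq_mul, hN, zero_mul,
    add_zero, boxTensor]
  rw [delta_comm b a]
  ring

/-- Read from the ends `a, c` to the ends `d, b`, a twisted box with κ = 0 is the identity plus the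
cap E, and E² = N E = 0. So the ladder is (1 + E)^w = 1 + w E. -/
theorem ladderTensor_zero (hN : (N : R) = 0) (w : ℕ) (a c d b : Fin N) :
    ladderTensor (0 : R) w a c d b =
      delta R a d * delta R b c + w * (delta R a c * delta R b d) := by
  induction w generalizing d b with
  | zero => simp [ladderTensor]
  | succ w ih =>
    have h1 : ∀ x y, ladderTensor (0 : R) w a c x y * boxTensor 0 x b y d =
      delta R a x * (delta R y c * boxTensor 0 x b y d) +
      w * delta R a c * (delta R y x * boxTensor 0 x b y d) := by
      intro x y
      rw [ih]; ring
    have h2 : ∀ x : Fin N, boxTensor (0 : R) x b x d =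
      delta R b d + delta R x d * delta R b x := by
      intro x; simp [boxTensor]
    rw [ladderTensor]
    simp only [h1, Finset.sum_add_distrib, ← Finset.mul_sum, sum_delta_mul, sum_delta_mul', h2]
    simp only [Finset.sum_const, Finset.card_univ, Fintype.card_fin, nsmul_eq_mul, hN, zero_mul,
      boxTensor]
    push_cast
    ring

theorem exists_polynomial_ladderTensor (w : ℕ) (a c d b : Fin N) :
    ∃ p : Polynomial R, p.natDegree ≤ w ∧ ∀ κ, ladderTensor κ w a c d b = p.eval κ := by
  induction w generalizing d b with
  | zero =>
    exact ⟨Polynomial.C (delta R a d * delta R b c), (Polynomial.natDegree_C _).le, fun κ => by simp [ladderTensor]⟩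
  | succ w ih =>
    choose p hp hp' using ih
    refine ⟨∑ x, ∑ y, p x y * (Polynomial.C (delta R x y * delta R b d + delta R x d * delta R b y) +
      Polynomial.X * Polynomial.C (delta R x b * delta R y d)), ?_, fun κ => ?_⟩
    · refine Polynomial.natDegree_sum_le_of_forall_le _ _ fun x _ =>
        Polynomial.natDegree_sum_le_of_forall_le _ _ fun y _ => ?_
      refine Polynomial.natDegree_mul_le_of_le (hp x y) ?_
      refine (Polynomial.natDegree_add_le _ _).trans (max_le ?_ ?_)
      · exact (Polynomial.natDegree_C _).le.trans (Nat.zero_le _)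
      · refine (Polynomial.natDegree_mul_le).trans ?_
        rw [Polynomial.natDegree_C]
        exact Polynomial.natDegree_X_le
    · simp only [ladderTensor, Polynomial.eval_finsetSum, Polynomial.eval_mul, ← hp',
        Polynomial.eval_add, Polynomial.eval_C, Polynomial.eval_X, boxTensor]

/-- A vertex all of whose ends are open legs interacts with nothing else and factors out of the
state sum. -/
theorem partFn_four_legs {n : ℕ} (a b c d : Fin N) (es : List (ℕ × ℕ))
    {ℓ : Multiset (ℕ × Fin N)} (hes : ∀ e ∈ es, e.1 < n ∧ e.2 < n) (hℓ : ∀ x ∈ ℓ, x.1 < n) :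
    partFn R es ((n, a) ::ₘ (n, b) ::ₘ (n, c) ::ₘ (n, d) ::ₘ ℓ) =
      boxTensor 1 a b c d * partFn R es ℓ := by
  induction es generalizing ℓ with
  | nil =>
    rw [partFn, partFn, matchCount_four_cons a b c d hℓ]
    simp only [boxTensor, delta, ite_and]
    push_cast
    split_ifs <;> simp_all
  | cons e es ih =>
    obtain ⟨he, hes⟩ := List.forall_mem_cons.1 hes
    rw [partFn, partFn, Finset.mul_sum]
    refine Finset.sum_congr rfl fun x _ => ?_
    rw [← ih hes]
    · congr 1
      simp only [← Multiset.singleton_add]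
      abel
    · intro y hy
      simp only [Multiset.mem_cons] at hy
      rcases hy with rfl | rfl | hy
      · exact he.1
      · exact he.2
      · exact hℓ y hy

/-- Double edges between the consecutive vertices `n, …, n + j`. -/
def chainEdges (n : ℕ) : ℕ → List (ℕ × ℕ)
  | 0 => []
  | j + 1 => chainEdges n j ++ [(n + j, n + j + 1), (n + j, n + j + 1)]

theorem chainEdges_lt {n j : ℕ} : ∀ e ∈ chainEdges n j, e.1 < n + j + 1 ∧ e.2 < n + j + 1 := by
  induction j with
  | zero => simp [chainEdges]
  | succ j ih =>
    intro e he
    simp only [chainEdges, List.mem_append, List.mem_cons, List.not_mem_nil, or_false] at he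
    rcases he with he | rfl | rfl
    · have := ih e he; omega
    · simp only; omega
    · simp only; omega

/-- Lengthening the chain composes its tensor with one more vertex, by `sum_box_mul_box`. This makes
κ a parameter that can be varied although all vertices have degree 4. -/
theorem partFn_chain (hN : (N : R) = 0) {n : ℕ} (j : ℕ) (a b c d : Fin N) (es : List (ℕ × ℕ))
    {ℓ : Multiset (ℕ × Fin N)} (hes : ∀ e ∈ es, e.1 < n ∧ e.2 < n) (hℓ : ∀ x ∈ ℓ, x.1 < n) :
    partFn R (es ++ chainEdges n j)
        ((n, a) ::ₘ (n, b) ::ₘ (n + j, c) ::ₘ (n + j, d) ::ₘ ℓ) =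
      2 ^ j * boxTensor ((j : R) + 1) a b c d * partFn R es ℓ := by
  induction j generalizing c d with
  | zero => simpa [chainEdges] using partFn_four_legs a b c d es hes hℓ
  | succ j ih =>
    rw [chainEdges, ← List.append_assoc,
      show [(n + j, n + j + 1), (n + j, n + j + 1)] =
        [(n + j, n + j + 1)] ++ [(n + j, n + j + 1)] from rfl, ← List.append_assoc,
      partFn_concat]
    simp only [partFn_concat]
    have h : ∀ x y, partFn R (es ++ chainEdges n j)
        ((n + j, x) ::ₘ (n + j + 1, x) ::ₘ (n + j, y) ::ₘ (n + j + 1, y) ::ₘ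
          (n, a) ::ₘ (n, b) ::ₘ (n + (j + 1), c) ::ₘ (n + (j + 1), d) ::ₘ ℓ) =
        2 ^ j * partFn R es ℓ * (boxTensor ((j : R) + 1) a b x y * boxTensor 1 x y c d) := by
      intro x y
      have := ih x y
      rw [show 2 ^ j * partFn R es ℓ * (boxTensor ((j : R) + 1) a b x y * boxTensor 1 x y c d) =
        boxTensor 1 x y c d * (2 ^ j * boxTensor ((j : R) + 1) a b x y * partFn R es ℓ) by ring,
        ← this, ← partFn_four_legs (n := n + j + 1)]
      · congr 1
        simp only [← Multiset.singleton_add, ← add_assoc n j 1]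
        abel
      · intro e he
        rcases List.mem_append.1 he with he | he
        · have := hes e he; omega
        · exact chainEdges_lt e he
      · intro z hz
        simp only [Multiset.mem_cons] at hz
        rcases hz with rfl | rfl | rfl | rfl | hz
        · simp only; omega
        · simp only; omega
        · simp only; omega
        · simp only; omega
        · have := hℓ z hz; omega
    rw [Finset.sum_comm]
    simp only [h, ← Finset.mul_sum]
    rw [sum_box_mul_box hN]
    push_cast
    ring

end Tensors

/-! ## Building a 4-regular graph -/

/-- A graph under construction: its edges, its number of vertices, and the vertex `own x` to which
the leg `x` is attached. -/
structure Builder where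
  es : List (ℕ × ℕ)
  nv : ℕ
  own : ℕ → ℕ

/-- A ladder under construction on the leg `p`; the next block is attached to `y₁` and `y₂`. -/
structure LadderState extends Builder where
  y₁ : ℕ
  y₂ : ℕ

/-- Add one block, a chain of `j + 1` vertices; `i` is the number of blocks already there. -/
def LadderState.addBlock (j p i : ℕ) (L : LadderState) : LadderState where
  es := L.es ++ (L.y₂, L.nv) :: ((if i = 0 then [] else [(L.y₁, L.nv + j)]) ++ chainEdges L.nv j)
  nv := L.nv + j + 1
  own := if i = 0 then Function.update L.own p (L.nv + j) else L.own
  y₁ := L.nv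
  y₂ := L.nv + j

/-- The ladder with the given number of blocks. -/
def Builder.blocks (j p : ℕ) (B : Builder) : ℕ → LadderState
  | 0 => ⟨B, 0, B.own p⟩
  | i + 1 => (B.blocks j p i).addBlock j p i

/-- `fresh p q` starts a new strand with legs `p` and `q`; `ladder w p q` lets the legs `p` and
`q` pass each other through a ladder with `w` blocks. -/
inductive Instr
  | fresh (p q : ℕ)
  | ladder (w p q : ℕ)

/-- The effect of an instruction, with `j + 1` vertices in each block. -/
def Builder.step (j : ℕ) (B : Builder) : Instr → Builder
  | .fresh p q =>
    ⟨B.es ++ [(B.nv, B.nv)], B.nv + 1, Function.update (Function.update B.own p B.nv) q B.nv⟩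
  | .ladder w p q =>
    let L := B.blocks j p w
    ⟨L.es ++ [(L.y₁, L.own q)], L.nv, Function.update L.own q L.y₂⟩

/-- The builder after a list of instructions. -/
def build (j : ℕ) (l : List Instr) : Builder := l.foldl (Builder.step j) ⟨[], 0, fun _ => 0⟩

/-- The number of blocks of an instruction. -/
def Instr.boxes : Instr → ℕ
  | .fresh _ _ => 0
  | .ladder w _ _ => w

/-- The contribution of an instruction to the normalizing constant. -/
def Instr.norm : Instr → ℕ
  | .fresh _ _ => 2
  | .ladder w _ _ => w

/-- The number of blocks in a list of instructions. -/
def numBoxes (l : List Instr) : ℕ := (l.map Instr.boxes).sum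

/-- The normalizing constant of a list of instructions. -/
def normConst (l : List Instr) : ℕ := (l.map Instr.norm).prod

@[simp] theorem numBoxes_nil : numBoxes [] = 0 := rfl
@[simp] theorem normConst_nil : normConst [] = 1 := rfl
@[simp] theorem build_nil (j : ℕ) : build j [] = ⟨[], 0, fun _ => 0⟩ := rfl

@[simp] theorem numBoxes_append (l l' : List Instr) :
    numBoxes (l ++ l') = numBoxes l + numBoxes l' := by simp [numBoxes]

@[simp] theorem normConst_append (l l' : List Instr) :
    normConst (l ++ l') = normConst l * normConst l' := by simp [normConst]

theorem build_concat (j : ℕ) (l : List Instr) (i : Instr) :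
    build j (l ++ [i]) = (build j l).step j i := by simp [build]

/-- Lists of instructions that only use legs that are present and only create legs that are not;
the finite set consists of the legs present at the end. -/
inductive ValidCode : List Instr → Finset ℕ → Prop
  | nil : ValidCode [] ∅
  | fresh {l A p q} : ValidCode l A → p ≠ q → p ∉ A → q ∉ A →
      ValidCode (l ++ [.fresh p q]) (insert p (insert q A))
  | ladder {l A w p q} : ValidCode l A → 0 < w → p ≠ q → p ∈ A → q ∈ A →
      ValidCode (l ++ [.ladder w p q]) A

/-- The multiset of the ends of a list of edges. -/
def edgeEnds (es : List (ℕ × ℕ)) : Multiset ℕ := (es.map fun e => {e.1, e.2}).sum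

@[simp] theorem edgeEnds_nil : edgeEnds [] = 0 := rfl

@[simp] theorem edgeEnds_cons (e : ℕ × ℕ) (es : List (ℕ × ℕ)) :
    edgeEnds (e :: es) = {e.1, e.2} + edgeEnds es := by simp [edgeEnds]

@[simp] theorem edgeEnds_append (es fs : List (ℕ × ℕ)) :
    edgeEnds (es ++ fs) = edgeEnds es + edgeEnds fs := by simp [edgeEnds]

theorem mem_edgeEnds {es : List (ℕ × ℕ)} {e : ℕ × ℕ} (he : e ∈ es) :
    e.1 ∈ edgeEnds es ∧ e.2 ∈ edgeEnds es := by
  induction es with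
  | nil => simp at he
  | cons f es ih =>
    rcases List.mem_cons.1 he with rfl | he
    · simp
    · have := ih he; simp [this]

/-- Every vertex has exactly four ends of edges and legs. -/
def Builder.Saturated (B : Builder) (A : Finset ℕ) : Prop :=
  edgeEnds B.es + A.val.map B.own = 4 • Multiset.range B.nv

theorem four_nsmul_range_succ (n : ℕ) :
    4 • Multiset.range (n + 1) = {n} + {n} + {n} + {n} + 4 • Multiset.range n := by
  rw [Multiset.range_succ, ← Multiset.singleton_add]
  abel

theorem edgeEnds_chainEdges (n j : ℕ) :
    edgeEnds (chainEdges n j) + ({n} + {n} + {n + j} + {n + j}) + 4 • Multiset.range n =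
      4 • Multiset.range (n + j + 1) := by
  induction j with
  | zero =>
    rw [chainEdges, edgeEnds_nil, Nat.add_zero, four_nsmul_range_succ, zero_add]
  | succ j ih =>
    rw [← Nat.add_assoc, four_nsmul_range_succ, ← ih, chainEdges]
    simp only [edgeEnds_append, edgeEnds_cons, edgeEnds_nil, Multiset.insert_eq_cons,
      ← Multiset.singleton_add]
    abel

theorem Builder.Saturated.es_lt {B : Builder} {A : Finset ℕ} (h : B.Saturated A) :
    ∀ e ∈ B.es, e.1 < B.nv ∧ e.2 < B.nv := by
  intro e he
  have key : ∀ x ∈ edgeEnds B.es, x < B.nv := by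
    intro x hx
    have : x ∈ 4 • Multiset.range B.nv := h ▸ Multiset.mem_add.2 (Or.inl hx)
    exact Multiset.mem_range.1 (Multiset.mem_of_mem_nsmul this)
  exact ⟨key _ (mem_edgeEnds he).1, key _ (mem_edgeEnds he).2⟩

theorem Builder.Saturated.own_lt {B : Builder} {A : Finset ℕ} (h : B.Saturated A) :
    ∀ x ∈ A, B.own x < B.nv := by
  intro x hx
  have : B.own x ∈ 4 • Multiset.range B.nv :=
    h ▸ Multiset.mem_add.2 (Or.inr (Multiset.mem_map_of_mem _ hx))
  exact Multiset.mem_range.1 (Multiset.mem_of_mem_nsmul this)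

namespace Builder

variable (j p : ℕ) (B : Builder)

theorem nv_blocks (i : ℕ) : (B.blocks j p i).nv = B.nv + i * (j + 1) := by
  induction i with
  | zero => simp [blocks]
  | succ i ih => simp only [blocks, LadderState.addBlock, ih]; ring

theorem own_blocks (i : ℕ) :
    (B.blocks j p (i + 1)).own = Function.update B.own p (B.nv + j) := by
  induction i with
  | zero => simp [blocks, LadderState.addBlock]
  | succ i ih =>
    rw [blocks, LadderState.addBlock]
    simpa using ih

/-- After the first block the leg `p` stays at `B.nv + j`, and `y₁`, `y₂` carry the two open ends
for the next block. The count starts at `i + 1` because without blocks `y₁` is a dummy and the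
ladder has only one open end. -/
theorem edgeEnds_blocks (i : ℕ) {S : Multiset ℕ}
    (hS : edgeEnds B.es + ({B.own p} + S) = 4 • Multiset.range B.nv) :
    edgeEnds (B.blocks j p (i + 1)).es + ({(B.blocks j p (i + 1)).y₁} +
      ({(B.blocks j p (i + 1)).y₂} + ({B.nv + j} + S))) =
        4 • Multiset.range (B.blocks j p (i + 1)).nv := by
  induction i with
  | zero =>
    simp only [blocks, LadderState.addBlock, if_true, List.nil_append]
    rw [← edgeEnds_chainEdges, ← hS]
    simp only [edgeEnds_append, edgeEnds_cons, Multiset.insert_eq_cons, ← Multiset.singleton_add]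
    abel
  | succ i ih =>
    rw [blocks, LadderState.addBlock]
    simp only
    rw [← edgeEnds_chainEdges, ← ih]
    simp only [edgeEnds_append, edgeEnds_cons, Multiset.insert_eq_cons, ← Multiset.singleton_add,
      if_neg (Nat.succ_ne_zero i), edgeEnds_nil]
    abel

variable {j p B}

theorem map_val_eq_add_erase {α : Type*} {A : Finset ℕ} {p : ℕ} (hp : p ∈ A) (f : ℕ → α) :
    A.val.map f = {f p} + (A.erase p).val.map f := by
  conv_lhs => rw [← Finset.insert_erase hp]
  rw [Finset.insert_val_of_notMem (Finset.notMem_erase _ _), Multiset.map_cons,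
    Multiset.singleton_add]

theorem map_val_congr {α : Type*} {A : Finset ℕ} {f g : ℕ → α} (h : ∀ x ∈ A, f x = g x) :
    A.val.map f = A.val.map g := Multiset.map_congr rfl h

theorem saturated_fresh {A : Finset ℕ} {p q : ℕ} (h : B.Saturated A) (hpq : p ≠ q) (hp : p ∉ A)
    (hq : q ∉ A) : (B.step j (.fresh p q)).Saturated (insert p (insert q A)) := by
  have hp' : p ∉ insert q A := by simp [hpq, hp]
  simp only [Saturated, step]
  rw [four_nsmul_range_succ, ← h, Finset.insert_val_of_notMem hp', Finset.insert_val_of_notMem hq,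
    Multiset.map_cons, Multiset.map_cons, Function.update_self, Function.update_of_ne hpq,
    Function.update_self, map_val_congr (g := B.own)]
  · simp only [edgeEnds_append, edgeEnds_cons, Multiset.insert_eq_cons, ← Multiset.singleton_add,
      edgeEnds_nil]
    abel
  · intro x hx
    rw [Function.update_of_ne (ne_of_mem_of_not_mem hx hq),
      Function.update_of_ne (ne_of_mem_of_not_mem hx hp)]

theorem saturated_ladder {A : Finset ℕ} {w p q : ℕ} (h : B.Saturated A) (hw : 0 < w) (hpq : p ≠ q)
    (hp : p ∈ A) (hq : q ∈ A) : (B.step j (.ladder w p q)).Saturated A := by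
  obtain ⟨i, rfl⟩ : ∃ i, w = i + 1 := ⟨w - 1, by omega⟩
  have hq' : q ∈ A.erase p := Finset.mem_erase.2 ⟨hpq.symm, hq⟩
  have h' : edgeEnds B.es + A.val.map B.own = 4 • Multiset.range B.nv := h
  rw [map_val_eq_add_erase hp] at h'
  have hb := edgeEnds_blocks j p B i h'
  simp only [Saturated, step]
  rw [← hb, own_blocks, map_val_eq_add_erase hp, map_val_eq_add_erase hq' B.own,
    map_val_eq_add_erase hq', Function.update_self, Function.update_of_ne hpq, Function.update_self,
    Function.update_of_ne hpq.symm,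
    map_val_congr (A := (A.erase p).erase q) (g := B.own)]
  · simp only [edgeEnds_append, edgeEnds_cons, Multiset.insert_eq_cons, ← Multiset.singleton_add,
      edgeEnds_nil]
    abel
  · intro x hx
    simp only [Finset.mem_erase] at hx
    rw [Function.update_of_ne hx.1, Function.update_of_ne hx.2.1]

end Builder

/-- Legs are counted like ends of edges, so that joining them in pairs at the end leaves a 4-regular
graph. -/
theorem ValidCode.saturated {l : List Instr} {A : Finset ℕ} (h : ValidCode l A) (j : ℕ) :
    (build j l).Saturated A := by
  induction h with
  | nil => simp [Builder.Saturated]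
  | fresh _ h1 h2 h3 ih =>
    rw [build_concat]
    exact Builder.saturated_fresh ih h1 h2 h3
  | ladder _ h1 h2 h3 h4 ih =>
    rw [build_concat]
    exact Builder.saturated_ladder ih h1 h2 h3 h4

/-! ### Tensors of instruction lists. -/

section Semantics

variable {N : ℕ} {R : Type*} [CommRing R]

/-- The coloured legs. -/
def legs (A : Finset ℕ) (own : ℕ → ℕ) (c : ℕ → Fin N) : Multiset (ℕ × Fin N) :=
  A.val.map fun x => (own x, c x)

/-- The effect of an instruction on a tensor, with weight `κ` for the unwanted transition. -/
def Instr.act (κ : R) (F : (ℕ → Fin N) → R) : Instr → (ℕ → Fin N) → R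
  | .fresh p q => fun c => 2 * delta R (c p) (c q) * F c
  | .ladder w p q => fun c => ∑ a, ∑ b, ladderTensor κ w a (c p) (c q) b *
      F (Function.update (Function.update c p a) q b)

/-- The tensor of a list of instructions. -/
def codeTensor (κ : R) (l : List Instr) : (ℕ → Fin N) → R :=
  l.foldl (Instr.act κ) fun _ => 1

theorem codeTensor_concat (κ : R) (l : List Instr) (i : Instr) :
    (codeTensor κ (l ++ [i]) : (ℕ → Fin N) → R) = Instr.act κ (codeTensor κ l) i := by
  simp [codeTensor]

/-- Each block is a chain, evaluated by `partFn_chain`; the colours of the edges that attach it are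
the summation variables of `ladderTensor`. The bound on the edges is carried along because
`partFn_chain` needs the vertices of the new chain to be new. -/
theorem partFn_blocks (hN : (N : R) = 0) (j p : ℕ) (B : Builder)
    (hes : ∀ e ∈ B.es, e.1 < B.nv ∧ e.2 < B.nv) (hp : B.own p < B.nv) (i : ℕ) (b c d : Fin N)
    {ℓ : Multiset (ℕ × Fin N)} (hℓ : ∀ x ∈ ℓ, x.1 < B.nv) :
    (∀ e ∈ (B.blocks j p (i + 1)).es,
      e.1 < (B.blocks j p (i + 1)).nv ∧ e.2 < (B.blocks j p (i + 1)).nv) ∧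
    partFn R (B.blocks j p (i + 1)).es (((B.blocks j p (i + 1)).y₁, b) ::ₘ
        ((B.blocks j p (i + 1)).y₂, d) ::ₘ (B.nv + j, c) ::ₘ ℓ) =
      2 ^ (j * (i + 1)) * ∑ a, ladderTensor ((j : R) + 1) (i + 1) a c d b *
        partFn R B.es ((B.own p, a) ::ₘ ℓ) := by
  induction i generalizing b d with
  | zero =>
    simp only [Builder.blocks, LadderState.addBlock, if_true, List.nil_append]
    constructor
    · intro e he
      rcases List.mem_append.1 he with he | he
      · have := hes e he; omega
      · rcases List.mem_cons.1 he with rfl | he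
        · simp only; omega
        · exact chainEdges_lt e he
    · rw [partFn_append, partFn, Finset.mul_sum]
      refine Finset.sum_congr rfl fun a _ => ?_
      have h1 : ladderTensor ((j : R) + 1) 1 a c d b = boxTensor ((j : R) + 1) a b c d := by
        simp only [ladderTensor, mul_assoc, ← Finset.mul_sum, sum_delta_mul, sum_delta_mul']
      have h2 := partFn_chain hN j a b c d B.es hes (ℓ := (B.own p, a) ::ₘ ℓ) (by
        intro x hx
        rcases Multiset.mem_cons.1 hx with rfl | hx
        · exact hp
        · exact hℓ x hx)
      rw [zero_add, h1, mul_one, ← mul_assoc, ← h2]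
      congr 1
      simp only [← Multiset.singleton_add]
      abel
  | succ i ih =>
    have ihes := (ih b d).1
    replace ih := fun b d => (ih b d).2
    have hnv := B.nv_blocks j p (i + 1)
    have hnv' := B.nv_blocks j p i
    have hy₁ : (B.blocks j p (i + 1)).y₁ < (B.blocks j p (i + 1)).nv := by
      simp only [Builder.blocks, LadderState.addBlock]; omega
    have hy₂ : (B.blocks j p (i + 1)).y₂ < (B.blocks j p (i + 1)).nv := by
      simp only [Builder.blocks, LadderState.addBlock]; omega
    have hle : B.nv + j < (B.blocks j p (i + 1)).nv := by
      rw [hnv, add_mul]; nlinarith [Nat.zero_le (i * (j + 1))]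
    have hL : B.blocks j p (i + 2) = (B.blocks j p (i + 1)).addBlock j p (i + 1) := rfl
    rw [hL]
    generalize B.blocks j p (i + 1) = L at *
    simp only [LadderState.addBlock, if_neg (Nat.succ_ne_zero i), List.cons_append, List.nil_append]
    constructor
    · intro e he
      rcases List.mem_append.1 he with he | he
      · have := ihes e he; omega
      · rcases List.mem_cons.1 he with rfl | he
        · simp only; omega
        · rcases List.mem_cons.1 he with rfl | he
          · simp only; omega
          · exact chainEdges_lt e he
    · rw [partFn_append, partFn]
      simp only [partFn_append, partFn]
      -- The colour `x` belongs to the edge from `y₂` to the start of the new chain and `y` to the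
      -- edge from `y₁` to its end; this crossing of the attachments is the twist of the ladder.
      have h2 : ∀ x y, partFn R (L.es ++ chainEdges L.nv j)
          ((L.y₁, y) ::ₘ (L.nv + j, y) ::ₘ (L.y₂, x) ::ₘ (L.nv, x) ::ₘ
            (L.nv, b) ::ₘ (L.nv + j, d) ::ₘ (B.nv + j, c) ::ₘ ℓ) =
          ∑ a, 2 ^ (j * (i + 1 + 1)) * (ladderTensor ((j : R) + 1) (i + 1) a c x y *
            boxTensor ((j : R) + 1) x b y d * partFn R B.es ((B.own p, a) ::ₘ ℓ)) := by
        intro x y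
        have h3 := partFn_chain hN j x b y d L.es ihes
          (ℓ := (L.y₁, y) ::ₘ (L.y₂, x) ::ₘ (B.nv + j, c) ::ₘ ℓ) (by
          intro z hz
          simp only [Multiset.mem_cons] at hz
          rcases hz with rfl | rfl | rfl | hz
          · exact hy₁
          · exact hy₂
          · exact hle
          · have := hℓ z hz; omega)
        rw [ih y x] at h3
        rw [← Finset.mul_sum, mul_add j (i + 1) 1, pow_add]
        simp only [mul_right_comm _ (boxTensor ((j : R) + 1) x b y d)]
        rw [← Finset.sum_mul]
        trans partFn R (L.es ++ chainEdges L.nv j) ((L.nv, x) ::ₘ (L.nv, b) ::ₘ (L.nv + j, y) ::ₘ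
          (L.nv + j, d) ::ₘ (L.y₁, y) ::ₘ (L.y₂, x) ::ₘ (B.nv + j, c) ::ₘ ℓ)
        · congr 1
          simp only [← Multiset.singleton_add]
          abel
        · rw [h3]
          ring
      simp only [h2, Finset.mul_sum]
      rw [Finset.sum_congr rfl fun x _ => Finset.sum_comm, Finset.sum_comm]
      refine Finset.sum_congr rfl fun a _ => ?_
      rw [ladderTensor]
      simp only [← Finset.mul_sum, ← Finset.sum_mul]

/-- Two of the three pairings at the new vertex lead from one leg through the loop to the other leg;
the third closes the loop, which contributes N = 0. -/
theorem partFn_step_fresh (hN : (N : R) = 0) {j p q : ℕ} {B : Builder} {A : Finset ℕ}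
    (h : B.Saturated A) (hpq : p ≠ q) (hp : p ∉ A) (hq : q ∉ A) (c : ℕ → Fin N) :
    partFn R (B.step j (.fresh p q)).es
        (legs (insert p (insert q A)) (B.step j (.fresh p q)).own c) =
      2 * delta R (c p) (c q) * partFn R B.es (legs A B.own c) := by
  have hp' : p ∉ insert q A := by simp [hpq, hp]
  have hlegs : legs (insert p (insert q A)) (B.step j (.fresh p q)).own c =
      (B.nv, c p) ::ₘ (B.nv, c q) ::ₘ legs A B.own c := by
    simp only [legs, Builder.step]
    rw [Finset.insert_val_of_notMem hp', Finset.insert_val_of_notMem hq,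
      Multiset.map_cons, Multiset.map_cons, Function.update_self, Function.update_of_ne hpq,
      Function.update_self, Builder.map_val_congr (g := fun x => (B.own x, c x))]
    intro x hx
    rw [Function.update_of_ne (ne_of_mem_of_not_mem hx hq),
      Function.update_of_ne (ne_of_mem_of_not_mem hx hp)]
  rw [hlegs]
  simp only [Builder.step]
  rw [partFn_concat]
  have hl : ∀ x ∈ legs A B.own c, x.1 < B.nv := by
    intro x hx
    obtain ⟨y, hy, rfl⟩ := Multiset.mem_map.1 hx
    exact h.own_lt y hy
  simp only [partFn_four_legs _ _ _ _ B.es h.es_lt hl]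
  rw [← Finset.sum_mul]
  congr 1
  simp only [boxTensor, Finset.sum_add_distrib, sum_delta_mul', delta_self, one_mul,
    Finset.sum_const, Finset.card_univ, Fintype.card_fin, nsmul_eq_mul, hN, zero_mul]
  rw [delta_comm (c q) (c p)]
  ring

theorem partFn_step_ladder (hN : (N : R) = 0) {j w p q : ℕ} {B : Builder} {A : Finset ℕ}
    (h : B.Saturated A) (hw : 0 < w) (hpq : p ≠ q) (hp : p ∈ A) (hq : q ∈ A) (c : ℕ → Fin N) :
    partFn R (B.step j (.ladder w p q)).es (legs A (B.step j (.ladder w p q)).own c) =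
      2 ^ (j * w) * ∑ a, ∑ b, ladderTensor ((j : R) + 1) w a (c p) (c q) b *
        partFn R B.es (legs A B.own (Function.update (Function.update c p a) q b)) := by
  obtain ⟨i, rfl⟩ : ∃ i, w = i + 1 := ⟨w - 1, by omega⟩
  have hq' : q ∈ A.erase p := Finset.mem_erase.2 ⟨hpq.symm, hq⟩
  set ℓ : Multiset (ℕ × Fin N) := legs ((A.erase p).erase q) B.own c with hℓ
  have hlegs : legs A (B.step j (.ladder (i + 1) p q)).own c =
      ((B.blocks j p (i + 1)).y₂, c q) ::ₘ (B.nv + j, c p) ::ₘ ℓ := by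
    simp only [legs, Builder.step, hℓ]
    rw [Builder.own_blocks, Builder.map_val_eq_add_erase hp, Builder.map_val_eq_add_erase hq',
      Function.update_self, Function.update_of_ne hpq, Function.update_self,
      Builder.map_val_congr (A := (A.erase p).erase q) (g := fun x => (B.own x, c x))]
    · simp only [← Multiset.singleton_add]
      abel
    · intro x hx
      simp only [Finset.mem_erase] at hx
      rw [Function.update_of_ne hx.1, Function.update_of_ne hx.2.1]
  have hlegs' : ∀ a b, legs A B.own (Function.update (Function.update c p a) q b) =
      (B.own p, a) ::ₘ (B.own q, b) ::ₘ ℓ := by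
    intro a b
    simp only [legs, hℓ]
    rw [Builder.map_val_eq_add_erase hp, Builder.map_val_eq_add_erase hq',
      Function.update_self, Function.update_of_ne hpq, Function.update_self,
      Builder.map_val_congr (A := (A.erase p).erase q) (g := fun x => (B.own x, c x))]
    · simp only [← Multiset.singleton_add]
    · intro x hx
      simp only [Finset.mem_erase] at hx
      rw [Function.update_of_ne hx.1, Function.update_of_ne hx.2.1]
  have hlt : ∀ x ∈ ℓ, x.1 < B.nv := by
    intro x hx
    obtain ⟨y, hy, rfl⟩ := Multiset.mem_map.1 hx
    exact h.own_lt y (Finset.mem_of_mem_erase (Finset.mem_of_mem_erase hy))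
  rw [hlegs]
  simp only [hlegs']
  have hown : (B.blocks j p (i + 1)).own q = B.own q := by
    rw [Builder.own_blocks, Function.update_of_ne hpq.symm]
  simp only [Builder.step]
  rw [partFn_concat, hown, Finset.sum_comm, Finset.mul_sum]
  refine Finset.sum_congr rfl fun b _ => ?_
  have h1 := (partFn_blocks hN j p B h.es_lt (h.own_lt p hp) i b (c p) (c q)
    (ℓ := (B.own q, b) ::ₘ ℓ) (by
      intro x hx
      rcases Multiset.mem_cons.1 hx with rfl | hx
      · exact h.own_lt q hq
      · exact hlt x hx)).2
  rw [← h1]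
  congr 1
  simp only [← Multiset.singleton_add]
  abel

/-- The partition function of the graph that is built, in terms of the tensor of the code. -/
theorem ValidCode.partFn_eq (hN : (N : R) = 0) {l : List Instr} {A : Finset ℕ}
    (h : ValidCode l A) (j : ℕ) (c : ℕ → Fin N) :
    partFn R (build j l).es (legs A (build j l).own c) =
      2 ^ (j * numBoxes l) * codeTensor ((j : R) + 1) l c := by
  induction h generalizing c with
  | nil => simp [partFn, legs, matchCount_zero, codeTensor]
  | fresh h' h1 h2 h3 ih =>
    rw [build_concat, partFn_step_fresh hN (h'.saturated j) h1 h2 h3, ih, codeTensor_concat]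
    simp only [Instr.act, numBoxes_append]
    simp only [numBoxes, List.map_cons, List.map_nil, List.sum_cons, List.sum_nil, Instr.boxes,
      add_zero]
    ring
  | ladder h' h1 h2 h3 h4 ih =>
    rw [build_concat, partFn_step_ladder hN (h'.saturated j) h1 h2 h3 h4, codeTensor_concat]
    simp only [ih, Instr.act, numBoxes_append]
    simp only [numBoxes, List.map_cons, List.map_nil, List.sum_cons, List.sum_nil, Instr.boxes,
      add_zero, mul_add, pow_add, Finset.mul_sum]
    refine Finset.sum_congr rfl fun a _ => Finset.sum_congr rfl fun b _ => ?_
    ring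

/-- Every box is affine in κ, so the degree is at most the number of boxes. -/
theorem exists_polynomial_codeTensor (l : List Instr) (c : ℕ → Fin N) :
    ∃ p : Polynomial R, p.natDegree ≤ numBoxes l ∧ ∀ κ, codeTensor κ l c = p.eval κ := by
  induction l using List.reverseRecOn generalizing c with
  | nil => exact ⟨1, by simp, fun κ => by simp [codeTensor]⟩
  | append_singleton l i ih =>
    choose P hP hP' using ih
    cases i with
    | fresh p q =>
      refine ⟨Polynomial.C (2 * delta R (c p) (c q)) * P c, ?_, fun κ => ?_⟩
      · refine (Polynomial.natDegree_C_mul_le _ _).trans ((hP c).trans ?_)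
        simp
      · simp only [codeTensor_concat, Instr.act, Polynomial.eval_mul, Polynomial.eval_C, hP']
    | ladder w p q =>
      choose Q hQ hQ' using fun a b => exists_polynomial_ladderTensor (R := R) w a (c p) (c q) b
      refine ⟨∑ a, ∑ b, Q a b * P (Function.update (Function.update c p a) q b), ?_, fun κ => ?_⟩
      · refine Polynomial.natDegree_sum_le_of_forall_le _ _ fun x _ =>
          Polynomial.natDegree_sum_le_of_forall_le _ _ fun y _ => ?_
        refine (Polynomial.natDegree_mul_le_of_le (hQ x y) (hP _)).trans ?_
        rw [numBoxes_append, add_comm]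
        simp [numBoxes, Instr.boxes]
      · simp only [codeTensor_concat, Instr.act, Polynomial.eval_finsetSum, Polynomial.eval_mul,
          hP', hQ']

/-- At κ = 0 a ladder is a weighted choice: weight `w` for leaving the two legs alone, weight 1 for
exchanging them. -/
theorem codeTensor_zero_ladder (hN : (N : R) = 0) (l : List Instr) (w p q : ℕ)
    (c : ℕ → Fin N) :
    codeTensor (0 : R) (l ++ [.ladder w p q]) c = w * codeTensor 0 l c +
      codeTensor 0 l (Function.update (Function.update c p (c q)) q (c p)) := by
  rw [codeTensor_concat]
  simp only [Instr.act, ladderTensor_zero hN]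
  have h : ∀ a b, (delta R a (c q) * delta R b (c p) +
      w * (delta R a (c p) * delta R b (c q))) *
        codeTensor (0 : R) l (Function.update (Function.update c p a) q b) =
      delta R a (c q) * (delta R b (c p) *
        codeTensor (0 : R) l (Function.update (Function.update c p a) q b)) +
      w * (delta R a (c p) * (delta R b (c q) *
        codeTensor (0 : R) l (Function.update (Function.update c p a) q b))) := by
    intro a b; ring
  simp only [h, Finset.sum_add_distrib, ← Finset.mul_sum, sum_delta_mul']
  rw [add_comm]
  simp

end Semantics

/-! ## The code of a graph -/

section Code

variable (inp : ℕ → ℕ)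

/-- The number of darts `p < i` at the vertex `v`, where `inp p` is the vertex of the dart `p`. -/
def countBefore (v : ℕ) : ℕ → ℕ
  | 0 => 0
  | i + 1 => if inp i = v then countBefore v i + 1 else countBefore v i

/-- The last dart `p < i` at the vertex `v`. -/
def lastBefore (v : ℕ) : ℕ → ℕ
  | 0 => 0
  | i + 1 => if inp i = v then i else lastBefore v i

/-- The ladders between `q` and the darts `p < i` at the vertex `v`. -/
def ladders (v m q : ℕ) : ℕ → List Instr
  | 0 => []
  | i + 1 => if inp i = v then ladders v m q i ++ [.ladder (m - countBefore inp v i) i q]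
      else ladders v m q i

/-- The instructions that attach the dart `q` and the dart before it at the same vertex, if `q` has
even position there. -/
def dartCode (q : ℕ) : List Instr :=
  if countBefore inp (inp q) q % 2 = 1 then
    .fresh (lastBefore inp (inp q) q) q ::
      ladders inp (inp q) (countBefore inp (inp q) q - 1) q (lastBefore inp (inp q) q)
  else []

/-- The instructions for the darts before `q`. -/
def code : ℕ → List Instr
  | 0 => []
  | q + 1 => code q ++ dartCode inp q

/-- The legs attached by the code for the darts before `q`. -/
def attached (q : ℕ) : Finset ℕ :=
  (Finset.range q).filter fun p =>
    ¬ (countBefore inp (inp p) q % 2 = 1 ∧ p = lastBefore inp (inp p) q)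

variable {inp}

/-- The positivity is needed because `lastBefore` takes the default value `0` when there is no
earlier dart at `v`. -/
theorem lastBefore_spec {v i : ℕ} (h : 0 < countBefore inp v i) :
    lastBefore inp v i < i ∧ inp (lastBefore inp v i) = v ∧
      (∀ p < i, inp p = v → p ≤ lastBefore inp v i) ∧
      countBefore inp v i = countBefore inp v (lastBefore inp v i) + 1 := by
  induction i with
  | zero => simp [countBefore] at h
  | succ i ih =>
    by_cases hi : inp i = v
    · simp only [lastBefore, countBefore, if_pos hi]
      exact ⟨Nat.lt_succ_self i, hi, fun p hp _ => Nat.lt_succ_iff.1 hp, trivial⟩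
    · simp only [lastBefore, countBefore, if_neg hi] at h ⊢
      obtain ⟨a, b, c, d⟩ := ih h
      refine ⟨by omega, b, fun p hp hv => ?_, d⟩
      rcases Nat.lt_succ_iff_lt_or_eq.1 hp with hp | rfl
      · exact c p hp hv
      · exact absurd hv hi

theorem countBefore_mono {v i i' : ℕ} (h : i ≤ i') :
    countBefore inp v i ≤ countBefore inp v i' := by
  induction h with
  | refl => rfl
  | step _ ih =>
    refine ih.trans ?_
    simp only [countBefore]
    split_ifs <;> omega

theorem countBefore_le (v i : ℕ) : countBefore inp v i ≤ i := by
  induction i with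
  | zero => rfl
  | succ i ih => simp only [countBefore]; split_ifs <;> omega

theorem lastBefore_le (v i : ℕ) : lastBefore inp v i ≤ i := by
  induction i with
  | zero => rfl
  | succ i ih => simp only [lastBefore]; split_ifs <;> omega

theorem countBefore_pos {v i p : ℕ} (hp : p < i) (hv : inp p = v) : 0 < countBefore inp v i := by
  refine lt_of_lt_of_le ?_ (countBefore_mono (Nat.succ_le_of_lt hp))
  simp [countBefore, hv]

theorem mem_attached_iff {p q : ℕ} : p ∈ attached inp q ↔
    p < q ∧ ¬ (countBefore inp (inp p) q % 2 = 1 ∧ p = lastBefore inp (inp p) q) := by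
  simp only [attached, Finset.mem_filter, Finset.mem_range]

/-- The dart `q` becomes the pending dart of its vertex and waits for a partner. -/
theorem attached_succ_of_even {q : ℕ} (h : ¬ countBefore inp (inp q) q % 2 = 1) :
    attached inp (q + 1) = attached inp q := by
  ext p
  simp only [mem_attached_iff, countBefore, lastBefore]
  rcases lt_trichotomy p q with hp | rfl | hp
  · by_cases hv : inp q = inp p
    · simp only [if_pos hv]
      rw [hv] at h
      constructor
      · exact fun _ => ⟨hp, fun hh => h hh.1⟩
      · exact fun _ => ⟨by omega, fun hh => by omega⟩
    · simp only [if_neg hv]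
      constructor
      · exact fun hh => ⟨hp, hh.2⟩
      · exact fun hh => ⟨by omega, hh.2⟩
  · simp; omega
  · constructor <;> intro hh <;> omega

/-- The pending dart of the vertex and `q` enter together, as the two legs of a fresh strand. -/
theorem attached_succ_of_odd {q : ℕ} (h : countBefore inp (inp q) q % 2 = 1) :
    attached inp (q + 1) =
      insert (lastBefore inp (inp q) q) (insert q (attached inp q)) := by
  obtain ⟨h1, h2, -, -⟩ := lastBefore_spec (inp := inp) (v := inp q) (i := q) (by omega)
  ext p
  simp only [Finset.mem_insert, mem_attached_iff, countBefore, lastBefore]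
  rcases lt_trichotomy p q with hp | rfl | hp
  · by_cases hv : inp q = inp p
    · simp only [if_pos hv]
      rw [hv] at h ⊢
      constructor
      · intro _
        by_cases hz : p = lastBefore inp (inp p) q
        · exact Or.inl hz
        · exact Or.inr (Or.inr ⟨hp, fun hh => hz hh.2⟩)
      · exact fun _ => ⟨by omega, fun hh => by omega⟩
    · simp only [if_neg hv]
      constructor
      · exact fun hh => Or.inr (Or.inr ⟨hp, hh.2⟩)
      · rintro (rfl | rfl | hh)
        · exact absurd h2.symm hv
        · exact absurd rfl hv
        · exact ⟨by omega, hh.2⟩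
  · simp; omega
  · constructor <;> intro hh <;> omega

theorem lastBefore_notMem_attached {q : ℕ} (h : countBefore inp (inp q) q % 2 = 1) :
    lastBefore inp (inp q) q ∉ attached inp q := by
  obtain ⟨h1, h2, -, -⟩ := lastBefore_spec (inp := inp) (v := inp q) (i := q) (by omega)
  intro hm
  have := (mem_attached_iff.1 hm).2
  rw [h2] at this
  exact this ⟨h, rfl⟩

theorem notMem_attached {q : ℕ} : q ∉ attached inp q := by simp [attached]

theorem mem_attached {q p : ℕ} (hp : p < q) (h : p ≠ lastBefore inp (inp p) q) :
    p ∈ attached inp q := by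
  exact mem_attached_iff.2 ⟨hp, fun hh => h hh.2⟩

/-- Only darts strictly before the pending one receive a ladder, and fewer than m of them precede
any of these; so no ladder is empty and no leg is paired with itself. -/
theorem validCode_ladders {q : ℕ} (h : countBefore inp (inp q) q % 2 = 1) {l : List Instr}
    (hl : ValidCode l (insert (lastBefore inp (inp q) q) (insert q (attached inp q)))) {i : ℕ}
    (hi : i ≤ lastBefore inp (inp q) q) :
    ValidCode (l ++ ladders inp (inp q) (countBefore inp (inp q) q - 1) q i)
      (insert (lastBefore inp (inp q) q) (insert q (attached inp q))) := by
  obtain ⟨h1, h2, h3, h4⟩ := lastBefore_spec (inp := inp) (v := inp q) (i := q) (by omega)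
  induction i with
  | zero => simpa [ladders] using hl
  | succ i ih =>
    by_cases hv : inp i = inp q
    · simp only [ladders, if_pos hv]
      rw [← List.append_assoc]
      have hc := countBefore_mono (inp := inp) (v := inp q) hi
      simp only [countBefore, if_pos hv] at hc
      refine ValidCode.ladder (ih (by omega)) (by omega) (by omega) ?_ ?_
      · refine Finset.mem_insert_of_mem (Finset.mem_insert_of_mem (mem_attached (by omega) ?_))
        rw [hv]; omega
      · exact Finset.mem_insert_of_mem (Finset.mem_insert_self _ _)
    · simp only [ladders, if_neg hv]
      exact ih (by omega)

theorem validCode_code (q : ℕ) : ValidCode (code inp q) (attached inp q) := by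
  induction q with
  | zero => exact ValidCode.nil
  | succ q ih =>
    rw [code, dartCode]
    split_ifs with h
    · obtain ⟨h1, -, -, -⟩ := lastBefore_spec (inp := inp) (v := inp q) (i := q) (by omega)
      rw [attached_succ_of_odd h, ← List.singleton_append, ← List.append_assoc]
      exact validCode_ladders h
        (ValidCode.fresh ih (by omega) (lastBefore_notMem_attached h) notMem_attached) le_rfl
    · rw [attached_succ_of_even h, List.append_nil]
      exact ih

/-! ### At κ = 0 the code computes matching numbers. -/

section Tensor

variable {N : ℕ} {R : Type*} [CommRing R]

/-- Let z be the pending dart. The first summand leaves z matched with `q`; in the others z is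
matched with an earlier dart `p`, whose place `q` takes. After r of the m ladders all these earlier
`p` have the same coefficient β, and β (m - r + 1) is the coefficient of the first summand. At r = m
the two agree, so the choice has become uniform. The alternative `countBefore = 0` covers the start,
where β multiplies an empty sum. -/
theorem codeTensor_ladders (hN : (N : R) = 0) {q : ℕ} (h : countBefore inp (inp q) q % 2 = 1)
    {l : List Instr}
    (hl : ∀ c : ℕ → Fin N, codeTensor (0 : R) l c = normConst l *
      (delta R (c (lastBefore inp (inp q) q)) (c q) * matchCount (legs (attached inp q) inp c)))
    {i : ℕ} (hi : i ≤ lastBefore inp (inp q) q) :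
    ∃ β : ℕ, (countBefore inp (inp q) i = 0 ∨
        β * (countBefore inp (inp q) q - 1 - countBefore inp (inp q) i + 1) =
          normConst (l ++ ladders inp (inp q) (countBefore inp (inp q) q - 1) q i)) ∧
      ∀ c : ℕ → Fin N,
        codeTensor (0 : R) (l ++ ladders inp (inp q) (countBefore inp (inp q) q - 1) q i) c =
          normConst (l ++ ladders inp (inp q) (countBefore inp (inp q) q - 1) q i) *
            (delta R (c (lastBefore inp (inp q) q)) (c q) *
              matchCount (legs (attached inp q) inp c)) +
          β * ((∑ p ∈ Finset.range i,
              if inp p = inp q ∧ c p = c (lastBefore inp (inp q) q) then 1 else 0 : ℕ) *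
            matchCount ((inp q, c q) ::ₘ (legs (attached inp q) inp c).erase
              (inp q, c (lastBefore inp (inp q) q)))) := by
  obtain ⟨h1, h2, h3, h4⟩ := lastBefore_spec (inp := inp) (v := inp q) (i := q) (by omega)
  have hm : countBefore inp (inp q) q - 1 = countBefore inp (inp q) (lastBefore inp (inp q) q) := by
    omega
  rw [hm]
  generalize hz : lastBefore inp (inp q) q = z at *
  generalize hmm : countBefore inp (inp q) z = m at *
  induction i with
  | zero => exact ⟨0, Or.inl rfl, fun c => by simp [ladders, hl c]⟩
  | succ i ih =>
    obtain ⟨β, hβ, hT⟩ := ih (by omega)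
    clear ih
    by_cases hv : inp i = inp q
    · have hc := countBefore_mono (inp := inp) (v := inp q) hi
      simp only [ladders, countBefore, if_pos hv] at hc ⊢
      generalize hr : countBefore inp (inp q) i = r at *
      rw [hmm] at hc
      rw [← List.append_assoc]
      generalize hl' : l ++ ladders inp (inp q) m q i = l' at *
      have hnorm : normConst (l' ++ [.ladder (m - r) i q]) = normConst l' * (m - r) := by
        rw [normConst_append]; simp [normConst, Instr.norm]
      -- The newly admitted partner `i` comes from exchanging in the first summand, hence with the
      -- old constant; the earlier ones had β and receive β (m - r) + β, which is the same.
      refine ⟨normConst l', Or.inr ?_, fun c => ?_⟩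
      · rw [hnorm]; congr 1; omega
      have hiA : i ∈ attached inp q := mem_attached (by omega) (by rw [hv]; omega)
      set S₀ : Multiset (ℕ × Fin N) := legs ((attached inp q).erase i) inp c with hS₀
      have hS : legs (attached inp q) inp c = (inp q, c i) ::ₘ S₀ := by
        rw [legs, Builder.map_val_eq_add_erase hiA, Multiset.singleton_add, hv]; rfl
      set c' := Function.update (Function.update c i (c q)) q (c i) with hc'
      have hc'i : c' i = c q := by
        rw [hc', Function.update_of_ne (by omega), Function.update_self]
      have hc'q : c' q = c i := by rw [hc', Function.update_self]
      have hc'o : ∀ x, x ≠ i → x ≠ q → c' x = c x := by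
        intro x hx hx'
        rw [hc', Function.update_of_ne hx', Function.update_of_ne hx]
      have hS' : legs (attached inp q) inp c' = (inp q, c q) ::ₘ S₀ := by
        rw [legs, Builder.map_val_eq_add_erase hiA, Multiset.singleton_add, hv, hc'i, hS₀, legs]
        congr 1
        refine Builder.map_val_congr fun x hx => ?_
        obtain ⟨hx1, hx2⟩ := Finset.mem_erase.1 hx
        rw [hc'o x hx1 (ne_of_mem_of_not_mem hx2 notMem_attached)]
      have hsum : (∑ p ∈ Finset.range i, if inp p = inp q ∧ c' p = c' z then 1 else 0 : ℕ) =
          ∑ p ∈ Finset.range i, if inp p = inp q ∧ c p = c z then 1 else 0 := by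
        refine Finset.sum_congr rfl fun p hp => ?_
        have := Finset.mem_range.1 hp
        rw [hc'o p (by omega) (by omega), hc'o z (by omega) (by omega)]
      rw [codeTensor_zero_ladder hN, ← hc', hT, hT, hsum, hS, hS', hc'q, hc'o z (by omega) (by omega),
        Finset.sum_range_succ, hnorm]
      generalize hk : (∑ p ∈ Finset.range i, if inp p = inp q ∧ c p = c z then 1 else 0 : ℕ) = k
      -- If some dart is counted by `k`, its leg of colour `c z` is still present after removing the
      -- leg of `i`.
      have hmem : k = 0 ∨ (inp q, c z) ∈ S₀ := by
        rcases Nat.eq_zero_or_pos k with h0 | hpos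
        · exact Or.inl h0
        · right
          obtain ⟨p, hp, hp'⟩ : ∃ p ∈ Finset.range i,
              0 < (if inp p = inp q ∧ c p = c z then 1 else 0 : ℕ) := by
            by_contra hcon
            push Not at hcon
            rw [← hk] at hpos
            exact absurd (Finset.sum_nonpos hcon) (by omega)
          have hpi := Finset.mem_range.1 hp
          have hpp : inp p = inp q ∧ c p = c z := by
            by_contra hcon
            simp [hcon] at hp'
          refine Multiset.mem_map.2 ⟨p, Finset.mem_erase.2 ⟨by omega,
            mem_attached (by omega) (by rw [hpp.1]; omega)⟩, ?_⟩
          rw [hpp.1, hpp.2]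
      -- The erased element can be taken from `S₀`, after which the colours of `i` and `q` enter
      -- symmetrically; so the exchange does not affect the terms of earlier partners.
      have hkey : k * matchCount ((inp q, c i) ::ₘ ((inp q, c q) ::ₘ S₀).erase (inp q, c z)) =
          k * matchCount ((inp q, c q) ::ₘ ((inp q, c i) ::ₘ S₀).erase (inp q, c z)) := by
        rcases hmem with rfl | hmem
        · simp
        · rw [Multiset.erase_cons_tail_of_mem hmem, Multiset.erase_cons_tail_of_mem hmem,
            Multiset.cons_swap]
      -- Where β is unconstrained there is no earlier dart, and `k = 0`.
      have hβ' : k * (β * (m - r + 1)) = k * normConst l' := by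
        rcases hβ with h0 | hβ
        · have : k = 0 := by
            rcases Nat.eq_zero_or_pos k with h0 | hpos
            · exact h0
            · exfalso
              obtain ⟨p, hp, hp'⟩ : ∃ p ∈ Finset.range i,
                  0 < (if inp p = inp q ∧ c p = c z then 1 else 0 : ℕ) := by
                by_contra hcon
                push Not at hcon
                rw [← hk] at hpos
                exact absurd (Finset.sum_nonpos hcon) (by omega)
              have hpp : inp p = inp q ∧ c p = c z := by
                by_contra hcon
                simp [hcon] at hp'
              have := countBefore_pos (inp := inp) (Finset.mem_range.1 hp) hpp.1
              omega
          simp [this]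
        · rw [hβ]
      have hkeyR := congrArg (Nat.cast : ℕ → R) hkey
      have hβR := congrArg (Nat.cast : ℕ → R) hβ'
      push_cast at hkeyR hβR
      push_cast
      by_cases hcz : c i = c z
      · simp only [hv, hcz, and_self, if_true, delta_self, one_mul, Multiset.erase_cons_head]
          at hkeyR ⊢
        rw [hkeyR]
        linear_combination (matchCount ((inp q, c q) ::ₘ S₀) : R) * hβR
      · have hcz' : ¬ c z = c i := fun e => hcz e.symm
        rw [if_neg (fun hh => hcz hh.2), hkeyR, delta, delta, if_neg hcz']
        linear_combination
          (matchCount ((inp q, c q) ::ₘ ((inp q, c i) ::ₘ S₀).erase (inp q, c z)) : R) * hβR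
    · simp only [ladders, countBefore, if_neg hv]
      refine ⟨β, hβ, fun c => ?_⟩
      rw [hT c, Finset.sum_range_succ, if_neg (fun hh => hv hh.1), add_zero]

/-- The right-hand side obeys `matchCount_cons` for the pending dart: its partner is `q` or one of
the earlier darts. The ladders give all of these one coefficient. -/
theorem codeTensor_code (hN : (N : R) = 0) (q : ℕ) (c : ℕ → Fin N) :
    codeTensor (0 : R) (code inp q) c =
      normConst (code inp q) * matchCount (legs (attached inp q) inp c) := by
  induction q generalizing c with
  | zero => simp [code, codeTensor, attached, legs, matchCount_zero]
  | succ q ih =>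
    rw [code, dartCode]
    split_ifs with h
    · obtain ⟨h1, h2, h3, h4⟩ := lastBefore_spec (inp := inp) (v := inp q) (i := q) (by omega)
      have hz := lastBefore_notMem_attached h
      rw [attached_succ_of_odd h, ← List.singleton_append, ← List.append_assoc]
      obtain ⟨β, hβ, hc⟩ := codeTensor_ladders (inp := inp) hN h
        (l := code inp q ++ [.fresh (lastBefore inp (inp q) q) q]) (by
          intro c
          rw [codeTensor_concat, normConst_append]
          simp only [Instr.act, ih, normConst, List.map_cons, List.map_nil, List.prod_cons,
            List.prod_nil, Instr.norm]
          push_cast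
          ring) le_rfl
      rw [hc]
      generalize hl : code inp q ++ [.fresh (lastBefore inp (inp q) q) q] ++ ladders inp (inp q)
        (countBefore inp (inp q) q - 1) q (lastBefore inp (inp q) q) = l at *
      -- All m ladders have been placed, so the remaining factor is 1 and β is the full normalizing
      -- constant.
      have hm : countBefore inp (inp q) q - 1 -
          countBefore inp (inp q) (lastBefore inp (inp q) q) = 0 := by omega
      rw [hm, zero_add, mul_one] at hβ
      have hlegs : legs (insert (lastBefore inp (inp q) q) (insert q (attached inp q))) inp c =
          (inp q, c (lastBefore inp (inp q) q)) ::ₘ (inp q, c q) ::ₘ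
            legs (attached inp q) inp c := by
        rw [legs, Finset.insert_val_of_notMem (by simp [hz]; omega),
          Finset.insert_val_of_notMem notMem_attached, Multiset.map_cons, Multiset.map_cons, h2]
        rfl
      have hcount : Multiset.count (inp q, c (lastBefore inp (inp q) q))
          (legs (attached inp q) inp c) = ∑ p ∈ Finset.range (lastBefore inp (inp q) q),
            if inp p = inp q ∧ c p = c (lastBefore inp (inp q) q) then 1 else 0 := by
        rw [legs, Multiset.count_map, ← Finset.card_filter]
        change (Finset.filter _ (attached inp q)).card = _
        congr 1
        ext p
        simp only [Finset.mem_filter, Finset.mem_range, Prod.mk.injEq]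
        constructor
        · rintro ⟨hp, hp1, hp2⟩
          have hpq : p < q := (mem_attached_iff.1 hp).1
          refine ⟨lt_of_le_of_ne (h3 p hpq hp1.symm) ?_, hp1.symm, hp2.symm⟩
          rintro rfl
          exact hz hp
        · rintro ⟨hp, hp1, hp2⟩
          exact ⟨mem_attached (by omega) (by rw [hp1]; omega), hp1.symm, hp2.symm⟩
      rw [hlegs, matchCount_cons (inp q, c (lastBefore inp (inp q) q)), ← hcount]
      generalize lastBefore inp (inp q) q = z at *
      generalize hS : legs (attached inp q) inp c = S at *
      have hβ' : (β * (Multiset.count (inp q, c z) S * matchCount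
          ((inp q, c q) ::ₘ S.erase (inp q, c z))) : R) =
          normConst l * (Multiset.count (inp q, c z) S * matchCount
          ((inp q, c q) ::ₘ S.erase (inp q, c z))) := by
        rcases hβ with h0 | hβ
        · have : Multiset.count (inp q, c z) S = 0 := by
            rw [hcount]
            refine Finset.sum_eq_zero fun p hp => ?_
            rw [if_neg]
            intro hh
            have := countBefore_pos (inp := inp) (Finset.mem_range.1 hp) hh.1
            omega
          simp [this]
        · rw [hβ]
      rw [hβ', ← mul_add]
      congr 1
      by_cases hzq : c z = c q
      · rw [hzq, Multiset.erase_cons_head, Multiset.count_cons_self, delta_self]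
        by_cases hmem : (inp q, c q) ∈ S
        · rw [Multiset.cons_erase hmem]
          push_cast; ring
        · rw [Multiset.count_eq_zero_of_notMem hmem]
          push_cast; ring
      · have hne : (inp q, c q) ≠ (inp q, c z) := by
          intro e
          exact hzq (congrArg Prod.snd e).symm
        rw [Multiset.count_cons_of_ne hne.symm, Multiset.erase_cons_tail _ hne, delta, if_neg hzq]
        push_cast; ring
    · rw [attached_succ_of_even h, List.append_nil]
      exact ih c

end Tensor

end Code

/-! ## The 4-regular graphs that simulate an Eulerian graph -/

/-- The word that lists the ends of the edges. -/
def flatEdges (es : List (ℕ × ℕ)) : List ℕ := es.flatMap fun e => [e.1, e.2]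

@[simp] theorem flatEdges_nil : flatEdges [] = [] := rfl

@[simp] theorem flatEdges_cons (e : ℕ × ℕ) (es : List (ℕ × ℕ)) :
    flatEdges (e :: es) = e.1 :: e.2 :: flatEdges es := rfl

@[simp] theorem flatEdges_append (es fs : List (ℕ × ℕ)) :
    flatEdges (es ++ fs) = flatEdges es ++ flatEdges fs := by simp [flatEdges]

@[simp] theorem length_flatEdges (es : List (ℕ × ℕ)) :
    (flatEdges es).length = 2 * es.length := by
  induction es with
  | nil => rfl
  | cons e es ih => simp [ih]; ring

theorem getD_flatEdges_ofFn {m : ℕ} (g : Fin m → ℕ × ℕ) (i : Fin m) :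
    (flatEdges (List.ofFn g)).getD (2 * i) 0 = (g i).1 ∧
      (flatEdges (List.ofFn g)).getD (2 * i + 1) 0 = (g i).2 := by
  induction m with
  | zero => exact i.elim0
  | succ m ih =>
    rw [List.ofFn_succ, flatEdges_cons]
    refine Fin.cases ?_ (fun i => ?_) i
    · simp
    · have := ih (fun i => g i.succ) i
      simp only [Fin.val_succ, mul_add, mul_one]
      exact this

theorem Multigraph.encode_eq_flatEdges (G : Multigraph) :
    G.encode = G.numVerts ::
      flatEdges (List.ofFn fun i => (((G.ends i).1 : ℕ), ((G.ends i).2 : ℕ))) := by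
  rw [Multigraph.encode, flatEdges, List.flatMap_def, List.flatMap_def, List.map_ofFn, List.map_ofFn]
  rfl

/-- The vertex of the dart number `x` (the darts of the edge `e` have the numbers `2 * e` and
`2 * e + 1`), as it appears in the encoding. -/
def Multigraph.dartVertex (G : Multigraph) (x : ℕ) : ℕ := G.encode.getD (x + 1) 0

theorem Multigraph.dartVertex_edge (G : Multigraph) (e : Fin G.numEdges) :
    G.dartVertex (2 * e) = (G.ends e).1 ∧ G.dartVertex (2 * e + 1) = (G.ends e).2 := by
  rw [dartVertex, dartVertex, encode_eq_flatEdges, List.getD_cons_succ, List.getD_cons_succ]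
  exact getD_flatEdges_ofFn _ e

theorem map_range_two_mul {α : Type*} (m : ℕ) (f : ℕ → α) :
    (Finset.range (2 * m)).val.map f = ∑ i : Fin m, {f (2 * i), f (2 * i + 1)} := by
  induction m with
  | zero => simp
  | succ m ih =>
    rw [Fin.sum_univ_castSucc, mul_add, mul_one, Finset.range_val, Multiset.range_succ,
      Multiset.range_succ, Multiset.map_cons, Multiset.map_cons, ← Finset.range_val, ih]
    simp only [Fin.val_castSucc, Fin.val_last, Multiset.insert_eq_cons, ← Multiset.singleton_add]
    abel

theorem Multigraph.map_src_val (G : Multigraph) :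
    (Finset.univ : Finset G.Dart).val.map (fun d => (G.src d : ℕ)) =
      ∑ i, {((G.ends i).1 : ℕ), ((G.ends i).2 : ℕ)} := by
  rw [univ_dart_map]
  simp [src]

theorem Multigraph.degree_eq_count (G : Multigraph) (v : Fin G.numVerts) :
    G.degree v = Multiset.count (v : ℕ)
      ((Finset.univ : Finset G.Dart).val.map fun d => (G.src d : ℕ)) := by
  rw [Multiset.count_map, degree]
  change _ = (Finset.filter _ Finset.univ).card
  congr 1
  ext d
  simp [Fin.ext_iff, eq_comm]

theorem countBefore_eq_count (inp : ℕ → ℕ) (v i : ℕ) :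
    countBefore inp v i = Multiset.count v ((Finset.range i).val.map inp) := by
  induction i with
  | zero => rfl
  | succ i ih =>
    rw [Finset.range_val, Multiset.range_succ, Multiset.map_cons, Multiset.count_cons,
      ← Finset.range_val, ← ih, countBefore]
    by_cases h : inp i = v
    · simp [h]
    · simp [h, Ne.symm h]

/-- A dart is left pending only at a vertex with an odd number of darts. -/
theorem Multigraph.attached_eq_range (G : Multigraph) (hG : ∀ v, Even (G.degree v)) :
    attached G.dartVertex (2 * G.numEdges) = Finset.range (2 * G.numEdges) := by
  refine Finset.filter_true_of_mem fun p hp => ?_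
  rintro ⟨h, -⟩
  have hmap : (Finset.range (2 * G.numEdges)).val.map G.dartVertex =
      (Finset.univ : Finset G.Dart).val.map fun d => (G.src d : ℕ) := by
    rw [map_range_two_mul, map_src_val]
    refine Finset.sum_congr rfl fun e _ => ?_
    rw [(G.dartVertex_edge e).1, (G.dartVertex_edge e).2]
  have hmem : G.dartVertex p ∈ (Finset.univ : Finset G.Dart).val.map fun d => (G.src d : ℕ) := by
    rw [← hmap]
    exact Multiset.mem_map_of_mem _ hp
  obtain ⟨d, -, hd⟩ := Multiset.mem_map.1 hmem
  rw [countBefore_eq_count, hmap, ← hd, ← G.degree_eq_count] at h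
  exact (Nat.not_even_iff.2 h) (hG _)

/-- Join the legs `2 * e` and `2 * e + 1` for `e < m`. -/
def Builder.close (B : Builder) (m : ℕ) (h : B.Saturated (Finset.range (2 * m))) : Multigraph where
  numVerts := B.nv
  numEdges := B.es.length + m
  ends := Fin.append
    (fun i => (⟨(B.es.get i).1, (h.es_lt _ (List.get_mem _ i)).1⟩,
      ⟨(B.es.get i).2, (h.es_lt _ (List.get_mem _ i)).2⟩))
    (fun e => (⟨B.own (2 * e), h.own_lt _ (Finset.mem_range.2 (by omega))⟩,
      ⟨B.own (2 * e + 1), h.own_lt _ (Finset.mem_range.2 (by omega))⟩))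

/-- The edges that join the legs `2 * e` and `2 * e + 1` for `e < m`. -/
def closingEdges (own : ℕ → ℕ) (m : ℕ) : List (ℕ × ℕ) :=
  List.ofFn fun e : Fin m => (own (2 * e), own (2 * e + 1))

/-! ### Joining the legs along the edges of the original graph. -/

section Close

variable {B : Builder} {m : ℕ} (h : B.Saturated (Finset.range (2 * m)))

theorem Builder.ends_close : (fun i => ((((B.close m h).ends i).1 : ℕ),
      (((B.close m h).ends i).2 : ℕ))) =
    Fin.append B.es.get fun e : Fin m => (B.own (2 * e), B.own (2 * e + 1)) := by
  funext i
  refine Fin.addCases (fun i => ?_) (fun i => ?_) i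
  · simp [close]
  · simp [close]

theorem Builder.encode_close : (B.close m h).encode =
    B.nv :: flatEdges (B.es ++ closingEdges B.own m) := by
  rw [Multigraph.encode_eq_flatEdges, Builder.ends_close]
  congr 2
  refine (List.ofFn_fin_append _ _).trans ?_
  rw [List.ofFn_get, closingEdges]

theorem sum_get_eq_edgeEnds (es : List (ℕ × ℕ)) :
    ∑ i : Fin es.length, ({(es.get i).1, (es.get i).2} : Multiset ℕ) = edgeEnds es := by
  rw [edgeEnds, ← List.sum_ofFn]
  congr 1
  conv_rhs => rw [← List.ofFn_get es, List.map_ofFn]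
  rfl

/-- The closing edges have exactly the owners of the legs as their ends, and `Saturated` counts four
ends at each vertex. -/
theorem Builder.isFourRegular_close : (B.close m h).IsFourRegular := by
  intro v
  have hsum : ∑ i, ({(((B.close m h).ends i).1 : ℕ), (((B.close m h).ends i).2 : ℕ)} : Multiset ℕ) =
      edgeEnds B.es + (Finset.range (2 * m)).val.map B.own := by
    have := congrFun (Builder.ends_close h)
    rw [map_range_two_mul, ← sum_get_eq_edgeEnds]
    refine (Fin.sum_univ_add (fun i => ({(((B.close m h).ends i).1 : ℕ),
      (((B.close m h).ends i).2 : ℕ)} : Multiset ℕ))).trans ?_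
    simp [close]
  rw [Multigraph.degree_eq_count, Multigraph.map_src_val, hsum, h, Multiset.count_nsmul]
  have hv : (v : ℕ) < B.nv := v.2
  rw [Multiset.count_eq_one_of_mem (Multiset.nodup_range _) (Multiset.mem_range.2 hv)]

theorem cutLegs_append {N a b : ℕ} (g : Fin a → ℕ × ℕ) (g' : Fin b → ℕ × ℕ) (col : Fin a → Fin N)
    (col' : Fin b → Fin N) :
    cutLegs (Fin.append g g') (Fin.append col col') = cutLegs g col + cutLegs g' col' := by
  simp [cutLegs, Fin.sum_univ_add]

variable {N : ℕ} [NeZero N] {R : Type*} [CommRing R]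

/-- The colours of the darts, given the colours of the edges. -/
def dartColor {m : ℕ} (col : Fin m → Fin N) (x : ℕ) : Fin N :=
  if hx : x / 2 < m then col ⟨x / 2, hx⟩ else 0

theorem cutLegs_eq_legs (own : ℕ → ℕ) (col : Fin m → Fin N) :
    cutLegs (fun e : Fin m => (own (2 * e), own (2 * e + 1))) col =
      legs (Finset.range (2 * m)) own (dartColor col) := by
  rw [legs, map_range_two_mul, cutLegs]
  refine Finset.sum_congr rfl fun e _ => ?_
  have h1 : dartColor col (2 * e) = col e := by
    have : (2 * (e : ℕ)) / 2 = e := by omega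
    simp [dartColor, this]
  have h2 : dartColor col (2 * e + 1) = col e := by
    have : (2 * (e : ℕ) + 1) / 2 = e := by omega
    simp [dartColor, this]
  rw [h1, h2]

theorem Multigraph.cast_numEulerianTours' {G : Multigraph} (hN : (N : R) = 0)
    (e₀ : Fin G.numEdges) :
    (G.numEulerianTours : R) = ∑ col : Fin G.numEdges → Fin N with col e₀ = 0,
      (matchCount (cutLegs (fun i => (((G.ends i).1 : ℕ), ((G.ends i).2 : ℕ))) col) : R) := by
  rw [cast_numEulerianTours hN e₀]
  refine Finset.sum_congr rfl fun col _ => ?_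
  rw [univ_dart_map]
  simp [src, cutLegs]

/-- The edge with prescribed colour is chosen among the closing edges; the colours inside the
gadgets are then summed freely, as `partFn` requires. -/
theorem Builder.cast_numEulerianTours_close (hN : (N : R) = 0) (e₀ : Fin m) :
    ((B.close m h).numEulerianTours : R) = ∑ col : Fin m → Fin N with col e₀ = 0,
      partFn R B.es (legs (Finset.range (2 * m)) B.own (dartColor col)) := by
  rw [Multigraph.cast_numEulerianTours' hN (Fin.natAdd B.es.length e₀), Builder.ends_close,
    Finset.sum_filter, Finset.sum_filter]
  refine ((Fin.appendEquiv B.es.length m).sum_comp _).symm.trans ?_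
  rw [Fintype.sum_prod_type_right]
  refine Finset.sum_congr rfl fun col' _ => ?_
  conv_rhs => rw [← List.ofFn_get B.es, partFn_ofFn]
  simp only [Fin.appendEquiv, Equiv.coe_fn_mk, Fin.append_right]
  split_ifs
  · refine Finset.sum_congr rfl fun col _ => ?_
    rw [← cutLegs_eq_legs, ← cutLegs_append]
    rfl
  · simp

theorem Multigraph.cast_numEulerianTours_eq_legs {G : Multigraph} (hN : (N : R) = 0)
    (e₀ : Fin G.numEdges) :
    (G.numEulerianTours : R) = ∑ col : Fin G.numEdges → Fin N with col e₀ = 0,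
      (matchCount (legs (Finset.range (2 * G.numEdges)) G.dartVertex (dartColor col)) : R) := by
  rw [cast_numEulerianTours' hN e₀]
  refine Finset.sum_congr rfl fun col _ => ?_
  rw [← cutLegs_eq_legs]
  congr 3
  funext e
  rw [(G.dartVertex_edge e).1, (G.dartVertex_edge e).2]

end Close

/-- Extrapolation of a polynomial to `0`. -/
theorem Polynomial.sum_choose_mul_eval {R : Type*} [CommRing R] (P : Polynomial R) {n : ℕ}
    (hP : P.natDegree ≤ n) :
    ∑ j ∈ Finset.range (n + 1), (-1) ^ j * ((n + 1).choose (j + 1) : R) * P.eval ((j : R) + 1) =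
      P.eval 0 := by
  -- The forward difference of order n + 1 vanishes on degree at most n; the term at 0, split off,
  -- is the value to be extrapolated.
  have h := congrFun (Polynomial.fwdDiff_iter_eq_zero_of_degree_lt (P := P)
    (Nat.lt_succ_of_le hP)) 0
  rw [fwdDiff_iter_eq_sum_shift, Finset.sum_range_succ'] at h
  have hsign : ∀ k ∈ Finset.range (n + 1), ((-1 : ℤ) ^ (n.succ - (k + 1)) *
      (n.succ.choose (k + 1) : ℤ)) • P.eval (0 + (k + 1) • (1 : R)) =
      (-1) ^ n * ((-1) ^ k * ((n + 1).choose (k + 1) : R) * P.eval ((k : R) + 1)) := by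
    intro k hk
    have hk : k ≤ n := Nat.lt_succ_iff.1 (Finset.mem_range.1 hk)
    obtain ⟨d, rfl⟩ := Nat.exists_eq_add_of_le hk
    have hs : ((-1 : R) ^ k) * (-1) ^ k = 1 := by rw [← pow_add, ← two_mul]; simp
    rw [show (k + d).succ - (k + 1) = d by omega, zsmul_eq_mul, pow_add]
    push_cast
    rw [zero_add, nsmul_eq_mul, mul_one]
    push_cast
    linear_combination (-1) * ((-1) ^ d * ((k + d + 1).choose (k + 1) : R) *
      P.eval ((k : R) + 1)) * hs
  rw [Finset.sum_congr rfl hsign, ← Finset.mul_sum] at h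
  simp only [Nat.succ_eq_add_one, Nat.sub_zero, Nat.choose_zero_right, Nat.cast_one, mul_one,
    zero_smul, add_zero, pow_succ, Pi.zero_apply, zsmul_eq_mul] at h
  push_cast at h
  have hs : ((-1 : R) ^ n) * (-1) ^ n = 1 := by rw [← pow_add, ← two_mul]; simp
  linear_combination (-1) ^ n * h - (∑ j ∈ Finset.range (n + 1),
    (-1) ^ j * ((n + 1).choose (j + 1) : R) * P.eval ((j : R) + 1) - P.eval 0) * hs

/-- The modulus |x - y| + 1 exceeds the difference, which it divides. -/
theorem Int.eq_of_forall_zmod {x y : ℤ}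
    (h : ∀ N : ℕ, NeZero N → (x : ZMod N) = (y : ZMod N)) : x = y := by
  have h1 := h ((x - y).natAbs + 1) ⟨by omega⟩
  rw [ZMod.intCast_eq_intCast_iff_dvd_sub] at h1
  have h2 : ((x - y).natAbs + 1) ∣ (x - y).natAbs := by
    rw [← Int.natCast_dvd]
    have h2 := (Int.dvd_neg).2 h1
    rwa [neg_sub] at h2
  have h3 := Nat.eq_zero_of_dvd_of_lt h2 (Nat.lt_succ_self _)
  omega

/-! ### The interpolation identity for tour numbers. -/

namespace Multigraph

variable (G : Multigraph)

/-- The instructions for the graph `G`. -/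
def instrs : List Instr := code G.dartVertex (2 * G.numEdges)

theorem validCode_instrs (hG : ∀ v, Even (G.degree v)) :
    ValidCode G.instrs (Finset.range (2 * G.numEdges)) := by
  rw [← G.attached_eq_range hG]
  exact validCode_code _

/-- The 4-regular graph with `j + 1` vertices in each block. -/
def fourRegular (hG : ∀ v, Even (G.degree v)) (j : ℕ) : Multigraph :=
  (build j G.instrs).close G.numEdges ((G.validCode_instrs hG).saturated j)

/-- The factor 2^((D - j) D) brings the factors 2^(j D) of the gadgets to the common value 2^(D²);
dividing is not possible, since 2 need not be invertible modulo N. -/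
theorem cast_sum_numEulerianTours (hG : ∀ v, Even (G.degree v)) (hE : 0 < G.numEdges) (N : ℕ)
    [NeZero N] :
    ∑ j ∈ Finset.range (numBoxes G.instrs + 1), (-1) ^ j *
        ((numBoxes G.instrs + 1).choose (j + 1) : ZMod N) *
          (2 ^ ((numBoxes G.instrs - j) * numBoxes G.instrs) *
            ((G.fourRegular hG j).numEulerianTours : ZMod N)) =
      2 ^ (numBoxes G.instrs * numBoxes G.instrs) * (normConst G.instrs * G.numEulerianTours) := by
  have hN : (N : ZMod N) = 0 := ZMod.natCast_self N
  have hv := G.validCode_instrs hG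
  choose P hP hP' using fun c : ℕ → Fin N =>
    exists_polynomial_codeTensor (R := ZMod N) G.instrs c
  set D := numBoxes G.instrs with hD
  -- The tour number of the closed graph as a polynomial in κ, up to the power of 2. `Q` depends on
  -- N, but the extrapolation coefficients do not.
  let Q : Polynomial (ZMod N) :=
    ∑ col : Fin G.numEdges → Fin N with col ⟨0, hE⟩ = 0, P (dartColor col)
  have hQ : Q.natDegree ≤ D :=
    Polynomial.natDegree_sum_le_of_forall_le _ _ fun col _ => hP _
  have hQ0 : Q.eval 0 = normConst G.instrs * G.numEulerianTours := by
    rw [Polynomial.eval_finsetSum, cast_numEulerianTours_eq_legs hN ⟨0, hE⟩, Finset.mul_sum]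
    refine Finset.sum_congr rfl fun col _ => ?_
    rw [← hP', instrs, codeTensor_code hN, G.attached_eq_range hG]
  have hQj : ∀ j : ℕ, ((G.fourRegular hG j).numEulerianTours : ZMod N) =
      2 ^ (j * D) * Q.eval ((j : ZMod N) + 1) := by
    intro j
    rw [fourRegular, Builder.cast_numEulerianTours_close _ hN ⟨0, hE⟩, Polynomial.eval_finsetSum,
      Finset.mul_sum]
    refine Finset.sum_congr rfl fun col _ => ?_
    rw [hv.partFn_eq hN, hP']
  rw [← hQ0, ← Polynomial.sum_choose_mul_eval Q hQ, Finset.mul_sum]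
  refine Finset.sum_congr rfl fun j hj => ?_
  have hj : j ≤ D := Nat.lt_succ_iff.1 (Finset.mem_range.1 hj)
  rw [hQj, ← mul_assoc (2 ^ _), ← pow_add, ← add_mul, Nat.sub_add_cancel hj]
  ring

/-- The number of Eulerian tours of `G` in terms of those of the 4-regular graphs. -/
theorem sum_numEulerianTours (hG : G.IsEulerian) :
    ∑ j ∈ Finset.range (numBoxes G.instrs + 1), (-1) ^ j *
        ((numBoxes G.instrs + 1).choose (j + 1) : ℤ) *
          (2 ^ ((numBoxes G.instrs - j) * numBoxes G.instrs) *
            ((G.fourRegular hG.2 j).numEulerianTours : ℤ)) =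
      2 ^ (numBoxes G.instrs * numBoxes G.instrs) * (normConst G.instrs * G.numEulerianTours) := by
  rcases Nat.eq_zero_or_pos G.numEdges with hE | hE
  -- Without edges there is no edge to fix a colour on; both graphs have just the empty tour.
  · have hl : G.instrs = [] := by rw [instrs, hE]; rfl
    have h0 : (G.fourRegular hG.2 0).numEdges = 0 := by
      rw [fourRegular]
      simp only [Builder.close, hl, build_nil, List.length_nil, hE]
    simp [hl, numEulerianTours_of_numEdges_eq_zero hE, numEulerianTours_of_numEdges_eq_zero h0]
  · refine Int.eq_of_forall_zmod fun N _ => ?_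
    have := G.cast_sum_numEulerianTours hG.2 hE N
    push_cast
    exact this

end Multigraph

/-! ## A program logic for oracle random access machines -/

theorem Nat.size_add_le (m n b : ℕ) (hm : Nat.size m ≤ b) (hn : Nat.size n ≤ b) :
    Nat.size (m + n) ≤ b + 1 := by
  rw [Nat.size_le] at *
  rw [pow_succ]
  omega

theorem Nat.size_mul_le (m n : ℕ) : Nat.size (m * n) ≤ Nat.size m + Nat.size n := by
  rw [Nat.size_le, pow_add]
  exact Nat.mul_lt_mul'' (Nat.lt_size_self m) (Nat.lt_size_self n)

theorem Nat.size_le_self (n : ℕ) : Nat.size n ≤ n :=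
  Nat.size_le.2 Nat.lt_two_pow_self

namespace OracleRAM

theorem Store.set_of_ne (s : Store) {A B : ℕ} (h : B ≠ A) (i v : ℕ) : s.set A i v B = s B := by
  simp [Store.set, h]

@[simp] theorem Store.set_same (s : Store) (A i v : ℕ) :
    s.set A i v A = Function.update (s A) i v := by
  simp [Store.set]

/-- All cells have bit length at most `b`. -/
def Store.Bounded (s : Store) (b : ℕ) : Prop := ∀ A i, Nat.size (s A i) ≤ b

theorem Store.Bounded.mono {s : Store} {b b' : ℕ} (h : s.Bounded b) (hb : b ≤ b') :
    s.Bounded b' := fun A i => (h A i).trans hb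

theorem Store.Bounded.set {s : Store} {b : ℕ} (h : s.Bounded b) (A i : ℕ) {v : ℕ}
    (hv : Nat.size v ≤ b) : (s.set A i v).Bounded b := by
  intro B k
  by_cases hB : B = A
  · subst hB
    rw [Store.set_same]
    by_cases hk : k = i
    · subst hk; simpa using hv
    · rw [Function.update_of_ne hk]; exact h _ _
  · rw [Store.set_of_ne s hB]; exact h _ _

/-- A bound for the growth of the bit length, and for the cost, in an evaluation. -/
def Expr.weight (s : Store) : Expr → ℕ
  | .const c => Nat.size c + 1
  | .load _ i => i.weight s + 3
  | .op .mul a b => a.weight s + b.weight s + 4 + Nat.size (b.eval s)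
  | .op _ a b => a.weight s + b.weight s + 4

theorem Op.size_eval_le (o : Op) (x y b : ℕ) (hx : Nat.size x ≤ b) (hy : Nat.size y ≤ b)
    (ho : o ≠ .mul) : Nat.size (o.eval x y) ≤ b + 1 := by
  cases o with
  | add => exact Nat.size_add_le x y b hx hy
  | sub => exact ((Nat.size_le_size (Nat.sub_le x y)).trans hx).trans (Nat.le_succ b)
  | mul => exact absurd rfl ho
  | div => exact ((Nat.size_le_size (Nat.div_le_self x y)).trans hx).trans (Nat.le_succ b)
  | mod => exact ((Nat.size_le_size (Nat.mod_le x y)).trans hx).trans (Nat.le_succ b)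

/-- Apart from products, an operation lengthens values by at most one bit; a product lengthens its
first factor by the bit length of the second, which is therefore part of the weight. -/
theorem Expr.size_eval_le_and_cost_le {s : Store} {b : ℕ} (h : s.Bounded b) (e : Expr) :
    Nat.size (e.eval s) ≤ b + e.weight s ∧ e.cost s ≤ e.weight s * (b + e.weight s) := by
  induction e with
  | const c =>
    simp only [Expr.eval, Expr.weight, Expr.cost]
    constructor
    · omega
    · nlinarith [Nat.zero_le (b * (Nat.size c + 1)), Nat.zero_le (Nat.size c * Nat.size c)]
  | load A i ih =>
    simp only [Expr.eval, Expr.weight, Expr.cost]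
    have := h A (i.eval s)
    refine ⟨by omega, ?_⟩
    nlinarith [ih.1, ih.2]
  | op o a c iha ihc =>
    have key : ∀ g, Nat.size (o.eval (a.eval s) (c.eval s)) ≤
        b + a.weight s + c.weight s + 1 + g → o.eval (a.eval s) (c.eval s) =
          (Expr.op o a c).eval s → (Expr.op o a c).cost s ≤
        (a.weight s + c.weight s + 4 + g) * (b + (a.weight s + c.weight s + 4 + g)) := by
      intro g hg _
      simp only [Expr.cost]
      have h1 := iha.1
      have h2 := ihc.1
      have h3 := iha.2
      have h4 := ihc.2
      have h5 : a.weight s * (b + a.weight s) ≤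
          a.weight s * (b + (a.weight s + c.weight s + 4 + g)) :=
        Nat.mul_le_mul_left _ (by omega)
      have h6 : c.weight s * (b + c.weight s) ≤
          c.weight s * (b + (a.weight s + c.weight s + 4 + g)) :=
        Nat.mul_le_mul_left _ (by omega)
      nlinarith [Nat.zero_le (g * (b + (a.weight s + c.weight s + 4 + g)))]
    by_cases ho : o = .mul
    · subst ho
      have hm := Nat.size_mul_le (a.eval s) (c.eval s)
      have h1 := iha.1
      refine ⟨?_, key (Nat.size (c.eval s)) ?_ rfl⟩
      · simp only [Expr.eval, Op.eval, Expr.weight]; omega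
      · simp only [Op.eval]; omega
    · have hw : (Expr.op o a c).weight s = a.weight s + c.weight s + 4 + 0 := by
        cases o <;> first | rfl | exact absurd rfl ho
      have hsz := Op.size_eval_le o (a.eval s) (c.eval s) (b + a.weight s + c.weight s)
        (by have := iha.1; omega) (by have := ihc.1; omega) ho
      rw [hw]
      exact ⟨by simp only [Expr.eval]; omega, key 0 (by omega) rfl⟩

/-- The arrays to which a program may write. -/
def Prog.writes : Prog → List ℕ
  | .skip => []
  | .assign A _ _ => [A]
  | .seq P Q => P.writes ++ Q.writes
  | .ite _ P Q => P.writes ++ Q.writes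
  | .while _ P => P.writes
  | .query _ _ B => [B]

/-- The condition is syntactic, so for concrete programs it can be settled by `decide`. -/
theorem Exec.frame {O : List ℕ → ℕ} {P : Prog} {s s' : Store} {t : ℕ} (h : Exec O P s s' t)
    {A : ℕ} (hA : A ∉ P.writes) : s' A = s A := by
  induction h with
  | skip => rfl
  | assign s B i e => exact Store.set_of_ne _ (by simpa [Prog.writes] using hA) _ _
  | seq _ _ ih1 ih2 =>
    simp only [Prog.writes, List.mem_append, not_or] at hA
    rw [ih2 hA.2, ih1 hA.1]
  | ite_true _ _ ih =>
    simp only [Prog.writes, List.mem_append, not_or] at hA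
    exact ih hA.1
  | ite_false _ _ ih =>
    simp only [Prog.writes, List.mem_append, not_or] at hA
    exact ih hA.2
  | while_true _ _ _ ih1 ih2 => rw [ih2 hA, ih1 hA]
  | while_false => rfl
  | query s B n C => exact Store.set_of_ne _ (by simpa [Prog.writes] using hA) _ _

/-- The program `P` leads from `s` to `s'` in at most `T` weighted steps; such a run increases the
bit lengths in the store by at most `T` and has cost at most `T * (b + T)`, where `b` bounds
the bit lengths in `s`. -/
def Runs (O : List ℕ → ℕ) (P : Prog) (s s' : Store) (T : ℕ) : Prop :=
  ∃ t, Exec O P s s' t ∧ ∀ b, s.Bounded b → s'.Bounded (b + T) ∧ t ≤ T * (b + T)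

/-! ### Composition rules for `Runs`. -/

section Rules

variable {O : List ℕ → ℕ}

theorem Runs.frame {P : Prog} {s s' : Store} {T A : ℕ} (h : Runs O P s s' T)
    (hA : A ∉ P.writes) : s' A = s A := by
  obtain ⟨t, h, -⟩ := h
  exact h.frame hA

theorem Runs.mono {P : Prog} {s s' : Store} {T T' : ℕ} (h : Runs O P s s' T) (hT : T ≤ T') :
    Runs O P s s' T' := by
  obtain ⟨t, h, hb⟩ := h
  refine ⟨t, h, fun b hs => ⟨(hb b hs).1.mono (by omega), (hb b hs).2.trans ?_⟩⟩
  gcongr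

theorem runs_skip (s : Store) : Runs O .skip s s 1 :=
  ⟨1, Exec.skip s, fun b hs => ⟨hs.mono (by omega), by omega⟩⟩

theorem runs_assign (s : Store) (A : ℕ) (i e : Expr) :
    Runs O (.assign A i e) s (s.set A (i.eval s) (e.eval s)) (i.weight s + e.weight s + 3) := by
  refine ⟨_, Exec.assign s A i e, fun b hs => ?_⟩
  obtain ⟨h1, h2⟩ := Expr.size_eval_le_and_cost_le hs i
  obtain ⟨h3, h4⟩ := Expr.size_eval_le_and_cost_le hs e
  refine ⟨(hs.mono (by omega)).set _ _ (by omega), ?_⟩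
  generalize i.weight s = x at *
  generalize e.weight s = y at *
  have h5 : x * (b + x) ≤ x * (b + (x + y + 3)) := Nat.mul_le_mul_left _ (by omega)
  have h6 : y * (b + y) ≤ y * (b + (x + y + 3)) := Nat.mul_le_mul_left _ (by omega)
  nlinarith

/-- The second part starts with bit lengths up to b + T, and T (b + T) + T' (b + T + T') stays below
the bound for T + T' + 1. The form of the bound is chosen for this additivity. -/
theorem Runs.seq {P Q : Prog} {s s' s'' : Store} {T T' : ℕ} (h : Runs O P s s' T)
    (h' : Runs O Q s' s'' T') : Runs O (.seq P Q) s s'' (T + T' + 1) := by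
  obtain ⟨t, h, hb⟩ := h
  obtain ⟨t', h', hb'⟩ := h'
  refine ⟨_, h.seq h', fun b hs => ?_⟩
  obtain ⟨h1, h2⟩ := hb b hs
  obtain ⟨h3, h4⟩ := hb' _ h1
  refine ⟨h3.mono (by omega), ?_⟩
  have h5 : T * (b + T) ≤ T * (b + (T + T' + 1)) := Nat.mul_le_mul_left _ (by omega)
  have h6 : T' * (b + T + T') ≤ T' * (b + (T + T' + 1)) := Nat.mul_le_mul_left _ (by omega)
  nlinarith

theorem Runs.ite_true {e : Expr} {P Q : Prog} {s s' : Store} {T : ℕ} (he : e.eval s ≠ 0)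
    (h : Runs O P s s' T) : Runs O (.ite e P Q) s s' (e.weight s + T + 1) := by
  obtain ⟨t, h, hb⟩ := h
  refine ⟨_, Exec.ite_true he h, fun b hs => ?_⟩
  obtain ⟨h1, h2⟩ := hb b hs
  obtain ⟨h3, h4⟩ := Expr.size_eval_le_and_cost_le hs e
  refine ⟨h1.mono (by omega), ?_⟩
  generalize e.weight s = x at *
  have h5 : x * (b + x) ≤ x * (b + (x + T + 1)) := Nat.mul_le_mul_left _ (by omega)
  have h6 : T * (b + T) ≤ T * (b + (x + T + 1)) := Nat.mul_le_mul_left _ (by omega)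
  nlinarith

theorem Runs.ite_false {e : Expr} {P Q : Prog} {s s' : Store} {T : ℕ} (he : e.eval s = 0)
    (h : Runs O Q s s' T) : Runs O (.ite e P Q) s s' (e.weight s + T + 1) := by
  obtain ⟨t, h, hb⟩ := h
  refine ⟨_, Exec.ite_false he h, fun b hs => ?_⟩
  obtain ⟨h1, h2⟩ := hb b hs
  obtain ⟨h3, h4⟩ := Expr.size_eval_le_and_cost_le hs e
  refine ⟨h1.mono (by omega), ?_⟩
  generalize e.weight s = x at *
  have h5 : x * (b + x) ≤ x * (b + (x + T + 1)) := Nat.mul_le_mul_left _ (by omega)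
  have h6 : T * (b + T) ≤ T * (b + (x + T + 1)) := Nat.mul_le_mul_left _ (by omega)
  nlinarith

theorem Runs.while_true {e : Expr} {P : Prog} {s s' s'' : Store} {T T' : ℕ} (he : e.eval s ≠ 0)
    (h : Runs O P s s' T) (h' : Runs O (.while e P) s' s'' T') :
    Runs O (.while e P) s s'' (e.weight s + T + T' + 1) := by
  obtain ⟨t, h, hb⟩ := h
  obtain ⟨t', h', hb'⟩ := h'
  refine ⟨_, Exec.while_true he h h', fun b hs => ?_⟩
  obtain ⟨h1, h2⟩ := hb b hs
  obtain ⟨h3, h4⟩ := hb' _ h1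
  obtain ⟨h5, h6⟩ := Expr.size_eval_le_and_cost_le hs e
  refine ⟨h3.mono (by omega), ?_⟩
  generalize e.weight s = x at *
  have h7 : x * (b + x) ≤ x * (b + (x + T + T' + 1)) := Nat.mul_le_mul_left _ (by omega)
  have h8 : T * (b + T) ≤ T * (b + (x + T + T' + 1)) := Nat.mul_le_mul_left _ (by omega)
  have h9 : T' * (b + T + T') ≤ T' * (b + (x + T + T' + 1)) := Nat.mul_le_mul_left _ (by omega)
  nlinarith

theorem Runs.while_false {e : Expr} {P : Prog} {s : Store} (he : e.eval s = 0) :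
    Runs O (.while e P) s s (e.weight s + 1) := by
  refine ⟨_, Exec.while_false he, fun b hs => ?_⟩
  obtain ⟨h3, h4⟩ := Expr.size_eval_le_and_cost_le hs e
  refine ⟨hs.mono (by omega), ?_⟩
  nlinarith

theorem wordSize_word_le {s : Store} {b : ℕ} (hs : s.Bounded b) (A n : ℕ) :
    wordSize (s.word A n) ≤ n * (b + 1) := by
  rw [wordSize, Store.word, List.map_map]
  refine (List.sum_le_card_nsmul _ (b + 1) ?_).trans ?_
  · intro x hx
    obtain ⟨i, -, rfl⟩ := List.mem_map.1 hx
    exact Nat.succ_le_succ (hs A i)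
  · simp

/-- The answer is the one value in the store that the program does not compute, so its bit length
has to enter the weight, like the length of the query. -/
theorem runs_query (s : Store) (A : ℕ) (n : Expr) (B : ℕ) :
    Runs O (.query A n B) s (s.set B 0 (O (s.word A (n.eval s))))
      (n.weight s + n.eval s + Nat.size (O (s.word A (n.eval s))) + 2) := by
  refine ⟨_, Exec.query s A n B, fun b hs => ?_⟩
  obtain ⟨h1, h2⟩ := Expr.size_eval_le_and_cost_le hs n
  have h3 := wordSize_word_le hs A (n.eval s)
  refine ⟨(hs.mono (by omega)).set _ _ (by omega), ?_⟩
  generalize n.weight s = x at *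
  generalize n.eval s = y at *
  generalize Nat.size (O (s.word A y)) = z at *
  have h5 : x * (b + x) ≤ x * (b + (x + y + z + 2)) := Nat.mul_le_mul_left _ (by omega)
  have h6 : y * (b + 1) ≤ y * (b + (x + y + z + 2)) := Nat.mul_le_mul_left _ (by omega)
  have h7 : z * 1 ≤ z * (b + (x + y + z + 2)) := Nat.mul_le_mul_left _ (by omega)
  nlinarith

end Rules

/-- The cell `A[0]`, used as a variable. -/
abbrev var (A : ℕ) : Expr := .load A (.const 0)

/-- `A[0] := e`. -/
abbrev setVar (A : ℕ) (e : Expr) : Prog := .assign A (.const 0) e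

/-- Repeat `P` for `r = 0, …, e - 1`; the variable `n` holds the bound. -/
def Prog.rep (r n : ℕ) (e : Expr) (P : Prog) : Prog :=
  .seq (setVar n e) (.seq (setVar r (.const 0))
    (.while (.op .sub (var n) (var r)) (.seq P (setVar r (.op .add (var r) (.const 1))))))

/-- The body must spare the counter and the bound, and has one weight `T` for all rounds; 28 is the
weight of testing and incrementing in each round. The invariant is stated after the increment. -/
theorem runs_rep {O : List ℕ → ℕ} {r n : ℕ} {e : Expr} {P : Prog} (hrn : r ≠ n)
    (hr : r ∉ P.writes) (hn : n ∉ P.writes) {s : Store} {m T : ℕ} (hm : e.eval s = m)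
    (Inv : ℕ → Store → Prop) (h0 : Inv 0 ((s.set n 0 m).set r 0 0))
    (hstep : ∀ i < m, ∀ s₁, Inv i s₁ → s₁ r 0 = i →
      (∀ A, A ≠ r → A ≠ n → A ∉ P.writes → s₁ A = s A) →
      ∃ s', Runs O P s₁ s' T ∧ Inv (i + 1) (s'.set r 0 (i + 1))) :
    ∃ s', Runs O (.rep r n e P) s s' (e.weight s + m * (T + 28) + 24) ∧ Inv m s' := by
  -- Induction on the number `k` of rounds still to come.
  have key : ∀ k i, i + k = m → ∀ s₁, Inv i s₁ → s₁ r 0 = i → s₁ n 0 = m →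
      (∀ A, A ≠ r → A ≠ n → A ∉ P.writes → s₁ A = s A) →
      ∃ s', Runs O (.while (.op .sub (var n) (var r))
        (.seq P (setVar r (.op .add (var r) (.const 1))))) s₁ s' (k * (T + 28) + 13) ∧ Inv m s' := by
    intro k
    induction k with
    | zero =>
      intro i hi s₁ hs h1 h2 _
      obtain rfl : i = m := by omega
      refine ⟨s₁, (Runs.while_false ?_).mono ?_, hs⟩
      · simp [Expr.eval, Op.eval, h1, h2]
      · simp [Expr.weight]
    | succ k ih =>
      intro i hi s₁ hs h1 h2 hf
      obtain ⟨s', hrun, hinv⟩ := hstep i (by omega) s₁ hs h1 hf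
      have h1' : s' r 0 = i := by rw [hrun.frame hr, h1]
      have h2' : s' n 0 = m := by rw [hrun.frame hn, h2]
      have hinc := runs_assign (O := O) s' r (.const 0) (.op .add (var r) (.const 1))
      simp only [Expr.eval, Op.eval, h1'] at hinc
      obtain ⟨s'', hrun', hinv'⟩ := ih (i + 1) (by omega) _ hinv (by simp)
        (by rw [Store.set_of_ne _ hrn.symm, h2'])
        (fun A ha hb hc => by rw [Store.set_of_ne _ ha, hrun.frame hc, hf A ha hb hc])
      refine ⟨s'', (Runs.while_true ?_ (hrun.seq hinc) hrun').mono ?_, hinv'⟩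
      · simp [Expr.eval, Op.eval, h1, h2]; omega
      · simp [Expr.weight, add_mul]; omega
  obtain ⟨s', hrun, hinv⟩ := key m 0 (by omega) _ h0 (by simp)
    (by rw [Store.set_of_ne _ hrn.symm]; simp)
    (fun A ha hb _ => by rw [Store.set_of_ne _ ha, Store.set_of_ne _ hb])
  have ha := runs_assign (O := O) s n (.const 0) e
  simp only [hm, Expr.eval] at ha
  have hb := runs_assign (O := O) (s.set n 0 m) r (.const 0) (.const 0)
  simp only [Expr.eval] at hb
  refine ⟨s', (ha.seq (hb.seq hrun)).mono ?_, hinv⟩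
  simp [Expr.weight]; omega

end OracleRAM

/-! ## The program -/

namespace OracleRAM

/-- Append the edge `{x, y}` to the word in the array `2`, whose length is kept in the
variable `4`. -/
def edgeProg (x y : Expr) : Prog :=
  .seq (.assign 2 (var 4) x) (.seq (.assign 2 (.op .add (var 4) (.const 1)) y)
    (setVar 4 (.op .add (var 4) (.const 2))))

/-- Append a chain of double edges; `5` is the number of vertices, `8` the length of the chain. -/
def chainProg : Prog :=
  .rep 22 23 (var 8) (.seq (edgeProg (var 5) (.op .add (var 5) (.const 1)))
    (.seq (edgeProg (var 5) (.op .add (var 5) (.const 1)))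
      (setVar 5 (.op .add (var 5) (.const 1)))))

/-- Append a block of a ladder on the leg in the variable `15`. -/
def blockProg : Prog :=
  .seq (edgeProg (var 25) (var 5))
    (.seq (.ite (var 20) (edgeProg (var 24) (.op .add (var 5) (var 8)))
        (.assign 3 (var 15) (.op .add (var 5) (var 8))))
      (.seq (setVar 24 (var 5)) (.seq chainProg
        (.seq (setVar 25 (var 5)) (setVar 5 (.op .add (var 5) (.const 1)))))))

/-- Append a ladder; the variables `19`, `15`, `13` hold its length and its legs. -/
def ladderProg : Prog :=
  .seq (setVar 24 (.const 0)) (.seq (setVar 25 (.load 3 (var 15)))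
    (.seq (.rep 20 21 (var 19) blockProg)
      (.seq (edgeProg (var 24) (.load 3 (var 13)))
        (.seq (.assign 3 (var 13) (var 25))
          (.seq (setVar 7 (.op .add (var 7) (var 19)))
            (setVar 6 (.op .mul (var 6) (var 19))))))))

/-- Nonzero if the darts in the variables `15` and `13` have the same vertex. -/
def sameExpr : Expr :=
  .op .sub (.const 1) (.op .add
    (.op .sub (.load 0 (.op .add (var 15) (.const 1))) (.load 0 (.op .add (var 13) (.const 1))))
    (.op .sub (.load 0 (.op .add (var 13) (.const 1))) (.load 0 (.op .add (var 15) (.const 1)))))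

/-- Count the earlier darts at the vertex of the dart in the variable `13`. -/
def scanProg : Prog :=
  .seq (setVar 17 (.const 0)) (.seq (setVar 18 (.const 0))
    (.rep 15 16 (var 13) (.ite sameExpr
      (.seq (setVar 17 (.op .add (var 17) (.const 1))) (setVar 18 (var 15))) .skip)))

/-- Start a new strand with the legs in the variables `18` and `13`. -/
def freshProg : Prog :=
  .seq (edgeProg (var 5) (var 5)) (.seq (.assign 3 (var 18) (var 5))
    (.seq (.assign 3 (var 13) (var 5)) (.seq (setVar 5 (.op .add (var 5) (.const 1)))
      (setVar 6 (.op .mul (var 6) (.const 2))))))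

/-- Process the dart in the variable `13`. -/
def dartProg : Prog :=
  .seq scanProg (.ite (.op .mod (var 17) (.const 2))
    (.seq freshProg (.seq (setVar 19 (.op .sub (var 17) (.const 1)))
      (.rep 15 16 (var 18) (.ite sameExpr
        (.seq ladderProg (setVar 19 (.op .sub (var 19) (.const 1)))) .skip)))) .skip)

/-- Build the 4-regular graph with chains of length given by the variable `8`. -/
def buildProg : Prog :=
  .seq (setVar 4 (.const 1)) (.seq (setVar 5 (.const 0)) (.seq (setVar 6 (.const 1))
    (.seq (setVar 7 (.const 0))
      (.seq (.rep 13 14 (.op .sub (var 1) (.const 1)) dartProg)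
        (.seq (.rep 29 30 (.op .div (.op .sub (var 1) (.const 1)) (.const 2))
          (edgeProg (.load 3 (.op .add (var 29) (var 29)))
            (.load 3 (.op .add (.op .add (var 29) (var 29)) (.const 1)))))
          (.assign 2 (.const 0) (var 5)))))))

/-! ### Correctness of the gadget programs. -/

section Correctness

variable {O : List ℕ → ℕ}

theorem size_two : Nat.size 2 = 2 := by decide

theorem runs_setVar {s : Store} (A : ℕ) {e : Expr} {v : ℕ} (he : e.eval s = v) :
    Runs O (setVar A e) s (s.set A 0 v) (e.weight s + 4) := by
  have := runs_assign (O := O) s A (.const 0) e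
  rw [he] at this
  refine this.mono ?_
  simp [Expr.weight]; omega

theorem runs_setArr {s : Store} (A : ℕ) {i e : Expr} {k v : ℕ} (hi : i.eval s = k)
    (he : e.eval s = v) :
    Runs O (.assign A i e) s (s.set A k v) (i.weight s + e.weight s + 3) := by
  have := runs_assign (O := O) s A i e
  rwa [hi, he] at this

/-- The array `2` holds the edges `es`. -/
def Out (es : List (ℕ × ℕ)) (s : Store) : Prop :=
  s 4 0 = 2 * es.length + 1 ∧
    (List.range (2 * es.length)).map (fun i => s 2 (i + 1)) = flatEdges es

theorem Out.congr {es : List (ℕ × ℕ)} {s s' : Store} (h : Out es s) (h2 : s' 2 = s 2)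
    (h4 : s' 4 = s 4) : Out es s' := by
  rw [Out, h2, h4]; exact h

/-- Cell 0 of the array `2` is reserved for the number of vertices, so edges start at position 1.
The expressions must not depend on the arrays `2` and `4`, since `y` is evaluated after the first
write. -/
theorem runs_edgeProg {es : List (ℕ × ℕ)} {s : Store} {x y : Expr} {u v : ℕ} (h : Out es s)
    (hxy : ∀ s' : Store, (∀ A, A ≠ 2 → A ≠ 4 → s' A = s A) →
      x.eval s' = u ∧ y.eval s' = v ∧ x.weight s' ≤ 30 ∧ y.weight s' ≤ 30) :
    ∃ s', Runs O (edgeProg x y) s s' 100 ∧ Out (es ++ [(u, v)]) s' := by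
  obtain ⟨h4, h2⟩ := h
  obtain ⟨hx, -, hwx, -⟩ := hxy s fun _ _ _ => rfl
  set s₁ := s.set 2 (2 * es.length + 1) u with hs₁
  have hf₁ : ∀ A, A ≠ 2 → s₁ A = s A := fun A hA => Store.set_of_ne _ hA _ _
  obtain ⟨-, hy, -, hwy⟩ := hxy s₁ fun A hA _ => hf₁ A hA
  have r1 : Runs O (.assign 2 (var 4) x) s s₁ 37 := by
    refine (runs_setArr 2 (by simpa [Expr.eval] using h4) hx).mono ?_
    simp [Expr.weight]; omega
  have r2 : Runs O (.assign 2 (.op .add (var 4) (.const 1)) y) s₁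
      (s₁.set 2 (2 * es.length + 2) v) 43 := by
    refine (runs_setArr 2 (by simp [Expr.eval, Op.eval, hf₁ 4, h4]) hy).mono ?_
    simp [Expr.weight]; omega
  have r3 : Runs O (setVar 4 (.op .add (var 4) (.const 2))) (s₁.set 2 (2 * es.length + 2) v)
      ((s₁.set 2 (2 * es.length + 2) v).set 4 0 (2 * es.length + 3)) 15 := by
    refine (runs_setVar 4 ?_).mono ?_
    · simp [Expr.eval, Op.eval, Store.set_of_ne _ (show 4 ≠ 2 by decide), hf₁ 4, h4]
    · simp [Expr.weight, size_two]
  refine ⟨_, (r1.seq (r2.seq r3)).mono (by omega), ?_, ?_⟩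
  · simp; ring
  · rw [List.length_append, List.length_singleton, flatEdges_append, mul_add, mul_one,
      List.range_succ, List.range_succ, List.append_assoc, List.map_append, ← h2]
    congr 1
    · refine List.map_congr_left fun i hi => ?_
      have := List.mem_range.1 hi
      rw [Store.set_of_ne _ (by decide), Store.set_same, Function.update_of_ne (by omega), hs₁,
        Store.set_same, Function.update_of_ne (by omega)]
    · simp [Store.set_of_ne _ (show 2 ≠ 4 by decide), hs₁]

theorem runs_chainProg {es : List (ℕ × ℕ)} {s : Store} {nv j : ℕ} (h : Out es s)
    (h5 : s 5 0 = nv) (h8 : s 8 0 = j) :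
    ∃ s', Runs O chainProg s s' (244 * j + 28) ∧ Out (es ++ chainEdges nv j) s' ∧
      s' 5 0 = nv + j := by
  obtain ⟨s', hr, h1, h2⟩ := runs_rep (O := O) (r := 22) (n := 23) (e := var 8)
    (P := .seq (edgeProg (var 5) (.op .add (var 5) (.const 1)))
      (.seq (edgeProg (var 5) (.op .add (var 5) (.const 1)))
        (setVar 5 (.op .add (var 5) (.const 1))))) (by decide) (by decide) (by decide)
    (s := s) (m := j) (T := 216) (by simpa [Expr.eval] using h8)
    (fun i s => Out (es ++ chainEdges nv i) s ∧ s 5 0 = nv + i)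
    ⟨by rw [chainEdges, List.append_nil]; exact h.congr rfl rfl, h5⟩ (by
      rintro i - s₁ ⟨ho, h5⟩ - -
      obtain ⟨s₂, r1, ho2⟩ := runs_edgeProg (O := O) (x := var 5)
        (y := .op .add (var 5) (.const 1)) (u := nv + i) (v := nv + i + 1) ho
        (fun s' hs' => by simp [Expr.eval, Op.eval, Expr.weight, hs' 5, h5])
      have h5' : s₂ 5 0 = nv + i := by rw [r1.frame (by decide), h5]
      obtain ⟨s₃, r2, ho3⟩ := runs_edgeProg (O := O) (x := var 5)
        (y := .op .add (var 5) (.const 1)) (u := nv + i) (v := nv + i + 1) ho2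
        (fun s' hs' => by simp [Expr.eval, Op.eval, Expr.weight, hs' 5, h5'])
      have h5'' : s₃ 5 0 = nv + i := by rw [r2.frame (by decide), h5']
      have r3 := runs_setVar (O := O) (s := s₃) 5 (e := .op .add (var 5) (.const 1))
        (v := nv + i + 1) (by simp [Expr.eval, Op.eval, h5''])
      refine ⟨_, (r1.seq (r2.seq r3)).mono (by simp [Expr.weight]), ?_, rfl⟩
      rw [chainEdges]
      refine Out.congr ?_ rfl rfl (s := s₃)
      simpa using ho3)
  refine ⟨s', hr.mono ?_, h1, h2⟩
  simp [Expr.weight]; omega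

/-- The store represents a ladder under construction. -/
def LadderRel (A : Finset ℕ) (L : LadderState) (s : Store) : Prop :=
  Out L.es s ∧ s 5 0 = L.nv ∧ (∀ x ∈ A, s 3 x = L.own x) ∧ s 24 0 = L.y₁ ∧ s 25 0 = L.y₂

theorem runs_blockProg {A : Finset ℕ} {L : LadderState} {s : Store} {i p j : ℕ}
    (h : LadderRel A L s) (h8 : s 8 0 = j) (h15 : s 15 0 = p) (h20 : s 20 0 = i) :
    ∃ s', Runs O blockProg s s' (244 * j + 268) ∧ LadderRel A (L.addBlock j p i) s' := by
  obtain ⟨ho, h5, hown, h24, h25⟩ := h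
  obtain ⟨s₁, r1, ho1⟩ := runs_edgeProg (O := O) (x := var 25) (y := var 5) (u := L.y₂)
    (v := L.nv) ho (fun s' hs' => by simp [Expr.eval, Expr.weight, hs' 5, hs' 25, h5, h25])
  have f1 : ∀ A, A ∉ (edgeProg (var 25) (var 5)).writes → s₁ A = s A := fun A hA => r1.frame hA
  have h2 : ∃ s₂, Runs O (.ite (var 20) (edgeProg (var 24) (.op .add (var 5) (var 8)))
        (.assign 3 (var 15) (.op .add (var 5) (var 8)))) s₁ s₂ 105 ∧
      Out (L.es ++ [(L.y₂, L.nv)] ++ (if i = 0 then [] else [(L.y₁, L.nv + j)])) s₂ ∧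
      ∀ x ∈ A, s₂ 3 x = (L.addBlock j p i).own x := by
    have h20' : s₁ 20 0 = i := by rw [f1 20 (by decide), h20]
    by_cases hi : i = 0
    · have r2 := runs_setArr (O := O) (s := s₁) 3 (i := var 15) (e := .op .add (var 5) (var 8))
        (k := p) (v := L.nv + j) (by simp [Expr.eval, f1 15 (by decide), h15])
        (by simp [Expr.eval, Op.eval, f1 5 (by decide), f1 8 (by decide), h5, h8])
      refine ⟨_, (Runs.ite_false (by simp [Expr.eval, h20', hi]) r2).mono ?_, ?_, ?_⟩
      · simp [Expr.weight]
      · rw [if_pos hi, List.append_nil]; exact ho1.congr rfl rfl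
      · intro x hx
        rw [Store.set_same, f1 3 (by decide)]
        simp only [LadderState.addBlock, if_pos hi, Function.update_apply, hown x hx]
    · obtain ⟨s₂, r2, ho2⟩ := runs_edgeProg (O := O) (x := var 24) (y := .op .add (var 5) (var 8))
        (u := L.y₁) (v := L.nv + j) ho1 (fun s' hs' => by
          simp [Expr.eval, Op.eval, Expr.weight, hs' 5, hs' 8, hs' 24, f1 5 (by decide),
            f1 8 (by decide), f1 24 (by decide), h5, h8, h24])
      refine ⟨s₂, (Runs.ite_true (by simp [Expr.eval, h20', hi]) r2).mono ?_, ?_, ?_⟩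
      · simp [Expr.weight]
      · simpa [hi] using ho2
      · intro x hx
        rw [r2.frame (by decide), f1 3 (by decide), hown x hx]
        simp [LadderState.addBlock, hi]
  obtain ⟨s₂, r2, ho2, hown2⟩ := h2
  have f2 : ∀ A, A ≠ 2 → A ≠ 3 → A ≠ 4 → s₂ A = s A := by
    intro A h2 h3 h4
    rw [r2.frame, r1.frame] <;> simp [Prog.writes, edgeProg, h2, h3, h4]
  have r3 := runs_setVar (O := O) (s := s₂) 24 (e := var 5) (v := L.nv)
    (by simp [Expr.eval, f2 5, h5])
  obtain ⟨s₄, r4, ho4, h5'⟩ := runs_chainProg (O := O) (s := s₂.set 24 0 L.nv) (nv := L.nv) (j := j)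
    (ho2.congr rfl rfl) (by simp [Store.set, f2 5, h5]) (by simp [Store.set, f2 8, h8])
  have r5 := runs_setVar (O := O) (s := s₄) 25 (e := var 5) (v := L.nv + j)
    (by simp [Expr.eval, h5'])
  have r6 := runs_setVar (O := O) (s := s₄.set 25 0 (L.nv + j)) 5
    (e := .op .add (var 5) (.const 1)) (v := L.nv + j + 1)
    (by simp [Expr.eval, Op.eval, Store.set, h5'])
  refine ⟨_, (r1.seq (r2.seq (r3.seq (r4.seq (r5.seq r6))))).mono ?_, ?_, ?_, ?_, ?_, ?_⟩
  · simp [Expr.weight]; omega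
  · refine Out.congr (s := s₄) ?_ rfl rfl
    simpa [LadderState.addBlock] using ho4
  · simp [LadderState.addBlock]
  · intro x hx
    rw [Store.set_of_ne _ (by decide), Store.set_of_ne _ (by decide), r4.frame (by decide),
      Store.set_of_ne _ (by decide), hown2 x hx]
  · rw [Store.set_of_ne _ (by decide), Store.set_of_ne _ (by decide), r4.frame (by decide)]
    simp [LadderState.addBlock]
  · rw [Store.set_of_ne _ (by decide)]
    simp [LadderState.addBlock]

/-- The store represents the graph built by the instructions `l`. -/
def CodeRel (j : ℕ) (A : Finset ℕ) (l : List Instr) (s : Store) : Prop :=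
  Out (build j l).es s ∧ s 5 0 = (build j l).nv ∧ (∀ x ∈ A, s 3 x = (build j l).own x) ∧
    s 6 0 = normConst l ∧ s 7 0 = numBoxes l

theorem CodeRel.congr {j : ℕ} {A : Finset ℕ} {l : List Instr} {s s' : Store} (h : CodeRel j A l s)
    (hs : ∀ B, 2 ≤ B → B ≤ 7 → s' B = s B) : CodeRel j A l s' := by
  obtain ⟨h1, h2, h3, h4, h5⟩ := h
  refine ⟨h1.congr (hs 2 (by decide) (by decide)) (hs 4 (by decide) (by decide)), ?_, ?_, ?_, ?_⟩
  · rw [hs 5 (by decide) (by decide), h2]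
  · rw [hs 3 (by decide) (by decide)]; exact h3
  · rw [hs 6 (by decide) (by decide), h4]
  · rw [hs 7 (by decide) (by decide), h5]

theorem runs_ladderProg {j : ℕ} {A : Finset ℕ} {l : List Instr} {s : Store} {w p q : ℕ}
    (h : CodeRel j A l s) (hp : p ∈ A) (hq : q ∈ A) (h8 : s 8 0 = j)
    (h15 : s 15 0 = p) (h13 : s 13 0 = q) (h19 : s 19 0 = w) :
    ∃ s', Runs O ladderProg s s' (w * (244 * j + 297) + 200) ∧
      CodeRel j A (l ++ [.ladder w p q]) s' := by
  obtain ⟨ho, h5, hown, h6, h7⟩ := h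
  have r1 := runs_setVar (O := O) (s := s) 24 (e := .const 0) (v := 0) rfl
  have r2 := runs_setVar (O := O) (s := s.set 24 0 0) 25 (e := .load 3 (var 15))
    (v := (build j l).own p) (by simp [Expr.eval, Store.set, h15, hown p hp])
  set s₂ := (s.set 24 0 0).set 25 0 ((build j l).own p) with hs₂
  have f2 : ∀ A, A ≠ 24 → A ≠ 25 → s₂ A = s A := by
    intro A h24 h25
    rw [hs₂, Store.set_of_ne _ h25, Store.set_of_ne _ h24]
  obtain ⟨s₃, r3, ho3, h53, hown3, h243, h253⟩ := runs_rep (O := O) (r := 20) (n := 21)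
    (e := var 19) (P := blockProg) (by decide) (by decide) (by decide) (s := s₂) (m := w)
    (T := 244 * j + 268) (by simp [Expr.eval, f2 19, h19])
    (fun i s => LadderRel A ((build j l).blocks j p i) s)
    (by
      refine ⟨ho.congr rfl rfl, ?_, ?_, ?_, ?_⟩
      · simp [Store.set, f2 5, h5, Builder.blocks]
      · intro x hx
        simp [Store.set, f2 3, hown x hx, Builder.blocks]
      · rfl
      · rfl)
    (by
      intro i _ s₃ hrel h20 hf
      obtain ⟨s₄, r4, h4⟩ := runs_blockProg (O := O) hrel (p := p) (j := j) (i := i)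
        (by rw [hf 8 (by decide) (by decide) (by decide), f2 8 (by decide) (by decide), h8])
        (by rw [hf 15 (by decide) (by decide) (by decide), f2 15 (by decide) (by decide), h15]) h20
      refine ⟨s₄, r4, ?_⟩
      obtain ⟨a, b, c, d, e⟩ := h4
      exact ⟨a.congr rfl rfl, b, c, d, e⟩)
  have f3 : ∀ A, A ∉ (Prog.rep 20 21 (var 19) blockProg).writes → s₃ A = s₂ A :=
    fun A hA => r3.frame hA
  have h13' : s₃ 13 0 = q := by rw [f3 13 (by decide), f2 13 (by decide) (by decide), h13]
  have h19' : s₃ 19 0 = w := by rw [f3 19 (by decide), f2 19 (by decide) (by decide), h19]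
  have h6' : s₃ 6 0 = normConst l := by rw [f3 6 (by decide), f2 6 (by decide) (by decide), h6]
  have h7' : s₃ 7 0 = numBoxes l := by rw [f3 7 (by decide), f2 7 (by decide) (by decide), h7]
  generalize hL : (build j l).blocks j p w = L at *
  obtain ⟨s₄, r4, ho4⟩ := runs_edgeProg (O := O) (x := var 24) (y := .load 3 (var 13))
    (u := L.y₁) (v := L.own q) ho3 (fun s' hs' => by
      simp [Expr.eval, Expr.weight, hs' 24, hs' 3, hs' 13, h243, h13', hown3 q hq])
  have f4 : ∀ A, A ∉ (edgeProg (var 24) (.load 3 (var 13))).writes → s₄ A = s₃ A :=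
    fun A hA => r4.frame hA
  have r5 := runs_setArr (O := O) (s := s₄) 3 (i := var 13) (e := var 25) (k := q) (v := L.y₂)
    (by simp [Expr.eval, f4 13 (by decide), h13']) (by simp [Expr.eval, f4 25 (by decide), h253])
  have r6 := runs_setVar (O := O) (s := s₄.set 3 q L.y₂) 7 (e := .op .add (var 7) (var 19))
    (v := numBoxes l + w)
    (by simp [Expr.eval, Op.eval, Store.set, f4 7 (by decide), f4 19 (by decide), h7', h19'])
  have r7 := runs_setVar (O := O) (s := (s₄.set 3 q L.y₂).set 7 0 (numBoxes l + w)) 6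
    (e := .op .mul (var 6) (var 19)) (v := normConst l * w)
    (by simp [Expr.eval, Op.eval, Store.set, f4 6 (by decide), f4 19 (by decide), h6', h19'])
  refine ⟨_, (r1.seq (r2.seq (r3.seq (r4.seq (r5.seq (r6.seq r7)))))).mono ?_, ?_, ?_, ?_, ?_, ?_⟩
  -- Multiplying the normalizing constant by `w` is charged the bit length of `w`, the second
  -- factor, however long the constant has become.
  · have hw : Nat.size (((s₄.set 3 q L.y₂).set 7 0 (numBoxes l + w)) 19 0) ≤ w := by
      rw [Store.set_of_ne _ (by decide), Store.set_of_ne _ (by decide), f4 19 (by decide), h19']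
      exact Nat.size_le_self w
    simp only [Expr.weight, Expr.eval, Nat.size_zero]
    nlinarith
  · rw [build_concat]
    refine Out.congr (s := s₄) ?_ rfl rfl
    simpa [Builder.step, hL] using ho4
  · rw [build_concat, Store.set_of_ne _ (by decide), Store.set_of_ne _ (by decide),
      Store.set_of_ne _ (by decide), f4 5 (by decide), h53]
    simp [Builder.step, hL]
  · intro x hx
    rw [build_concat, Store.set_of_ne _ (by decide), Store.set_of_ne _ (by decide), Store.set_same,
      f4 3 (by decide)]
    simp only [Builder.step, hL, Function.update_apply, hown3 x hx]
  · simp [normConst, Instr.norm]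
  · simp [Store.set, numBoxes, Instr.boxes]

end Correctness

end OracleRAM

/-! ### Correctness of the program that builds the whole graph. -/

namespace OracleRAM

section Correctness

variable {O : List ℕ → ℕ} {inp : ℕ → ℕ}

theorem sameExpr_weight (s : Store) : sameExpr.weight s = 70 := by
  simp [sameExpr, Expr.weight]

/-- With truncated subtraction the sum of the two differences is the distance of the two vertices,
and 1 minus it is nonzero only if they agree. -/
theorem sameExpr_eval {s : Store} {p q : ℕ} (h0 : ∀ x, s 0 (x + 1) = inp x) (h15 : s 15 0 = p)
    (h13 : s 13 0 = q) : sameExpr.eval s = 0 ↔ ¬ inp p = inp q := by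
  simp only [sameExpr, Expr.eval, Op.eval, h15, h13, h0]
  omega

theorem runs_scanProg {s : Store} {q : ℕ} (h0 : ∀ x, s 0 (x + 1) = inp x) (h13 : s 13 0 = q) :
    ∃ s', Runs O scanProg s s' (122 * q + 40) ∧ s' 17 0 = countBefore inp (inp q) q ∧
      s' 18 0 = lastBefore inp (inp q) q := by
  have r1 := runs_setVar (O := O) (s := s) 17 (e := .const 0) (v := 0) rfl
  have r2 := runs_setVar (O := O) (s := s.set 17 0 0) 18 (e := .const 0) (v := 0) rfl
  obtain ⟨s', r3, h17, h18⟩ := runs_rep (O := O) (r := 15) (n := 16) (e := var 13)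
    (P := .ite sameExpr
      (.seq (setVar 17 (.op .add (var 17) (.const 1))) (setVar 18 (var 15))) .skip)
    (by decide) (by decide) (by decide) (s := (s.set 17 0 0).set 18 0 0) (m := q) (T := 94)
    (by simp [Expr.eval, Store.set, h13])
    (fun i s => s 17 0 = countBefore inp (inp q) i ∧ s 18 0 = lastBefore inp (inp q) i)
    ⟨rfl, rfl⟩ (by
      rintro i - s₁ ⟨h17, h18⟩ h15 hf
      have h0' : ∀ x, s₁ 0 (x + 1) = inp x := by
        intro x; rw [hf 0 (by decide) (by decide) (by decide)]; exact h0 x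
      have h13' : s₁ 13 0 = q := by
        rw [hf 13 (by decide) (by decide) (by decide)]; exact h13
      by_cases hv : inp i = inp q
      · have r1 := runs_setVar (O := O) (s := s₁) 17 (e := .op .add (var 17) (.const 1))
          (v := countBefore inp (inp q) i + 1) (by simp [Expr.eval, Op.eval, h17])
        have r2 := runs_setVar (O := O) (s := s₁.set 17 0 (countBefore inp (inp q) i + 1)) 18
          (e := var 15) (v := i) (by simp [Expr.eval, Store.set, h15])
        refine ⟨_, (Runs.ite_true (fun h => (sameExpr_eval h0' h15 h13').1 h hv)
          (r1.seq r2)).mono ?_, ?_, ?_⟩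
        · simp [Expr.weight, sameExpr_weight]
        · simp [Store.set, countBefore, hv]
        · simp [Store.set, lastBefore, hv]
      · refine ⟨_, (Runs.ite_false ((sameExpr_eval h0' h15 h13').2 hv)
          (runs_skip s₁)).mono ?_, ?_, ?_⟩
        · simp [sameExpr_weight]
        · simpa [Store.set, countBefore, hv] using h17
        · simpa [Store.set, lastBefore, hv] using h18)
  refine ⟨s', (r1.seq (r2.seq r3)).mono ?_, h17, h18⟩
  simp [Expr.weight]; omega

theorem runs_freshProg {j : ℕ} {A : Finset ℕ} {l : List Instr} {s : Store} {z q : ℕ}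
    (h : CodeRel j A l s) (h18 : s 18 0 = z) (h13 : s 13 0 = q) :
    ∃ s', Runs O freshProg s s' 157 ∧
      CodeRel j (insert z (insert q A)) (l ++ [.fresh z q]) s' := by
  obtain ⟨ho, h5, hown, h6, h7⟩ := h
  obtain ⟨s₁, r1, ho1⟩ := runs_edgeProg (O := O) (x := var 5) (y := var 5)
    (u := (build j l).nv) (v := (build j l).nv) ho
    (fun s' hs' => by simp [Expr.eval, Expr.weight, hs' 5, h5])
  have f1 : ∀ A, A ≠ 2 → A ≠ 4 → s₁ A = s A := by
    intro A h2 h4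
    rw [r1.frame]; simp [Prog.writes, edgeProg, h2, h4]
  generalize hn : (build j l).nv = n at *
  have r2 := runs_setArr (O := O) (s := s₁) 3 (i := var 18) (e := var 5) (k := z) (v := n)
    (by simp [Expr.eval, f1 18, h18]) (by simp [Expr.eval, f1 5, h5])
  have r3 := runs_setArr (O := O) (s := s₁.set 3 z n) 3 (i := var 13) (e := var 5) (k := q) (v := n)
    (by simp [Expr.eval, Store.set, f1 13, h13]) (by simp [Expr.eval, Store.set, f1 5, h5])
  have r4 := runs_setVar (O := O) (s := (s₁.set 3 z n).set 3 q n) 5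
    (e := .op .add (var 5) (.const 1)) (v := n + 1)
    (by simp [Expr.eval, Op.eval, Store.set, f1 5, h5])
  have r5 := runs_setVar (O := O) (s := ((s₁.set 3 z n).set 3 q n).set 5 0 (n + 1)) 6
    (e := .op .mul (var 6) (.const 2)) (v := normConst l * 2)
    (by simp [Expr.eval, Op.eval, Store.set, f1 6, h6])
  refine ⟨_, (r1.seq (r2.seq (r3.seq (r4.seq r5)))).mono ?_, ?_, ?_, ?_, ?_, ?_⟩
  · simp [Expr.weight, Expr.eval, size_two]
  · rw [build_concat]
    refine Out.congr (s := s₁) ?_ rfl rfl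
    simpa [Builder.step, hn] using ho1
  · rw [build_concat]
    simp [Store.set, Builder.step, hn]
  · intro x hx
    rw [build_concat, Store.set_of_ne _ (by decide), Store.set_of_ne _ (by decide), Store.set_same,
      Store.set_same, f1 3 (by decide) (by decide)]
    simp only [Builder.step, hn, Function.update_apply]
    by_cases hxq : x = q
    · simp [hxq]
    · by_cases hxz : x = z
      · simp [hxz]
      · simp only [if_neg hxq, if_neg hxz]
        exact hown x (by simpa [hxq, hxz] using hx)
  · simp [normConst, Instr.norm]
  · rw [Store.set_of_ne _ (by decide), Store.set_of_ne _ (by decide), Store.set_of_ne _ (by decide),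
      Store.set_of_ne _ (by decide), f1 7 (by decide) (by decide), h7]
    simp [numBoxes, Instr.boxes]

/-- The variable `19` drops by one with every ladder and so always holds the length of the next one.
The weight is expressed by `Q` instead of `q` to be the same for all rounds of the outer loop. -/
theorem runs_dartProg {j q Q : ℕ} {s : Store} (hQ : q ≤ Q)
    (h : CodeRel j (attached inp q) (code inp q) s) (h0 : ∀ x, s 0 (x + 1) = inp x)
    (h13 : s 13 0 = q) (h8 : s 8 0 = j) :
    ∃ s', Runs O dartProg s s' (Q * (Q * (244 * j + 297) + 436) + 260) ∧
      CodeRel j (attached inp (q + 1)) (code inp (q + 1)) s' := by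
  obtain ⟨s₁, r1, h17, h18⟩ := runs_scanProg (O := O) h0 h13
  have f1 : ∀ A, A ∉ scanProg.writes → s₁ A = s A := fun A hA => r1.frame hA
  have h1 : CodeRel j (attached inp q) (code inp q) s₁ := h.congr fun B h2 h7 => f1 B (by
    have : scanProg.writes = [17, 18, 16, 15, 17, 18, 15] := by decide
    rw [this]; simp; omega)
  have h13' : s₁ 13 0 = q := by rw [f1 13 (by decide), h13]
  set v := inp q with hv
  have hsc : 122 * q + 40 ≤ 122 * Q + 40 := by omega
  by_cases hodd : countBefore inp v q % 2 = 1
  · obtain ⟨hz, hzv, hmax, hcnt⟩ := lastBefore_spec (inp := inp) (v := v) (i := q) (by omega)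
    rw [code, dartCode, if_pos hodd, attached_succ_of_odd hodd]
    set z := lastBefore inp v q with hzdef
    obtain ⟨s₂, r2, h2⟩ := runs_freshProg (O := O) h1 h18 h13'
    have f2 : ∀ A, A ∉ scanProg.writes → A ∉ freshProg.writes → s₂ A = s A := fun A hA hB => by
      rw [r2.frame hB, f1 A hA]
    have h17₂ : s₂ 17 0 = countBefore inp v q := by rw [r2.frame (by decide), h17]
    have h18₂ : s₂ 18 0 = z := by rw [r2.frame (by decide), h18]
    have r3 := runs_setVar (O := O) (s := s₂) 19 (e := .op .sub (var 17) (.const 1))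
      (v := countBefore inp v q - 1) (by simp [Expr.eval, Op.eval, h17₂])
    set m := countBefore inp v q - 1 with hm
    have hmQ : m ≤ Q := by
      have := countBefore_le (inp := inp) v q
      omega
    obtain ⟨s₄, r4, h4, -⟩ := runs_rep (O := O) (r := 15) (n := 16) (e := var 18)
      (P := .ite sameExpr
        (.seq ladderProg (setVar 19 (.op .sub (var 19) (.const 1)))) .skip)
      (by decide) (by decide) (by decide) (s := s₂.set 19 0 m) (m := z)
      (T := Q * (244 * j + 297) + 286) (by simp [Expr.eval, Store.set, h18₂])
      (fun i s => CodeRel j (insert z (insert q (attached inp q)))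
        (code inp q ++ [.fresh z q] ++ ladders inp v m q i) s ∧
          s 19 0 = m - countBefore inp v i)
      ⟨by
        rw [ladders, List.append_nil]
        refine h2.congr fun B _ _ => ?_
        rw [Store.set_of_ne _ (by omega), Store.set_of_ne _ (by omega),
          Store.set_of_ne _ (by omega)], by simp [Store.set, countBefore]⟩ (by
        rintro i hi s₅ ⟨h5, h19⟩ h15 hf
        have hf' : ∀ A, A = 0 ∨ A = 8 ∨ A = 13 → s₅ A = s A := by
          rintro A (rfl | rfl | rfl) <;>
          rw [hf _ (by decide) (by decide) (by decide), Store.set_of_ne _ (by decide),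
            f2 _ (by decide) (by decide)]
        have h0' : ∀ x, s₅ 0 (x + 1) = inp x := by
          intro x; rw [hf' 0 (by simp)]; exact h0 x
        have h13' : s₅ 13 0 = q := by rw [hf' 13 (by simp), h13]
        by_cases hiv : inp i = v
        · have hmem : i ∈ attached inp q :=
            mem_attached (by omega) (by rw [hiv]; omega)
          obtain ⟨s₆, r6, h6⟩ := runs_ladderProg (O := O) h5 (p := i) (q := q)
            (w := m - countBefore inp v i) (by simp [hmem]) (by simp)
            (by rw [hf' 8 (by simp), h8]) h15 h13' h19
          have r7 := runs_setVar (O := O) (s := s₆) 19 (e := .op .sub (var 19) (.const 1))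
            (v := m - countBefore inp v i - 1)
            (by simp [Expr.eval, Op.eval, r6.frame (show 19 ∉ ladderProg.writes by decide), h19])
          refine ⟨_, (Runs.ite_true (fun h => (sameExpr_eval h0' h15 h13').1 h hiv)
            (r6.seq r7)).mono ?_, ?_, ?_⟩
          · have : (m - countBefore inp v i) * (244 * j + 297) ≤ Q * (244 * j + 297) :=
              Nat.mul_le_mul_right _ (by omega)
            simp [Expr.weight, sameExpr_weight]; omega
          · rw [ladders, if_pos hiv, ← List.append_assoc]
            refine h6.congr fun B _ _ => ?_
            rw [Store.set_of_ne _ (by omega), Store.set_of_ne _ (by omega)]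
          · simp only [countBefore, if_pos hiv]
            rw [Store.set_of_ne _ (by decide)]
            simp; omega
        · refine ⟨_, (Runs.ite_false ((sameExpr_eval h0' h15 h13').2 hiv)
            (runs_skip s₅)).mono ?_, ?_, ?_⟩
          · simp [sameExpr_weight]
          · rw [ladders, if_neg hiv]
            refine h5.congr fun B _ _ => ?_
            rw [Store.set_of_ne _ (by omega)]
          · simpa [Store.set, countBefore, hiv] using h19)
    refine ⟨s₄, (r1.seq (Runs.ite_true ?_ (r2.seq (r3.seq r4)))).mono ?_, ?_⟩
    · simp [Expr.eval, Op.eval, h17, hodd]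
    · have : z * (Q * (244 * j + 297) + 286 + 28) ≤ Q * (Q * (244 * j + 297) + 286 + 28) :=
        Nat.mul_le_mul_right _ (by omega)
      simp only [Expr.weight, size_two, Nat.size_zero, Nat.size_one]
      nlinarith
    · simpa using h4
  · refine ⟨s₁, (r1.seq (Runs.ite_false ?_ (runs_skip s₁))).mono ?_, ?_⟩
    · simp [Expr.eval, Op.eval, h17]; omega
    · simp only [Expr.weight, size_two, Nat.size_zero]
      nlinarith [Nat.zero_le (Q * (Q * (244 * j + 297)))]
    · rw [code, dartCode, if_neg hodd, attached_succ_of_even hodd, List.append_nil]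
      exact h1

theorem closingEdges_succ (own : ℕ → ℕ) (m : ℕ) :
    closingEdges own (m + 1) = closingEdges own m ++ [(own (2 * m), own (2 * m + 1))] := by
  rw [closingEdges, List.ofFn_succ_last]; rfl

theorem Out.word {es : List (ℕ × ℕ)} {s : Store} (h : Out es s) :
    s.word 2 (s 4 0) = s 2 0 :: flatEdges es := by
  rw [Store.word, h.1, List.range_succ_eq_map, List.map_cons, List.map_map, ← h.2]
  rfl

/-- The program runs repeatedly in one store. Nothing is assumed about what earlier runs left in its
working arrays: every leg is assigned an owner before it is read. -/
theorem runs_buildProg {G : Multigraph} (hG : ∀ v, Even (G.degree v)) {j : ℕ} {s : Store}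
    (h0 : ∀ x, s 0 (x + 1) = G.dartVertex x) (h1 : s 1 0 = 2 * G.numEdges + 1) (h8 : s 8 0 = j)
    {Q : ℕ} (hQ : Q = 2 * G.numEdges) :
    ∃ s', Runs O buildProg s s' (Q * (Q * (Q * (244 * j + 297) + 436) + 288) + 128 * Q + 150) ∧
      s'.word 2 (s' 4 0) = (G.fourRegular hG j).encode ∧
      s' 4 0 = 2 * (G.fourRegular hG j).numEdges + 1 ∧
      s' 6 0 = normConst G.instrs ∧ s' 7 0 = numBoxes G.instrs := by
  have r1 := runs_setVar (O := O) (s := s) 4 (e := .const 1) (v := 1) rfl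
  have r2 := runs_setVar (O := O) (s := s.set 4 0 1) 5 (e := .const 0) (v := 0) rfl
  have r3 := runs_setVar (O := O) (s := (s.set 4 0 1).set 5 0 0) 6 (e := .const 1) (v := 1) rfl
  have r4 := runs_setVar (O := O) (s := ((s.set 4 0 1).set 5 0 0).set 6 0 1) 7 (e := .const 0)
    (v := 0) rfl
  set s₄ := (((s.set 4 0 1).set 5 0 0).set 6 0 1).set 7 0 0 with hs₄
  have f4 : ∀ A, A < 4 ∨ 7 < A → s₄ A = s A := by
    intro A hA
    rw [hs₄, Store.set_of_ne _ (by omega), Store.set_of_ne _ (by omega),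
      Store.set_of_ne _ (by omega), Store.set_of_ne _ (by omega)]
  obtain ⟨s₅, r5, h5⟩ := runs_rep (O := O) (r := 13) (n := 14)
    (e := .op .sub (var 1) (.const 1)) (P := dartProg) (by decide) (by decide) (by decide)
    (s := s₄) (m := Q) (T := Q * (Q * (244 * j + 297) + 436) + 260)
    (by simp [Expr.eval, Op.eval, f4 1, h1, hQ])
    (fun q s => CodeRel j (attached G.dartVertex q) (code G.dartVertex q) s)
    (by
      refine ⟨⟨rfl, rfl⟩, rfl, ?_, rfl, rfl⟩
      intro x hx
      simp [attached] at hx)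
    (by
      intro q hq s₅ h5 h13 hf
      have hf' : ∀ A, A = 0 ∨ A = 8 → s₅ A = s A := by
        rintro A (rfl | rfl) <;>
        rw [hf _ (by decide) (by decide) (by decide), f4 _ (by decide)]
      obtain ⟨s₆, r6, h6⟩ := runs_dartProg (O := O) hq.le h5
        (fun x => by rw [hf' 0 (by simp)]; exact h0 x) h13 (by rw [hf' 8 (by simp), h8])
      refine ⟨s₆, r6, h6.congr fun B _ _ => ?_⟩
      rw [Store.set_of_ne _ (by omega)])
  rw [hQ, G.attached_eq_range hG] at h5
  change CodeRel j _ G.instrs s₅ at h5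
  obtain ⟨ho, hnv, hown, h6, h7⟩ := h5
  have h1₅ : s₅ 1 0 = 2 * G.numEdges + 1 := by
    rw [r5.frame (by decide), f4 1 (by decide), h1]
  obtain ⟨s₆, r6, ho6⟩ := runs_rep (O := O) (r := 29) (n := 30)
    (e := .op .div (.op .sub (var 1) (.const 1)) (.const 2))
    (P := edgeProg (.load 3 (.op .add (var 29) (var 29)))
            (.load 3 (.op .add (.op .add (var 29) (var 29)) (.const 1))))
    (by decide) (by decide) (by decide) (s := s₅) (m := G.numEdges) (T := 100)
    (by simp [Expr.eval, Op.eval, h1₅])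
    (fun i s => Out ((build j G.instrs).es ++ closingEdges (build j G.instrs).own i) s)
    (by
      rw [closingEdges, List.ofFn_zero, List.append_nil]
      exact ho.congr rfl rfl)
    (by
      intro i hi s₆ ho6 h29 hf
      have h3 : s₆ 3 = s₅ 3 := hf 3 (by decide) (by decide) (by decide)
      obtain ⟨s₇, r7, ho7⟩ := runs_edgeProg (O := O)
        (x := .load 3 (.op .add (var 29) (var 29)))
        (y := .load 3 (.op .add (.op .add (var 29) (var 29)) (.const 1)))
        (u := (build j G.instrs).own (2 * i)) (v := (build j G.instrs).own (2 * i + 1)) ho6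
        (fun s' hs' => by
          refine ⟨?_, ?_, by simp [Expr.weight], by simp [Expr.weight]⟩
          · simp only [Expr.eval, Op.eval, hs' 29 (by decide) (by decide), h29,
              hs' 3 (by decide) (by decide), h3]
            rw [← two_mul]
            exact hown _ (Finset.mem_range.2 (by omega))
          · simp only [Expr.eval, Op.eval, hs' 29 (by decide) (by decide), h29,
              hs' 3 (by decide) (by decide), h3]
            rw [← two_mul]
            exact hown _ (Finset.mem_range.2 (by omega)))
      refine ⟨s₇, r7, ?_⟩
      rw [closingEdges_succ, ← List.append_assoc]
      exact ho7.congr rfl rfl)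
  have f6 : ∀ A, A ∉ [2, 4, 29, 30] → s₆ A = s₅ A := by
    intro A hA
    refine r6.frame ?_
    have : (Prog.rep 29 30 (.op .div (.op .sub (var 1) (.const 1)) (.const 2))
      (edgeProg (.load 3 (.op .add (var 29) (var 29)))
            (.load 3 (.op .add (.op .add (var 29) (var 29)) (.const 1))))).writes =
        [30, 29, 2, 2, 4, 29] := by decide
    rw [this]
    simp at hA ⊢
    omega
  have r7 := runs_setArr (O := O) (s := s₆) 2 (i := .const 0) (e := var 5) (k := 0)
    (v := (build j G.instrs).nv) rfl (by simp [Expr.eval, f6 5, hnv])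
  have ho7 : Out ((build j G.instrs).es ++ closingEdges (build j G.instrs).own G.numEdges)
      (s₆.set 2 0 (build j G.instrs).nv) := by
    refine ⟨ho6.1, ?_⟩
    rw [← ho6.2]
    refine List.map_congr_left fun i _ => ?_
    simp
  refine ⟨_, (r1.seq (r2.seq (r3.seq (r4.seq (r5.seq (r6.seq r7)))))).mono ?_, ?_, ?_, ?_, ?_⟩
  · simp only [Expr.weight, size_two, Nat.size_zero, Nat.size_one]
    have : G.numEdges * (100 + 28) ≤ 128 * Q := by omega
    nlinarith
  · rw [ho7.word, Multigraph.fourRegular, Builder.encode_close]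
    simp
  · rw [ho7.1, Multigraph.fourRegular]
    simp [Builder.close, closingEdges]
  · rw [Store.set_of_ne _ (by decide), f6 6 (by decide), h6]
  · rw [Store.set_of_ne _ (by decide), f6 7 (by decide), h7]

end Correctness

end OracleRAM

/-! ## Size bounds -/

theorem ValidCode.normConst_pos {l : List Instr} {A : Finset ℕ} (h : ValidCode l A) :
    0 < normConst l := by
  induction h with
  | nil => simp
  | fresh _ _ _ _ ih => simpa [normConst, Instr.norm] using ih
  | ladder _ hw _ _ _ ih => simpa [normConst, Instr.norm, hw] using ih

theorem numBoxes_ladders_le {inp : ℕ → ℕ} (v m q i : ℕ) :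
    numBoxes (ladders inp v m q i) ≤ i * m ∧ (ladders inp v m q i).length ≤ i := by
  induction i with
  | zero => simp [ladders]
  | succ i ih =>
    simp only [ladders]
    split_ifs
    · refine ⟨?_, by simpa using ih.2⟩
      have : numBoxes [.ladder (m - countBefore inp v i) i q] ≤ m := by
        simp [numBoxes, Instr.boxes]
      rw [numBoxes_append, add_mul, one_mul]
      exact Nat.add_le_add ih.1 this
    · exact ⟨ih.1.trans (Nat.mul_le_mul_right _ (by omega)), by omega⟩

theorem numBoxes_dartCode_le {inp : ℕ → ℕ} (q : ℕ) :
    numBoxes (dartCode inp q) ≤ q * q ∧ (dartCode inp q).length ≤ q + 1 := by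
  rw [dartCode]
  split_ifs
  · have h := numBoxes_ladders_le (inp := inp) (inp q) (countBefore inp (inp q) q - 1) q
      (lastBefore inp (inp q) q)
    have h1 := lastBefore_le (inp := inp) (inp q) q
    have h2 := countBefore_le (inp := inp) (inp q) q
    constructor
    · rw [← List.singleton_append, numBoxes_append]
      simp only [numBoxes, Instr.boxes, List.map_cons, List.map_nil, List.sum_cons, List.sum_nil,
        zero_add]
      exact h.1.trans (Nat.mul_le_mul h1 (by omega))
    · rw [List.length_cons]; omega
  · simp

theorem numBoxes_code_le {inp : ℕ → ℕ} {q Q : ℕ} (hq : q ≤ Q) :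
    numBoxes (code inp q) ≤ q * (Q * Q) ∧ (code inp q).length ≤ q * (Q + 1) := by
  induction q with
  | zero => simp [code]
  | succ q ih =>
    have h1 := ih (by omega)
    have h2 := numBoxes_dartCode_le (inp := inp) q
    have h3 : q * q ≤ Q * Q := Nat.mul_le_mul (by omega) (by omega)
    rw [code, numBoxes_append, List.length_append, add_mul, add_mul, one_mul, one_mul]
    omega

theorem length_chainEdges (n j : ℕ) : (chainEdges n j).length = 2 * j := by
  induction j with
  | zero => rfl
  | succ j ih => rw [chainEdges]; simp [ih]; omega

theorem Builder.length_blocks_le (j p : ℕ) (B : Builder) (i : ℕ) :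
    (B.blocks j p i).es.length ≤ B.es.length + i * (2 * j + 2) := by
  induction i with
  | zero => simp [blocks]
  | succ i ih =>
    rw [blocks, LadderState.addBlock]
    simp only [List.length_append, List.length_cons, length_chainEdges, add_mul, one_mul]
    split_ifs <;> simp <;> omega

theorem length_build_le (j : ℕ) (l : List Instr) :
    (build j l).es.length ≤ l.length + numBoxes l * (2 * j + 2) := by
  induction l using List.reverseRecOn with
  | nil => simp
  | append_singleton l i ih =>
    rw [build_concat, numBoxes_append, add_mul]
    cases i with
    | fresh p q => simp [Builder.step, numBoxes, Instr.boxes] at ih ⊢; omega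
    | ladder w p q =>
      have := Builder.length_blocks_le j p (build j l) w
      simp [Builder.step, numBoxes, Instr.boxes] at ih ⊢; omega

theorem Nat.size_factorial_le (n : ℕ) : Nat.size n.factorial ≤ n * n + 1 := by
  rw [Nat.size_le]
  calc n.factorial ≤ n ^ n := Nat.factorial_le_pow n
    _ ≤ (2 ^ n) ^ n := Nat.pow_le_pow_left Nat.lt_two_pow_self.le n
    _ = 2 ^ (n * n) := (pow_mul 2 n n).symm
    _ < 2 ^ (n * n + 1) := Nat.pow_lt_pow_right (by decide) (Nat.lt_succ_self _)

namespace Multigraph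

variable {G : Multigraph} {S : ℕ}

theorem numBoxes_instrs_le (hS : 2 * G.numEdges + 1 ≤ S) : numBoxes G.instrs ≤ S ^ 3 := by
  refine (numBoxes_code_le le_rfl).1.trans ?_
  calc 2 * G.numEdges * (2 * G.numEdges * (2 * G.numEdges)) ≤ S * (S * S) := by gcongr <;> omega
    _ = S ^ 3 := by ring

theorem numEdges_fourRegular_le (hG : ∀ v, Even (G.degree v)) (hS : 2 * G.numEdges + 1 ≤ S)
    {j : ℕ} (hj : j ≤ S ^ 3) : (G.fourRegular hG j).numEdges ≤ 6 * S ^ 6 := by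
  have h1 := length_build_le j G.instrs
  have h2 := numBoxes_instrs_le hS
  have h3 : G.instrs.length ≤ S * S := (numBoxes_code_le le_rfl).2.trans (by gcongr; omega)
  have h4 : numBoxes G.instrs * (2 * j + 2) ≤ S ^ 3 * (2 * S ^ 3 + 2) := by gcongr
  have hS' : 1 ≤ S := by omega
  have h5 : S ^ 3 ≤ S ^ 6 := Nat.pow_le_pow_right hS' (by decide)
  have h6 : S ^ 2 ≤ S ^ 6 := Nat.pow_le_pow_right hS' (by decide)
  have h7 : S ≤ S ^ 6 := Nat.le_self_pow (by decide) S
  have h8 : S ^ 3 * (2 * S ^ 3 + 2) = 2 * S ^ 6 + 2 * S ^ 3 := by ring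
  have h9 : S * S = S ^ 2 := by ring
  change (build j G.instrs).es.length + G.numEdges ≤ _
  omega

/-- The factorial of n has at most n² + 1 bits, here with n at most 12 S⁶. -/
theorem size_numEulerianTours_le {H : Multigraph} (hS : 1 ≤ S) (hH : H.numEdges ≤ 6 * S ^ 6) :
    Nat.size H.numEulerianTours ≤ 145 * S ^ 12 := by
  have h1 := (Nat.size_le_size H.numEulerianTours_le_factorial).trans (Nat.size_factorial_le _)
  have h2 : H.numEdges * 2 * (H.numEdges * 2) ≤ (6 * S ^ 6 * 2) * (6 * S ^ 6 * 2) := by gcongr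
  have h3 : (6 * S ^ 6 * 2) * (6 * S ^ 6 * 2) = 144 * S ^ 12 := by ring
  have h4 : 1 ≤ S ^ 12 := Nat.one_le_pow _ _ hS
  omega

theorem length_encode (G : Multigraph) : G.encode.length = 2 * G.numEdges + 1 := by
  rw [encode_eq_flatEdges, List.length_cons, length_flatEdges, List.length_ofFn]

end Multigraph

/-! ## The reduction -/

namespace OracleRAM

theorem size_le_wordSize {w : List ℕ} {x : ℕ} (hx : x ∈ w) : Nat.size x ≤ wordSize w :=
  (Nat.le_succ _).trans (List.single_le_sum (fun _ _ => Nat.zero_le _) _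
    (List.mem_map_of_mem (f := fun x => Nat.size x + 1) hx))

theorem length_le_wordSize (w : List ℕ) : w.length ≤ wordSize w := by
  induction w with
  | nil => simp
  | cons a w ih =>
    simp only [wordSize, List.map_cons, List.sum_cons, List.length_cons] at *
    omega

theorem bounded_initStore (w : List ℕ) : (initStore w).Bounded (wordSize w) := by
  intro A i
  rw [initStore]
  split_ifs
  · by_cases hi : i < w.length
    · rw [List.getD_eq_getElem _ _ hi]
      exact size_le_wordSize (List.getElem_mem hi)
    · rw [List.getD_eq_default _ _ (by omega)]
      simp
  · exact (Nat.size_le_self _).trans (length_le_wordSize w)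
  · simp

/-- Double the variables `10` and `11` as often as the variable `7` says. -/
def doubleProg : Prog :=
  .rep 26 27 (var 7) (.seq (setVar 10 (.op .add (var 10) (var 10)))
    (setVar 11 (.op .add (var 11) (var 11))))

/-- Query the graph with chains of length given by the variable `8`, and add the answer, with its
binomial coefficient and its sign, to the partial sum. -/
def termProg : Prog :=
  .seq buildProg (.seq (.query 2 (var 4) 12)
    (.seq (setVar 9 (.op .div (.op .mul (var 9) (.op .sub (.op .add (var 7) (.const 1)) (var 8)))
        (.op .add (var 8) (.const 1))))
      (.seq doubleProg (.ite (.op .mod (var 8) (.const 2))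
        (setVar 11 (.op .add (var 11) (.op .mul (var 9) (var 12))))
        (setVar 10 (.op .add (var 10) (.op .mul (var 9) (var 12))))))))

/-- Count the Eulerian tours of the input graph. -/
def mainProg : Prog :=
  .seq buildProg (.seq (setVar 9 (.const 1))
    (.seq (.rep 8 28 (.op .add (var 7) (.const 1)) termProg)
      (.seq (.rep 26 27 (.op .mul (var 7) (var 7)) (setVar 6 (.op .add (var 6) (var 6))))
        (setVar 0 (.op .div (.op .sub (var 10) (var 11)) (var 6))))))

/-! ### Correctness and cost of the reduction. -/

section Correctness

variable {O : List ℕ → ℕ}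

theorem runs_doubleProg {s : Store} {D a b : ℕ} (h7 : s 7 0 = D) (h10 : s 10 0 = a)
    (h11 : s 11 0 = b) : ∃ s', Runs O doubleProg s s' (61 * D + 28) ∧
      s' 10 0 = 2 ^ D * a ∧ s' 11 0 = 2 ^ D * b := by
  obtain ⟨s', r, h⟩ := runs_rep (O := O) (r := 26) (n := 27) (e := var 7)
    (P := .seq (setVar 10 (.op .add (var 10) (var 10)))
      (setVar 11 (.op .add (var 11) (var 11)))) (by decide) (by decide) (by decide)
    (s := s) (m := D) (T := 33) (by simp [Expr.eval, h7])
    (fun i s => s 10 0 = 2 ^ i * a ∧ s 11 0 = 2 ^ i * b)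
    (by simp [Store.set, h10, h11])
    (by
      rintro i - s₁ ⟨h10, h11⟩ - -
      have r1 := runs_setVar (O := O) (s := s₁) 10 (e := .op .add (var 10) (var 10))
        (v := 2 ^ (i + 1) * a) (by simp [Expr.eval, Op.eval, h10]; ring)
      have r2 := runs_setVar (O := O) (s := s₁.set 10 0 (2 ^ (i + 1) * a)) 11
        (e := .op .add (var 11) (var 11)) (v := 2 ^ (i + 1) * b)
        (by simp [Expr.eval, Op.eval, Store.set, h11]; ring)
      exact ⟨_, (r1.seq r2).mono (by simp [Expr.weight]), by simp [Store.set]⟩)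
  refine ⟨s', r.mono ?_, h⟩
  simp [Expr.weight]; omega

theorem runs_doubleNorm {s : Store} {D K : ℕ} (h7 : s 7 0 = D) (h6 : s 6 0 = K) :
    ∃ s', Runs O (.rep 26 27 (.op .mul (var 7) (var 7)) (setVar 6 (.op .add (var 6) (var 6)))) s s'
        (D + 44 * (D * D) + 36) ∧ s' 6 0 = 2 ^ (D * D) * K := by
  obtain ⟨s', r, h⟩ := runs_rep (O := O) (r := 26) (n := 27) (e := .op .mul (var 7) (var 7))
    (P := setVar 6 (.op .add (var 6) (var 6))) (by decide) (by decide) (by decide)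
    (s := s) (m := D * D) (T := 16) (by simp [Expr.eval, Op.eval, h7])
    (fun i s => s 6 0 = 2 ^ i * K)
    (by simp [Store.set, h6])
    (by
      rintro i - s₁ h6 - -
      have r1 := runs_setVar (O := O) (s := s₁) 6 (e := .op .add (var 6) (var 6))
        (v := 2 ^ (i + 1) * K) (by simp [Expr.eval, Op.eval, h6]; ring)
      exact ⟨_, r1.mono (by simp [Expr.weight]), by simp [Store.set]⟩)
  refine ⟨s', r.mono ?_, h⟩
  have := Nat.size_le_self D
  simp [Expr.weight, Expr.eval, h7]; omega

/-- The partial sums that the program computes. -/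
def partialSum (D : ℕ) (N : ℕ → ℕ) (i : ℕ) : ℤ :=
  ∑ j ∈ Finset.range i, (-1) ^ j * ((D + 1).choose (j + 1) : ℤ) * (2 ^ ((i - 1 - j) * D) * (N j : ℤ))

/-- A Horner scheme: multiplying the partial sum by 2^D in every round produces the exponents (D -
j) D once D + 1 rounds are over. -/
theorem partialSum_succ (D : ℕ) (N : ℕ → ℕ) (i : ℕ) :
    partialSum D N (i + 1) =
      2 ^ D * partialSum D N i + (-1) ^ i * (((D + 1).choose (i + 1) * N i : ℕ) : ℤ) := by
  rw [partialSum, Finset.sum_range_succ, partialSum, Finset.mul_sum]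
  congr 1
  · refine Finset.sum_congr rfl fun j hj => ?_
    have : i + 1 - 1 - j = (i - 1 - j) + 1 := by have := Finset.mem_range.1 hj; omega
    rw [this, add_mul, one_mul, pow_add]
    ring
  · simp; ring

variable {G : Multigraph} {S : ℕ}

theorem runs_buildProg_pow (hG : ∀ v, Even (G.degree v)) (hS : 2 * G.numEdges + 1 ≤ S) {j : ℕ}
    (hj : j ≤ S ^ 3) {s : Store} (h0 : ∀ x, s 0 (x + 1) = G.dartVertex x)
    (h1 : s 1 0 = 2 * G.numEdges + 1) (h8 : s 8 0 = j) :
    ∃ s', Runs O buildProg s s' (1543 * S ^ 6) ∧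
      s'.word 2 (s' 4 0) = (G.fourRegular hG j).encode ∧
      s' 4 0 = 2 * (G.fourRegular hG j).numEdges + 1 ∧
      s' 6 0 = normConst G.instrs ∧ s' 7 0 = numBoxes G.instrs := by
  obtain ⟨s', r, h⟩ := runs_buildProg (O := O) hG h0 h1 h8 rfl
  refine ⟨s', r.mono ?_, h⟩
  have hS' : 1 ≤ S := by omega
  calc 2 * G.numEdges * (2 * G.numEdges * (2 * G.numEdges * (244 * j + 297) + 436) + 288) +
        128 * (2 * G.numEdges) + 150
      ≤ S * (S * (S * (244 * S ^ 3 + 297) + 436) + 288) + 128 * S + 150 := by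
        gcongr <;> omega
    _ = 244 * S ^ 6 + 297 * S ^ 3 + 436 * S ^ 2 + 416 * S ^ 1 + 150 * S ^ 0 := by ring
    _ ≤ 244 * S ^ 6 + 297 * S ^ 6 + 436 * S ^ 6 + 416 * S ^ 6 + 150 * S ^ 6 := by
        gcongr <;> first | exact hS' | decide
    _ = 1543 * S ^ 6 := by ring

/-- Values are natural numbers, so terms of positive and negative sign are collected in the
variables `10` and `11`; only their difference matters. -/
theorem runs_termProg (hO : ∀ H : Multigraph, H.IsFourRegular → O H.encode = H.numEulerianTours)
    (hG : ∀ v, Even (G.degree v)) (hS : 2 * G.numEdges + 1 ≤ S) {j : ℕ}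
    (hj : j ≤ numBoxes G.instrs) {s : Store} (h0 : ∀ x, s 0 (x + 1) = G.dartVertex x)
    (h1 : s 1 0 = 2 * G.numEdges + 1) (h8 : s 8 0 = j)
    (h9 : s 9 0 = (numBoxes G.instrs + 1).choose j)
    (hsum : (s 10 0 : ℤ) - s 11 0 = partialSum (numBoxes G.instrs)
      (fun k => (G.fourRegular hG k).numEulerianTours) j) :
    ∃ s', Runs O termProg s s' (2100 * S ^ 12) ∧
      s' 6 0 = normConst G.instrs ∧ s' 7 0 = numBoxes G.instrs ∧
      s' 9 0 = (numBoxes G.instrs + 1).choose (j + 1) ∧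
      (s' 10 0 : ℤ) - s' 11 0 = partialSum (numBoxes G.instrs)
        (fun k => (G.fourRegular hG k).numEulerianTours) (j + 1) := by
  have hD := Multigraph.numBoxes_instrs_le hS
  have hE := Multigraph.numEdges_fourRegular_le hG hS (hj.trans hD)
  have hN := Multigraph.size_numEulerianTours_le (by omega) hE
  rw [partialSum_succ]
  generalize partialSum _ _ j = z at *
  obtain ⟨s₁, r1, hw, h4, h6, h7⟩ := runs_buildProg_pow (O := O) hG hS (hj.trans hD) h0 h1 h8
  have f1 : ∀ A, A ∉ buildProg.writes → s₁ A = s A := fun A hA => r1.frame hA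
  have r2 := runs_query (O := O) s₁ 2 (var 4) 12
  have hans : O (s₁.word 2 ((var 4).eval s₁)) = (G.fourRegular hG j).numEulerianTours := by
    rw [show (var 4).eval s₁ = s₁ 4 0 from rfl, hw]
    exact hO _ (Builder.isFourRegular_close _)
  rw [hans] at r2
  generalize (G.fourRegular hG j).numEulerianTours = N at *
  generalize (G.fourRegular hG j).numEdges = E at *
  generalize numBoxes G.instrs = D at *
  generalize normConst G.instrs = K at *
  have f2 : ∀ A, A ≠ 12 → s₁.set 12 0 N A = s₁ A := fun A hA => Store.set_of_ne _ hA _ _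
  have r3 := runs_setVar (O := O) (s := s₁.set 12 0 N) 9
    -- The next binomial coefficient is the last one times (D + 1 - j) / (j + 1), and this division
    -- is exact.
    (e := .op .div (.op .mul (var 9) (.op .sub (.op .add (var 7) (.const 1)) (var 8)))
        (.op .add (var 8) (.const 1))) (v := (D + 1).choose (j + 1)) (by
      simp only [Expr.eval, Op.eval]
      rw [f2 9 (by decide), f2 7 (by decide), f2 8 (by decide), f1 9 (by decide), f1 8 (by decide),
        h7, h8, h9, ← Nat.choose_succ_right_eq]
      exact Nat.mul_div_cancel _ (Nat.succ_pos j))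
  set s₃ := (s₁.set 12 0 N).set 9 0 ((D + 1).choose (j + 1)) with hs₃
  have f3 : ∀ A, A ≠ 12 → A ≠ 9 → s₃ A = s₁ A := fun A hA hB => by
    rw [hs₃, Store.set_of_ne _ hB, f2 A hA]
  obtain ⟨s₄, r4, h10, h11⟩ := runs_doubleProg (O := O) (s := s₃) (D := D) (a := s 10 0)
    (b := s 11 0) (by rw [f3 7 (by decide) (by decide), h7])
    (by rw [f3 10 (by decide) (by decide), f1 10 (by decide)])
    (by rw [f3 11 (by decide) (by decide), f1 11 (by decide)])
  have f4 : ∀ A, A ∉ doubleProg.writes → s₄ A = s₃ A := fun A hA => r4.frame hA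
  have h6₄ : s₄ 6 0 = K := by rw [f4 6 (by decide), f3 6 (by decide) (by decide), h6]
  have h7₄ : s₄ 7 0 = D := by rw [f4 7 (by decide), f3 7 (by decide) (by decide), h7]
  have h8₄ : s₄ 8 0 = j := by
    rw [f4 8 (by decide), f3 8 (by decide) (by decide), f1 8 (by decide), h8]
  have h9₄ : s₄ 9 0 = (D + 1).choose (j + 1) := by
    rw [f4 9 (by decide), hs₃]; simp
  have h12₄ : s₄ 12 0 = N := by
    rw [f4 12 (by decide), hs₃, Store.set_of_ne _ (by decide)]; simp
  have h5 : ∃ s₅, Runs O (.ite (.op .mod (var 8) (.const 2))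
        (setVar 11 (.op .add (var 11) (.op .mul (var 9) (var 12))))
        (setVar 10 (.op .add (var 10) (.op .mul (var 9) (var 12))))) s₄ s₅ (36 + 145 * S ^ 12) ∧
      (s₅ 10 0 : ℤ) - s₅ 11 0 = 2 ^ D * z + (-1) ^ j * (((D + 1).choose (j + 1) * N : ℕ) : ℤ) := by
    rcases Nat.even_or_odd j with hj | hj
    · have r5 := runs_setVar (O := O) (s := s₄) 10
        (e := .op .add (var 10) (.op .mul (var 9) (var 12)))
        (v := 2 ^ D * s 10 0 + (D + 1).choose (j + 1) * N)
        (by simp [Expr.eval, Op.eval, h10, h9₄, h12₄])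
      refine ⟨_, (Runs.ite_false ?_ r5).mono ?_, ?_⟩
      · simp [Expr.eval, Op.eval, h8₄, Nat.even_iff.1 hj]
      · simp [Expr.weight, Expr.eval, size_two, h12₄]; omega
      · rw [Store.set_same, Store.set_of_ne _ (by decide), h11, ← hsum, hj.neg_one_pow]
        simp; ring
    · have r5 := runs_setVar (O := O) (s := s₄) 11
        (e := .op .add (var 11) (.op .mul (var 9) (var 12)))
        (v := 2 ^ D * s 11 0 + (D + 1).choose (j + 1) * N)
        (by simp [Expr.eval, Op.eval, h11, h9₄, h12₄])
      refine ⟨_, (Runs.ite_true ?_ r5).mono ?_, ?_⟩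
      · simp [Expr.eval, Op.eval, h8₄, Nat.odd_iff.1 hj]
      · simp [Expr.weight, Expr.eval, size_two, h12₄]; omega
      · rw [Store.set_same, Store.set_of_ne _ (by decide), h10, ← hsum, hj.neg_one_pow]
        simp; ring
  obtain ⟨s₅, r5, hsum'⟩ := h5
  refine ⟨s₅, (r1.seq (r2.seq (r3.seq (r4.seq r5)))).mono ?_, ?_, ?_, ?_, hsum'⟩
  · have hp1 : S ^ 6 ≤ S ^ 12 := Nat.pow_le_pow_right (by omega) (by decide)
    have hp2 : S ^ 3 ≤ S ^ 12 := Nat.pow_le_pow_right (by omega) (by decide)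
    have hp3 : 1 ≤ S ^ 12 := Nat.one_le_pow _ _ (by omega)
    have hsz := Nat.size_le_self ((s₁.set 12 0 N) 7 0 + 1 - (s₁.set 12 0 N) 8 0)
    rw [f2 7 (by decide), h7] at hsz
    simp only [Expr.weight, Expr.eval, Op.eval, Nat.size_zero, Nat.size_one, h4,
      f2 7 (by decide), h7]
    omega
  · rw [r5.frame (by decide), h6₄]
  · rw [r5.frame (by decide), h7₄]
  · rw [r5.frame (by decide), h9₄]

/-- The accumulated difference is 2^(D²) times the normalizing constant times the wanted number, so
one exact division remains. -/
theorem runs_mainProg (hO : ∀ H : Multigraph, H.IsFourRegular → O H.encode = H.numEulerianTours)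
    (hG : G.IsEulerian) (hS : 2 * G.numEdges + 1 ≤ S) :
    ∃ s, Runs O mainProg (initStore G.encode) s (6000 * S ^ 15) ∧ s 0 0 = G.numEulerianTours := by
  have hD := Multigraph.numBoxes_instrs_le hS
  have hS' : 1 ≤ S := by omega
  have h0 : ∀ x, initStore G.encode 0 (x + 1) = G.dartVertex x := fun x => rfl
  have h1 : initStore G.encode 1 0 = 2 * G.numEdges + 1 := G.length_encode
  -- A preliminary run with `j = 0`, whose graph is not queried: it supplies D and hence the number
  -- of rounds.
  obtain ⟨s₁, r1, -, -, h6, h7⟩ := runs_buildProg_pow (O := O) hG.2 hS (Nat.zero_le _) h0 h1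
    (show initStore G.encode 8 0 = 0 from rfl)
  have f1 : ∀ A, A ∉ buildProg.writes → s₁ A = initStore G.encode A := fun A hA => r1.frame hA
  have r2 := runs_setVar (O := O) (s := s₁) 9 (e := .const 1) (v := 1) rfl
  have f2 : ∀ A, A ≠ 9 → s₁.set 9 0 1 A = s₁ A := fun A hA => Store.set_of_ne _ hA _ _
  obtain ⟨s₃, r3, h6₃, h7₃, -, hsum⟩ := runs_rep (O := O) (r := 8) (n := 28)
    (e := .op .add (var 7) (.const 1)) (P := termProg) (by decide) (by decide) (by decide)
    (s := s₁.set 9 0 1) (m := numBoxes G.instrs + 1) (T := 2100 * S ^ 12)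
    (by simp [Expr.eval, Op.eval, f2 7, h7])
    (fun i s => s 6 0 = normConst G.instrs ∧ s 7 0 = numBoxes G.instrs ∧
      s 9 0 = (numBoxes G.instrs + 1).choose i ∧
      (s 10 0 : ℤ) - s 11 0 = partialSum (numBoxes G.instrs)
        (fun k => (G.fourRegular hG.2 k).numEulerianTours) i)
    (by
      have h10 : s₁ 10 0 = 0 := by rw [f1 10 (by decide)]; rfl
      have h11 : s₁ 11 0 = 0 := by rw [f1 11 (by decide)]; rfl
      simp [Store.set, h6, h7, h10, h11, partialSum])
    (by
      rintro i hi s₃ ⟨h6, h7, h9, hsum⟩ h8 hf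
      have h0' : s₃ 0 = initStore G.encode 0 := by
        rw [hf 0 (by decide) (by decide) (by decide), f2 0 (by decide), f1 0 (by decide)]
      have h1' : s₃ 1 = initStore G.encode 1 := by
        rw [hf 1 (by decide) (by decide) (by decide), f2 1 (by decide), f1 1 (by decide)]
      obtain ⟨s₄, r4, h4⟩ := runs_termProg (O := O) hO hG.2 hS (Nat.lt_succ_iff.1 hi)
        (by rw [h0']; exact h0) (by rw [h1', h1]) h8 h9 hsum
      exact ⟨s₄, r4, h4⟩)
  obtain ⟨s₄, r4, h6₄⟩ := runs_doubleNorm (O := O) h7₃ h6₃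
  have hpos := (G.validCode_instrs hG.2).normConst_pos
  have key : s₃ 10 0 - s₃ 11 0 = 2 ^ (numBoxes G.instrs * numBoxes G.instrs) *
      normConst G.instrs * G.numEulerianTours := by
    have h := G.sum_numEulerianTours hG
    rw [partialSum] at hsum
    simp only [Nat.add_sub_cancel] at hsum
    rw [h] at hsum
    -- The difference equals a nonnegative number, so the truncated subtraction of the program is
    -- exact.
    zify [show s₃ 11 0 ≤ s₃ 10 0 by
      have : (0 : ℤ) ≤ (s₃ 10 0 : ℤ) - s₃ 11 0 := by rw [hsum]; positivity
      omega]
    rw [hsum]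
    ring
  have r5 := runs_setVar (O := O) (s := s₄) 0 (e := .op .div (.op .sub (var 10) (var 11)) (var 6))
    (v := G.numEulerianTours) (by
      simp only [Expr.eval, Op.eval]
      rw [r4.frame (A := 10) (by decide), r4.frame (A := 11) (by decide), key, h6₄]
      exact Nat.mul_div_cancel_left _ (by positivity))
  refine ⟨_, (r1.seq (r2.seq (r3.seq (r4.seq r5)))).mono ?_, by simp⟩
  generalize numBoxes G.instrs = D at *
  have hp1 : S ^ 6 ≤ S ^ 15 := Nat.pow_le_pow_right hS' (by decide)
  have hp2 : S ^ 3 ≤ S ^ 15 := Nat.pow_le_pow_right hS' (by decide)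
  have hp3 : 1 ≤ S ^ 15 := Nat.one_le_pow _ _ hS'
  have hp4 : 1 ≤ S ^ 3 := Nat.one_le_pow _ _ hS'
  have hp5 : 1 ≤ S ^ 12 := Nat.one_le_pow _ _ hS'
  have hDD : D * D ≤ S ^ 6 := by
    calc D * D ≤ S ^ 3 * S ^ 3 := by gcongr
      _ = S ^ 6 := by ring
  have hloop : (D + 1) * (2100 * S ^ 12 + 28) ≤ 4256 * S ^ 15 := by
    calc (D + 1) * (2100 * S ^ 12 + 28) ≤ (S ^ 3 + S ^ 3) * (2100 * S ^ 12 + 28 * S ^ 12) := by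
          gcongr; omega
      _ = 4256 * S ^ 15 := by ring
  simp only [Expr.weight, Nat.size_zero, Nat.size_one]
  omega

end Correctness

end OracleRAM

open OracleRAM in
theorem mainTheorem1 :
    (sharpET Multigraph.IsEulerian).PolyTimeTuringReducible
      (sharpET Multigraph.IsFourRegular) := by
  -- The cost bound T (b + T) with T = 6000 (b + 1)^15 and b ≤ (b + 1)^15; the constant is 6000 ·
  -- 6001.
  refine ⟨mainProg, 36006000 * (Polynomial.X + 1) ^ 30, fun O hO ⟨G, hG⟩ => ?_⟩
  change Outputs O mainProg G.encode G.numEulerianTours _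
  have hb := bounded_initStore G.encode
  have hlen := length_le_wordSize G.encode
  rw [G.length_encode] at hlen
  obtain ⟨s, ⟨t, ht, hbt⟩, hs⟩ := runs_mainProg (O := O) (fun H hH => hO ⟨H, hH⟩) hG
    (S := wordSize G.encode + 1) (by omega)
  refine ⟨s, t, ht, hs, (hbt _ hb).2.trans ?_⟩
  change _ ≤ Polynomial.eval (wordSize G.encode) _
  rw [Polynomial.eval_mul, Polynomial.eval_pow, Polynomial.eval_add, Polynomial.eval_X,
    Polynomial.eval_one, Polynomial.eval_ofNat]
  generalize wordSize G.encode = b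
  have h : b ≤ (b + 1) ^ 15 := (Nat.le_succ b).trans (Nat.le_self_pow (by decide) _)
  calc 6000 * (b + 1) ^ 15 * (b + 6000 * (b + 1) ^ 15)
      ≤ 6000 * (b + 1) ^ 15 * ((b + 1) ^ 15 + 6000 * (b + 1) ^ 15) := by gcongr
    _ = 36006000 * (b + 1) ^ 30 := by ring
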